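/- Let $p$ be a prime, $L$ a finite extension of $\mathbf{Q}_p$ with ring of integers $\mathcal{O}_L$, $G=\mathrm{GL}_n(\mathbf{Q}_p)$, $\kappa=2$ if $p=2$ and $\kappa=1$ otherwise, and $H=1+p^{\kappa}M_n(\mathbf{Z}_p)$. For $g\in G$ let $d(g,1)$ be the least $m\ge 0$ such that $H^{p^m}\subset gHg^{-1}$. Let $\Pi$ be an $L$-Banach space with a continuous $L$-linear action of $G$ having a central character, and admissible (the continuous dual $\Pi^*$ is a finitely generated module over the algebra $\Lambda(H)$ of $L$-valued measures on $H$); the action is not assumed to be unitary. Fix an ultrametric valuation $v_\Pi$ defining the topology of $\Pi$. Let $(h_{ij})_{1\le i,j\le n}$, $h_{ij}=1+p^{\kappa}E_{ij}$, be the standard minimal system of topological generators of $H$; for $\alpha\in\mathbf{N}^{n^2}$ put $b^{\alpha}=\prod_{i,j}(h_{ij}-1)^{\alpha_{ij}}$ (product in the lexicographic order), and for $h\ge 1$ put $r_h=\frac{1}{p^{h-1}(p-1)}$, $$\Pi^{(h)}=\{v\in\Pi:\ v_\Pi(b^{\alpha}v)-r_h|\alpha|\to\infty \text{ as } |\alpha|\to\infty\},\qquad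 v^{(h)}(v)=\inf_{\alpha}\bigl(v_\Pi(b^{\alpha}v)-r_h|\alpha|\bigr),$$ and let $\Pi_0^{(h)}=\{v\in\Pi^{(h)}: v^{(h)}(v)\ge 0\}$ be the unit ball of the Banach space $\Pi^{(h)}$. Let $\Pi^{\mathrm{an}}$ be the space of locally analytic vectors of $\Pi$ (those $v$ for which $g\mapsto g\cdot v$ is locally analytic on $G$), with the locally convex inductive limit topology of the spaces $\Pi^{(h)}$. Assume that $\Pi$ is coherent: there is an integer $m(\Pi)\geq 1$ such that $\Pi^{(h+k)}=\sum_{d(g,1)\le k} g\cdot\Pi^{(h)}$ for all $h\ge m(\Pi)$ and $k\ge 0$. Then $\Pi^{\mathrm{an}}=\bigcup_{h\ge 1}\Pi^{(h)}$, and $\Pi^{\mathrm{an}}$ has a universal unitary completion, that is, a unitary $L$-Banach representation $\widehat{\Pi^{\mathrm{an}}}$ of $G$ with a continuous $L$-linear $G$-equivariant map $\iota:\Pi^{\mathrm{an}}\to\widehat{\Pi^{\mathrm{an}}}$ through which every continuous $L$-linear $G$-equivariant map from $\Pi^{\mathrm{an}}$ to a unitary $L$-Banach representation of $G$ factors uniquely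 by a continuous $L$-linear $G$-equivariant map. More precisely, for every integer $m(\Pi)$ as above and every $h\ge m(\Pi)$, the $\mathcal{O}_L$-module $M=\sum_{g\in G}g\cdot\Pi_0^{(h)}$ is an open lattice of $\Pi^{\mathrm{an}}$ (an open $\mathcal{O}_L$-submodule that spans $\Pi^{\mathrm{an}}$ over $L$; it need not be $p$-adically separated), and $\widehat{\Pi^{\mathrm{an}}}$ is the completion of $\Pi^{\mathrm{an}}$ with respect to $M$: the space $L\otimes_{\mathcal{O}_L}\varprojlim_k M/p^kM$, with the topology for which the $p^j\varprojlim_k M/p^kM$ ($j\geq 0$) form a basis of neighbourhoods of $0$, with the induced action of $G$ and with the map $\iota$ given on $M$ by the natural map $M\to\varprojlim_k M/p^kM$, is a universal unitary completion of $\Pi^{\mathrm{an}}$. -/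

import Mathlib

open Filter Topology
open scoped TensorProduct NNReal

universe u v w x y

namespace UnitaryCompletion

noncomputable section

set_option linter.style.haveILetI false

/-! ### Unitary Banach representations and universal unitary completions -/

section General

variable {L : Type u} [NormedField L]
variable {G : Type x} [Group G] [TopologicalSpace G]

/-- A representation of a topological group on a topological `L`-vector space is a unitary Banach
representation if the action is (jointly) continuous and the topology is defined by a complete
ultrametric norm which is homogeneous for the absolute value of `L` and invariant under `G`. -/
structure IsUnitaryBanachRep {W : Type v} [AddCommGroup W] [Module L W] [TopologicalSpace W]
    (σ : Representation L G W) : Prop where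
  continuous_action : Continuous fun z : G × W => σ z.1 z.2
  exists_norm : ∃ N : Seminorm L W,
    (∀ a b : W, N (a + b) ≤ max (N a) (N b)) ∧
    (∀ a : W, N a = 0 → a = 0) ∧
    (∀ U : Set W, IsOpen U ↔ ∀ a ∈ U, ∃ ε : ℝ, 0 < ε ∧ ∀ b : W, N (b - a) < ε → b ∈ U) ∧
    (∀ s : ℕ → W, (∀ ε : ℝ, 0 < ε → ∃ k : ℕ, ∀ i ≥ k, ∀ j ≥ k, N (s i - s j) < ε) →
      ∃ a : W, Tendsto (fun i => N (s i - a)) atTop (𝓝 0)) ∧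
    (∀ (g : G) (a : W), N (σ g a) = N a)

/-- `ι : V → W` exhibits the unitary Banach representation `σ` on `W` as the universal unitary
completion of the representation `τ` on `V`. -/
structure IsUniversalUnitaryCompletion
    {V : Type v} [AddCommGroup V] [Module L V] [TopologicalSpace V]
    {W : Type y} [AddCommGroup W] [Module L W] [TopologicalSpace W]
    (τ : Representation L G V) (σ : Representation L G W) (ι : V →L[L] W) : Prop where
  unitary : IsUnitaryBanachRep σ
  equivariant : ∀ (g : G) (a : V), ι (τ g a) = σ g (ι a)
  universal : ∀ (B : Type w) [AddCommGroup B] [Module L B] [TopologicalSpace B]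
    (β : Representation L G B), IsUnitaryBanachRep β →
    ∀ f : V →L[L] B, (∀ (g : G) (a : V), f (τ g a) = β g (f a)) →
    ∃! F : W →L[L] B, (∀ (g : G) (b : W), F (σ g b) = β g (F b)) ∧ ∀ a : V, F (ι a) = f a

/-- The representation `τ` has a universal unitary completion. -/
def HasUniversalUnitaryCompletion
    {V : Type v} [AddCommGroup V] [Module L V] [TopologicalSpace V]
    (τ : Representation L G V) : Prop :=
  ∃ (W : Type (max u v)) (_ : AddCommGroup W) (_ : Module L W) (_ : TopologicalSpace W)
    (σ : Representation L G W) (ι : V →L[L] W),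
    IsUniversalUnitaryCompletion.{u, v, w, x, max u v} τ σ ι

end General

/-! ### Completion of a vector space with respect to a lattice -/

section LatticeCompletion

variable (p : ℕ) {L : Type u} [NormedField L] [IsUltrametricDist L]

variable (L) in
/-- The ring of integers `𝒪_L = {a ∈ L : ‖a‖ ≤ 1}`. -/
abbrev OL : Subring L := (NormedField.valuation (K := L)).integer

variable (L) in
/-- The ideal `(p)` of `𝒪_L`. -/
def idealP : Ideal (OL L) := Ideal.span {(p : OL L)}

variable {V : Type v} [AddCommGroup V] [Module L V]

/-- `L ⊗_{𝒪_L} lim_k M / p^k M`: the completion of `V` with respect to a lattice `M ⊆ V`. -/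
def LatticeCompletion (M : Submodule (OL L) V) : Type (max u v) :=
  L ⊗[OL L] AdicCompletion (idealP p L) M

variable (M : Submodule (OL L) V)

instance : AddCommGroup (LatticeCompletion p M) :=
  inferInstanceAs (AddCommGroup (L ⊗[OL L] AdicCompletion (idealP p L) M))

instance : Module L (LatticeCompletion p M) :=
  inferInstanceAs (Module L (L ⊗[OL L] AdicCompletion (idealP p L) M))

/-- The map `z ↦ 1 ⊗ z` from `lim_k M / p^k M` to the completion. -/
def LatticeCompletion.ofInt :
    AdicCompletion (idealP p L) M →ₗ[OL L] L ⊗[OL L] AdicCompletion (idealP p L) M :=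
  TensorProduct.mk (OL L) L (AdicCompletion (idealP p L) M) 1

/-- The element `1 ⊗ z` of the completion. -/
def LatticeCompletion.int (z : AdicCompletion (idealP p L) M) : LatticeCompletion p M :=
  LatticeCompletion.ofInt p M z

lemma LatticeCompletion.int_pow_smul (k : ℕ) (z : AdicCompletion (idealP p L) M) :
    LatticeCompletion.int p M (((p : OL L) ^ k) • z)
      = ((p : L) ^ k) • LatticeCompletion.int p M z := by
  unfold LatticeCompletion.int
  rw [map_smul]
  change ((p : OL L) ^ k) • (LatticeCompletion.ofInt p M z)
    = ((p : L) ^ k) • (LatticeCompletion.ofInt p M z)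
  rw [← algebraMap_smul L ((p : OL L) ^ k)]
  simp

/-- The topology of the completion: the sets `p^k (lim_j M / p^j M)` form a basis of
neighbourhoods of `0`. -/
instance : TopologicalSpace (LatticeCompletion p M) where
  IsOpen U := ∀ a ∈ U, ∃ k : ℕ, ∀ z : AdicCompletion (idealP p L) M,
    a + ((p : L) ^ k) • LatticeCompletion.int p M z ∈ U
  isOpen_univ := fun _ _ => ⟨0, fun _ => Set.mem_univ _⟩
  isOpen_inter := by
    rintro U U' hU hU' a ⟨ha, ha'⟩
    obtain ⟨k, hk⟩ := hU a ha
    obtain ⟨k', hk'⟩ := hU' a ha'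
    refine ⟨k + k', fun z => ⟨?_, ?_⟩⟩
    · have := hk (((p : OL L) ^ k') • z)
      rwa [LatticeCompletion.int_pow_smul, smul_smul, ← pow_add] at this
    · have := hk' (((p : OL L) ^ k) • z)
      rwa [LatticeCompletion.int_pow_smul, smul_smul, ← pow_add, add_comm k' k] at this
  isOpen_sUnion := by
    rintro S hS a ⟨U, hU, ha⟩
    obtain ⟨k, hk⟩ := hS U hU a ha
    exact ⟨k, fun z => ⟨U, hU, hk z⟩⟩

variable {G : Type x} [Group G]

/-- The action of `g` on a `G`-stable lattice. -/
def latticeAction (τ : Representation L G V)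
    (hM : ∀ g : G, ∀ a ∈ M, τ g a ∈ M) (g : G) : M →ₗ[OL L] M :=
  ((τ g).restrictScalars (OL L)).restrict (hM g)

lemma latticeAction_one (τ : Representation L G V) (hM : ∀ g : G, ∀ a ∈ M, τ g a ∈ M) :
    latticeAction M τ hM 1 = LinearMap.id := by
  apply LinearMap.ext
  intro a
  apply Subtype.ext
  change τ 1 a = a
  rw [map_one]; rfl

lemma latticeAction_mul (τ : Representation L G V) (hM : ∀ g : G, ∀ a ∈ M, τ g a ∈ M)
    (g g' : G) :
    latticeAction M τ hM (g * g') = latticeAction M τ hM g ∘ₗ latticeAction M τ hM g' := by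
  apply LinearMap.ext
  intro a
  apply Subtype.ext
  change τ (g * g') a = τ g (τ g' a)
  rw [map_mul]; rfl

/-- The endomorphism of `L ⊗_{𝒪_L} lim_k M / p^k M` induced by an endomorphism of `M`. -/
def completionMap (f : M →ₗ[OL L] M) :
    L ⊗[OL L] AdicCompletion (idealP p L) M →ₗ[L] L ⊗[OL L] AdicCompletion (idealP p L) M :=
  ((AdicCompletion.map (idealP p L) f).restrictScalars (OL L)).baseChange L

lemma completionMap_id : completionMap p M LinearMap.id = LinearMap.id := by
  unfold completionMap
  rw [AdicCompletion.map_id]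
  exact LinearMap.baseChange_id

lemma completionMap_comp (f f' : M →ₗ[OL L] M) :
    completionMap p M (f ∘ₗ f') = completionMap p M f ∘ₗ completionMap p M f' := by
  unfold completionMap
  rw [← AdicCompletion.map_comp, ← LinearMap.baseChange_comp]
  rfl

/-- The action of `G` on the completion with respect to a `G`-stable lattice. -/
def latticeCompletionRep (τ : Representation L G V)
    (hM : ∀ g : G, ∀ a ∈ M, τ g a ∈ M) : Representation L G (LatticeCompletion p M) :=
  let φ : Representation L G (L ⊗[OL L] AdicCompletion (idealP p L) M) :=
    { toFun := fun g => completionMap p M (latticeAction M τ hM g)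
      map_one' := by rw [latticeAction_one, completionMap_id]; rfl
      map_mul' := fun g g' => by rw [latticeAction_mul, completionMap_comp]; rfl }
  φ

end LatticeCompletion

/-! ### Banach representations of `GL_n(ℚ_p)` -/

section GLn

variable {p : ℕ} [Fact p.Prime] {n : ℕ}

variable (p) in
/-- `κ = 2` if `p = 2` and `κ = 1` otherwise. -/
def kappa : ℕ := if p = 2 then 2 else 1

variable (p) in
/-- `r_h = 1 / (p^(h-1) (p-1))`, for `h ≥ 1`. -/
def radius (h : ℕ) : ℝ := 1 / ((p : ℝ) ^ (h - 1) * ((p : ℝ) - 1))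

variable (p n) in
/-- The uniform pro-`p` group `H = 1 + p^κ M_n(ℤ_p)`, as a subgroup of `GL_n(ℚ_p)`: the image of
the kernel of `GL_n(ℤ_p) → GL_n(ℤ/p^κ)`. -/
def H : Subgroup (GL (Fin n) ℚ_[p]) :=
  (Matrix.GeneralLinearGroup.map (n := Fin n)
    (PadicInt.toZModPow (p := p) (kappa p))).ker.map
  (Matrix.GeneralLinearGroup.map (n := Fin n) (algebraMap ℤ_[p] ℚ_[p]))

/-- `d(g,1)`: the least `m` such that `H^(p^m) ⊆ g H g⁻¹`. -/
def dist1 (g : GL (Fin n) ℚ_[p]) : ℕ :=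
  sInf {m : ℕ | ∀ a ∈ H p n, g⁻¹ * a ^ (p ^ m) * g ∈ H p n}

lemma one_add_kappa_ne_zero : (1 : ℚ_[p]) + (p : ℚ_[p]) ^ kappa p ≠ 0 := by
  have : ((1 + p ^ kappa p : ℕ) : ℚ_[p]) ≠ 0 := by
    rw [Nat.cast_ne_zero]; omega
  simpa using this

lemma det_generator_ne_zero (i j : Fin n) :
    ((1 : Matrix (Fin n) (Fin n) ℚ_[p])
      + Matrix.single i j ((p : ℚ_[p]) ^ kappa p)).det ≠ 0 := by
  by_cases hij : i = j
  · subst hij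
    have : ((1 : Matrix (Fin n) (Fin n) ℚ_[p]) + Matrix.single i i ((p : ℚ_[p]) ^ kappa p))
        = Matrix.diagonal (fun k => 1 + if k = i then (p : ℚ_[p]) ^ kappa p else 0) := by
      ext a b
      by_cases hab : a = b
      · subst hab
        by_cases hai : a = i
        · subst hai; simp
        · simp [hai, Ne.symm hai]
      · have : ¬ (i = a ∧ i = b) := fun h => hab (h.1.symm.trans h.2)
        simp [hab, this]
    rw [this, Matrix.det_diagonal, Finset.prod_ne_zero_iff]
    intro k _
    split_ifs
    · exact one_add_kappa_ne_zero
    · simp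
  · have := Matrix.det_transvection_of_ne i j hij ((p : ℚ_[p]) ^ kappa p)
    rw [Matrix.transvection] at this
    rw [this]
    exact one_ne_zero

variable (p) in
/-- The minimal system of topological generators `h_{ij} = 1 + p^κ E_{ij}` of `H`. -/
def generator (ij : Fin n × Fin n) : GL (Fin n) ℚ_[p] :=
  Matrix.GeneralLinearGroup.mkOfDetNeZero
    (1 + Matrix.single ij.1 ij.2 ((p : ℚ_[p]) ^ kappa p)) (det_generator_ne_zero ij.1 ij.2)

/-- The total degree `|α|`. -/
def degree (α : Fin n × Fin n → ℕ) : ℕ := ∑ ij, α ij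

section Algebraic

variable {L : Type u} [NormedField L] {E : Type v} [AddCommGroup E] [Module L E]

/-- `b^α = ∏ (h_{ij} - 1)^(α_{ij})`, the (noncommutative) product being taken in the
lexicographic order of the indices, acting on `E`. -/
def bOp (ρ : Representation L (GL (Fin n) ℚ_[p]) E) (α : Fin n × Fin n → ℕ) : Module.End L E :=
  ((List.finRange n ×ˢ List.finRange n).map
    fun ij => (ρ (generator p ij) - 1) ^ (α ij)).prod

/-- The restriction of `ρ` to the centre is given by a continuous character. -/
def HasCentralCharacter (ρ : Representation L (GL (Fin n) ℚ_[p]) E) : Prop :=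
  ∃ δ : ℚ_[p]ˣ →* Lˣ, Continuous δ ∧ ∀ (a : ℚ_[p]ˣ) (g : GL (Fin n) ℚ_[p]),
    (g : Matrix (Fin n) (Fin n) ℚ_[p]) = Matrix.scalar (Fin n) (a : ℚ_[p]) →
    ∀ e : E, ρ g e = (δ a : L) • e

end Algebraic

section Banach

variable {L : Type u} [NormedField L] [NormedAlgebra ℚ_[p] L]
variable {E : Type v} [NormedAddCommGroup E] [NormedSpace L E]

/-- `ρ` is a continuous action. -/
def IsContinuousRep (ρ : Representation L (GL (Fin n) ℚ_[p]) E) : Prop :=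
  Continuous fun z : GL (Fin n) ℚ_[p] × E => ρ z.1 z.2

/-- The continuous function `a ↦ l(a⁻¹ e)` on `H`. -/
def coefficient {ρ : Representation L (GL (Fin n) ℚ_[p]) E} (hρ : IsContinuousRep ρ)
    (l : E →L[L] L) (e : E) : C(H p n, L) where
  toFun a := l (ρ (a : GL (Fin n) ℚ_[p])⁻¹ e)
  continuous_toFun := by
    have h1 : Continuous fun a : H p n => ((a : GL (Fin n) ℚ_[p])⁻¹, e) := by fun_prop
    exact l.continuous.comp (hρ.comp h1)

/-- Admissibility: the dual `E*` is finitely generated over `Λ(H)`, the algebra of `L`-valued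
measures on `H` (the continuous dual of `C(H, L)`). A measure `μ` acts on `l ∈ E*` by
`(μ l)(e) = ∫ l(a⁻¹ e) dμ(a)`. -/
def IsAdmissible {ρ : Representation L (GL (Fin n) ℚ_[p]) E} (hρ : IsContinuousRep ρ) : Prop :=
  ∃ (r : ℕ) (l : Fin r → (E →L[L] L)), ∀ l' : E →L[L] L,
    ∃ μ : Fin r → (C(H p n, L) →L[L] L), ∀ e : E, l' e = ∑ i, μ i (coefficient hρ (l i) e)

/-- The norm `‖e‖_h = sup_α p^(r_h |α|) ‖b^α e‖`, that is, the exponential of minus the valuation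
`v^(h)(e) = inf_α (v(b^α e) - r_h |α|)`; it is meaningful on the space `Π^(h)` below. -/
def normH (ρ : Representation L (GL (Fin n) ℚ_[p]) E) (h : ℕ) (e : E) : ℝ :=
  ⨆ α : Fin n × Fin n → ℕ, (p : ℝ) ^ (radius p h * degree α) * ‖bOp ρ α e‖

/-- The space `Π^(h)` of the vectors `e` such that `v(b^α e) - r_h |α| → ∞` when `|α| → ∞`. -/
def PiH (ρ : Representation L (GL (Fin n) ℚ_[p]) E) (h : ℕ) : Submodule L E where
  carrier := {e | Tendsto (fun α : Fin n × Fin n → ℕ =>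
    (p : ℝ) ^ (radius p h * degree α) * ‖bOp ρ α e‖) cofinite (𝓝 0)}
  zero_mem' := by simp [tendsto_const_nhds]
  add_mem' := by
    intro a b ha hb
    have hab := Tendsto.add ha hb
    rw [add_zero] at hab
    refine squeeze_zero (fun α => by positivity) (fun α => ?_) hab
    rw [map_add, ← mul_add]
    exact mul_le_mul_of_nonneg_left (norm_add_le _ _) (by positivity)
  smul_mem' := by
    intro c a ha
    have hca := Tendsto.const_mul ‖c‖ ha
    rw [mul_zero] at hca
    refine hca.congr (fun α => ?_)
    rw [map_smul, norm_smul]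
    ring

/-- `ρ` is coherent from `m` on: for all `h ≥ m` and `k ≥ 0`, one has
`Π^(h+k) = ∑_{d(g,1) ≤ k} g Π^(h)`. -/
def IsCoherentFrom (ρ : Representation L (GL (Fin n) ℚ_[p]) E) (m : ℕ) : Prop :=
  1 ≤ m ∧ ∀ h ≥ m, ∀ k : ℕ,
    PiH ρ (h + k) = ⨆ (g : GL (Fin n) ℚ_[p]) (_ : dist1 g ≤ k), (PiH ρ h).map (ρ g)

/-- `ρ` is coherent. -/
def IsCoherent (ρ : Representation L (GL (Fin n) ℚ_[p]) E) : Prop :=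
  ∃ m, IsCoherentFrom ρ m

/-- A function on `GL_n(ℚ_p)` is locally analytic if, near each point, it is given by a convergent
power series in the matrix entries. -/
def IsLocallyAnalytic (L : Type u) [NormedField L] [NormedAlgebra ℚ_[p] L]
    {E : Type v} [NormedAddCommGroup E] [NormedSpace L E] (f : GL (Fin n) ℚ_[p] → E) : Prop :=
  letI : NormedSpace ℚ_[p] E := NormedSpace.restrictScalars ℚ_[p] L E
  ∀ g : GL (Fin n) ℚ_[p], ∃ F : (Fin n → Fin n → ℚ_[p]) → E,
    AnalyticAt ℚ_[p] F (fun i j => g i j) ∧ ∀ᶠ a in 𝓝 g, f a = F (fun i j => a i j)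

lemma IsLocallyAnalytic.add {f f' : GL (Fin n) ℚ_[p] → E} (hf : IsLocallyAnalytic L f)
    (hf' : IsLocallyAnalytic L f') : IsLocallyAnalytic L (fun a => f a + f' a) := by
  letI : NormedSpace ℚ_[p] E := NormedSpace.restrictScalars ℚ_[p] L E
  intro g
  obtain ⟨F, hF, h⟩ := hf g
  obtain ⟨F', hF', h'⟩ := hf' g
  refine ⟨F + F', hF.add hF', ?_⟩
  filter_upwards [h, h'] with a ha ha'
  simp [ha, ha']

lemma IsLocallyAnalytic.smul (c : L) {f : GL (Fin n) ℚ_[p] → E} (hf : IsLocallyAnalytic L f) :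
    IsLocallyAnalytic L (fun a => c • f a) := by
  letI : NormedSpace ℚ_[p] E := NormedSpace.restrictScalars ℚ_[p] L E
  haveI : IsScalarTower ℚ_[p] L E := IsScalarTower.restrictScalars ℚ_[p] L E
  intro g
  obtain ⟨F, hF, h⟩ := hf g
  let T : E →L[ℚ_[p]] E := (c • ContinuousLinearMap.id L E).restrictScalars ℚ_[p]
  refine ⟨fun a => T (F a), (T.analyticAt _).comp hF, ?_⟩
  filter_upwards [h] with a ha
  simp [ha, T]

lemma IsLocallyAnalytic.mul_right {f : GL (Fin n) ℚ_[p] → E} (hf : IsLocallyAnalytic L f)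
    (b : GL (Fin n) ℚ_[p]) : IsLocallyAnalytic L (fun a => f (a * b)) := by
  letI : NormedSpace ℚ_[p] E := NormedSpace.restrictScalars ℚ_[p] L E
  intro g
  obtain ⟨F, hF, h⟩ := hf (g * b)
  let T₀ : (Fin n → Fin n → ℚ_[p]) →ₗ[ℚ_[p]] (Fin n → Fin n → ℚ_[p]) :=
    { toFun := fun a i j => ∑ k, a i k * b k j
      map_add' := fun a a' => by
        ext i j; simp [add_mul, Finset.sum_add_distrib]
      map_smul' := fun c a => by
        ext i j; simp [Finset.mul_sum, mul_assoc] }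
  let T : (Fin n → Fin n → ℚ_[p]) →L[ℚ_[p]] (Fin n → Fin n → ℚ_[p]) :=
    LinearMap.toContinuousLinearMap T₀
  have hT : ∀ a : GL (Fin n) ℚ_[p], T (fun i j => a i j) = fun i j => (a * b) i j := by
    intro a
    ext i j
    simp [T, T₀, Matrix.mul_apply]
  refine ⟨fun a => F (T a), ?_, ?_⟩
  · have hF' : AnalyticAt ℚ_[p] F (T fun i j => g i j) := by rw [hT]; exact hF
    exact hF'.comp (T.analyticAt _)
  · have hc : Tendsto (fun a : GL (Fin n) ℚ_[p] => a * b) (𝓝 g) (𝓝 (g * b)) :=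
      (continuous_mul_const b).tendsto g
    filter_upwards [hc.eventually h] with a ha
    rw [ha, hT]

/-- The subspace `Π^an` of the locally analytic vectors: those `e` whose orbit map `g ↦ g e` is
locally analytic on `GL_n(ℚ_p)`. -/
def analyticSubmodule (ρ : Representation L (GL (Fin n) ℚ_[p]) E) : Submodule L E where
  carrier := {e | IsLocallyAnalytic L fun g => ρ g e}
  zero_mem' := by
    intro g
    letI : NormedSpace ℚ_[p] E := NormedSpace.restrictScalars ℚ_[p] L E
    exact ⟨fun _ => 0, analyticAt_const, by simp⟩
  add_mem' := by
    intro a b ha hb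
    have := IsLocallyAnalytic.add ha hb
    simpa using this
  smul_mem' := by
    intro c a ha
    have := IsLocallyAnalytic.smul c ha
    simpa using this

lemma analyticSubmodule_stable (ρ : Representation L (GL (Fin n) ℚ_[p]) E)
    (g : GL (Fin n) ℚ_[p]) : ∀ e ∈ analyticSubmodule ρ, ρ g e ∈ analyticSubmodule ρ := by
  intro e he
  have := IsLocallyAnalytic.mul_right (show IsLocallyAnalytic L fun a => ρ a e from he) g
  change IsLocallyAnalytic L fun a => ρ a (ρ g e)
  simpa using this

/-- The space `Π^an`, which carries a topology finer than that of a subspace of `Π`. -/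
def AnalyticVectors (ρ : Representation L (GL (Fin n) ℚ_[p]) E) : Type v :=
  analyticSubmodule ρ

variable (ρ : Representation L (GL (Fin n) ℚ_[p]) E)

instance : AddCommGroup (AnalyticVectors ρ) :=
  inferInstanceAs (AddCommGroup (analyticSubmodule ρ))

instance : Module L (AnalyticVectors ρ) :=
  inferInstanceAs (Module L (analyticSubmodule ρ))

/-- The inclusion `Π^an → Π`. -/
def AnalyticVectors.incl : AnalyticVectors ρ →ₗ[L] E := (analyticSubmodule ρ).subtype

/-- The action of `GL_n(ℚ_p)` on `Π^an`. -/
def analyticRep : Representation L (GL (Fin n) ℚ_[p]) (AnalyticVectors ρ) where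
  toFun g := (ρ g).restrict (analyticSubmodule_stable ρ g)
  map_one' := by
    apply LinearMap.ext
    intro a
    apply Subtype.ext
    simp only [map_one]
    rfl
  map_mul' g g' := by
    apply LinearMap.ext
    intro a
    apply Subtype.ext
    simp only [map_mul]
    rfl

section Lattices

variable [IsUltrametricDist L]

/-- The trace on each `Π^(h)`, `h ≥ 1`, of the `𝒪_L`-submodule `W` of `Π^an` is open in the Banach
space `Π^(h)`. -/
def IsOpenInEachPiH (W : Submodule (OL L) (AnalyticVectors ρ)) : Prop :=
  ∀ h ≥ 1, ∃ ε : ℝ, 0 < ε ∧ ∀ a : AnalyticVectors ρ,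
    AnalyticVectors.incl ρ a ∈ PiH ρ h → normH ρ h (AnalyticVectors.incl ρ a) ≤ ε → a ∈ W

/-- The topology of `Π^an` as the locally convex inductive limit of the Banach spaces `Π^(h)`:
the `𝒪_L`-submodules whose trace on each `Π^(h)` is open form a basis of neighbourhoods of `0`. -/
instance : TopologicalSpace (AnalyticVectors ρ) where
  IsOpen U := ∀ a ∈ U, ∃ W : Submodule (OL L) (AnalyticVectors ρ),
    IsOpenInEachPiH ρ W ∧ ∀ b ∈ W, a + b ∈ U
  isOpen_univ := fun _ _ => ⟨⊤, fun _ _ => ⟨1, one_pos, fun _ _ _ => Submodule.mem_top⟩,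
    fun _ _ => Set.mem_univ _⟩
  isOpen_inter := by
    rintro U U' hU hU' a ⟨ha, ha'⟩
    obtain ⟨W, hW, h⟩ := hU a ha
    obtain ⟨W', hW', h'⟩ := hU' a ha'
    refine ⟨W ⊓ W', fun k hk => ?_, fun b hb => ⟨h b hb.1, h' b hb.2⟩⟩
    obtain ⟨ε, hε, H₁⟩ := hW k hk
    obtain ⟨ε', hε', H₂⟩ := hW' k hk
    exact ⟨min ε ε', lt_min hε hε', fun b hb hb' =>
      ⟨H₁ b hb (hb'.trans (min_le_left _ _)), H₂ b hb (hb'.trans (min_le_right _ _))⟩⟩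
  isOpen_sUnion := by
    rintro S hS a ⟨U, hU, ha⟩
    obtain ⟨W, hW, h⟩ := hS U hU a ha
    exact ⟨W, hW, fun b hb => ⟨U, hU, h b hb⟩⟩

/-- The `𝒪_L`-submodule `M = ∑_g g Π_0^(h)` of `Π^an`, where `Π_0^(h)` is the unit ball of `Π^(h)`
for the norm `‖·‖_h` (the span of the union of the `g Π_0^(h)`). -/
def latticeM (h : ℕ) : Submodule (OL L) (AnalyticVectors ρ) :=
  Submodule.span (OL L) {a | ∃ (g : GL (Fin n) ℚ_[p]) (b : AnalyticVectors ρ),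
    AnalyticVectors.incl ρ b ∈ PiH ρ h ∧ normH ρ h (AnalyticVectors.incl ρ b) ≤ 1 ∧
    a = analyticRep ρ g b}

lemma latticeM_stable (h : ℕ) (g : GL (Fin n) ℚ_[p]) :
    ∀ a ∈ latticeM ρ h, analyticRep ρ g a ∈ latticeM ρ h := by
  intro a ha
  refine Submodule.span_induction (p := fun a _ => analyticRep ρ g a ∈ latticeM ρ h)
    ?_ ?_ ?_ ?_ ha
  · rintro _ ⟨g', b, hb, hb', rfl⟩
    refine Submodule.subset_span ⟨g * g', b, hb, hb', ?_⟩
    rw [map_mul]; rfl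
  · rw [map_zero]; exact Submodule.zero_mem _
  · intro a b _ _ ha hb
    rw [map_add]; exact Submodule.add_mem _ ha hb
  · intro c a _ ha
    have : analyticRep ρ g (c • a) = c • analyticRep ρ g a :=
      (analyticRep ρ g).map_smul (c : L) a
    rw [this]; exact Submodule.smul_mem _ c ha

end Lattices

end Banach

end GLn

end

end UnitaryCompletion

namespace UnitaryCompletion

noncomputable section

/-! ### The lattice `lim_k M / p^k M` inside its `L`-linear extension -/

section LatticeStructure

variable {p : ℕ} {L : Type u} [NormedField L] [IsUltrametricDist L]
variable {V : Type v} [AddCommGroup V] [Module L V] {M : Submodule (OL L) V}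

/-! Let `M` be the sum of the `g Π_0^(h)`. A continuous equivariant map `f` from Π^an to a unitary
representation is bounded on Π_0^(h), by continuity on Π^(h). An invariant ultrametric norm carries
the same bound to each `g Π_0^(h)` and to their sum (`exists_bound_latticeM`). A map bounded on `M`
extends to the `p`-adic completion of `M` (`exists_extension`), uniquely because Π^an has dense
image. It remains to see that `M` is an open lattice and that the action on the completion is
continuous.

Openness comes from coherence. For `h ≥ m` the case `k = 0` makes Π^(h) stable under `H`, so `g
Π^(h)` depends only on the coset `gH`, and there are countably many cosets. Thus Π^(h+k) is a sum of
countably many continuous images of Π^(h); Baire's theorem and the successive approximations of the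
open mapping theorem put a ball of Π^(h+k) inside `M` (`exists_ball_subset_of_iSup_range_eq_top`).

The equality of Π^an with the union of the Π^(h) has two halves. If `v` is locally analytic, the
finite differences of `g ↦ g v` along the one-parameter subgroups of the generators decay
geometrically (`exists_local_decay`). Compactness of `H` and the boundedness of the ring of
operators it generates turn this into `‖b^α v‖ ≤ C θ^|α|` with `θ < 1` (`exists_bOp_decay`); since
`r_h → 0`, `v` lies in Π^(h) for large `h`. The same estimate makes the orbit map continuous at `1`
for the norm of Π^(h), whence the continuity of the action on the completion.

Conversely, if `v ∈ Π^(h)` and `g = ∏ h_ij^(x_ij)`, then `g v` is the sum of the `binom(x, α) b^α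
v`. This Mahler series is analytic near `0` because it is a coefficient of `∏ (1 + T_ij)^(x_ij)` for
topologically nilpotent weighted shifts `T_ij` (`exists_analyticAt_mahler`), and the inverse
function theorem expresses `x` analytically in the entries of `g`. -/

lemma mem_OL {c : L} : c ∈ OL L ↔ ‖c‖ ≤ 1 := by
  rw [Valuation.mem_integer_iff, NormedField.valuation_apply]
  exact Iff.rfl

lemma exists_pow_mul_mem_OL (hp : ‖(p : L)‖ < 1) (c : L) : ∃ k : ℕ, (p : L) ^ k * c ∈ OL L := by
  have h : Tendsto (fun k : ℕ => ‖(p : L)‖ ^ k * ‖c‖) atTop (𝓝 (0 * ‖c‖)) :=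
    (tendsto_pow_atTop_nhds_zero_of_lt_one (norm_nonneg _) hp).mul_const _
  rw [zero_mul] at h
  obtain ⟨k, hk⟩ := (h.eventually (gt_mem_nhds zero_lt_one)).exists
  refine ⟨k, mem_OL.2 ?_⟩
  rw [norm_mul, norm_pow]
  exact hk.le

lemma mem_idealP_pow_smul {N : Type*} [AddCommGroup N] [Module (OL L) N] {k : ℕ} {a : N} :
    a ∈ (idealP p L ^ k • ⊤ : Submodule (OL L) N) ↔ ∃ b : N, ((p : OL L) ^ k) • b = a := by
  rw [idealP, Ideal.span_singleton_pow, Submodule.ideal_span_singleton_smul,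
    Submodule.mem_smul_pointwise_iff_exists]
  simp

lemma pow_smul_coe (k : ℕ) (a : M) : ((((p : OL L) ^ k) • a : M) : V) = ((p : L) ^ k) • (a : V) := by
  rw [Submodule.coe_smul, ← algebraMap_smul L ((p : OL L) ^ k)]
  simp

lemma pow_smul_injective (hp : (p : L) ≠ 0) (k : ℕ) {a b : M}
    (h : ((p : OL L) ^ k) • a = ((p : OL L) ^ k) • b) : a = b := by
  have h' := congrArg (Subtype.val) h
  rw [pow_smul_coe, pow_smul_coe] at h'
  exact Subtype.ext (smul_right_injective V (pow_ne_zero k hp) h')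

/-- The ideal `(p)` is finitely generated, so the kernel of `lim M / p^j M → M / p^k M` is `p^k`
times the limit. This translates congruences into divisibility throughout. -/
lemma eval_eq_zero_iff {k : ℕ} {z : AdicCompletion (idealP p L) M} :
    z.val k = 0 ↔ ∃ z', ((p : OL L) ^ k) • z' = z := by
  have h := AdicCompletion.pow_smul_top_eq_ker_eval (M := M) (I := idealP p L) (n := k)
    ⟨{(p : OL L)}, by simp [idealP]⟩
  rw [← mem_idealP_pow_smul, h, LinearMap.mem_ker]
  rfl

/-- `M` sits in an `L`-vector space and has no torsion. If `a` lifts the component of `z` at level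
`k + 1`, then `p a ∈ p^(k+1) M` forces `a ∈ p^k M`, so the component at level `k` vanishes. -/
lemma eq_zero_of_smul_eq_zero (hp : (p : L) ≠ 0) {z : AdicCompletion (idealP p L) M}
    (hz : (p : OL L) • z = 0) : z = 0 := by
  apply AdicCompletion.ext
  intro k
  obtain ⟨a, ha⟩ := Submodule.Quotient.mk_surjective _ (z.val (k + 1))
  have h1 : (p : OL L) • (z.val (k + 1)) = 0 := by
    rw [← AdicCompletion.val_smul_apply, hz]; rfl
  rw [← ha, ← Submodule.Quotient.mk_smul, Submodule.Quotient.mk_eq_zero,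
    mem_idealP_pow_smul] at h1
  obtain ⟨b, hb⟩ := h1
  have h2 : ((p : OL L) ^ k) • b = a := by
    apply pow_smul_injective hp 1
    rw [pow_one, ← hb, pow_succ', mul_smul]
  have h3 := z.prop (Nat.le_succ k)
  rw [← h3]
  change AdicCompletion.transitionMap _ _ _ (z.val (k + 1)) = 0
  rw [← ha]
  exact (Submodule.Quotient.mk_eq_zero _).2 (mem_idealP_pow_smul.2 ⟨b, h2⟩)

lemma eq_zero_of_pow_smul_eq_zero (hp : (p : L) ≠ 0) (k : ℕ) {z : AdicCompletion (idealP p L) M}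
    (hz : (p : OL L) ^ k • z = 0) : z = 0 := by
  induction k with
  | zero => simpa using hz
  | succ k ih =>
    rw [pow_succ', mul_smul] at hz
    exact ih (eq_zero_of_smul_eq_zero hp hz)

/-- A power of `p` clears any denominator of `L`. Hence tensoring with `L` is inverting `p`, and the
kernel of `int` consists of `p`-power torsion. -/
lemma isLocalization_powers (hp0 : (p : L) ≠ 0) (hp : ‖(p : L)‖ < 1) :
    IsLocalization (Submonoid.powers (p : OL L)) L where
  map_units := by
    rintro ⟨_, k, rfl⟩
    simpa using fun h => absurd h hp0
  surj c := by
    obtain ⟨k, hk⟩ := exists_pow_mul_mem_OL hp c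
    refine ⟨⟨⟨_, hk⟩, ⟨_, k, rfl⟩⟩, ?_⟩
    simp only [map_pow, map_natCast]
    exact mul_comm _ _
  exists_of_eq {a b} h := ⟨1, by rw [Subtype.ext h]⟩

namespace LatticeCompletion

lemma int_injective (hp0 : (p : L) ≠ 0) (hp : ‖(p : L)‖ < 1) :
    Function.Injective (int p M) := by
  have := isLocalization_powers (p := p) (L := L) hp0 hp
  have h : IsLocalizedModule (Submonoid.powers (p : OL L)) (ofInt p M) :=
    (isLocalizedModule_iff_isBaseChange _ L _).2 (TensorProduct.isBaseChange _ _ _)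
  intro a b hab
  obtain ⟨⟨_, k, rfl⟩, hk⟩ := (IsLocalizedModule.eq_iff_exists (Submonoid.powers (p : OL L))
    (ofInt p M)).1 hab
  rw [← sub_eq_zero] at hk ⊢
  change ((p : OL L) ^ k) • a - ((p : OL L) ^ k) • b = 0 at hk
  rw [← smul_sub] at hk
  exact eq_zero_of_pow_smul_eq_zero hp0 k hk

lemma int_add (a b : AdicCompletion (idealP p L) M) : int p M (a + b) = int p M a + int p M b :=
  map_add (ofInt p M) a b

lemma int_sub (a b : AdicCompletion (idealP p L) M) : int p M (a - b) = int p M a - int p M b :=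
  map_sub (ofInt p M) a b

lemma int_zero : int p M 0 = 0 := map_zero (ofInt p M)

lemma int_smul (c : OL L) (a : AdicCompletion (idealP p L) M) :
    int p M (c • a) = (c : L) • int p M a := by
  unfold int
  rw [map_smul]
  change c • (ofInt p M a) = (c : L) • (ofInt p M a)
  rw [← algebraMap_smul L c]
  rfl

lemma exists_pow_smul_eq_int (hp : ‖(p : L)‖ < 1) (a : LatticeCompletion p M) :
    ∃ (k : ℕ) (z : AdicCompletion (idealP p L) M), ((p : L) ^ k) • a = int p M z := by
  refine TensorProduct.induction_on (motive := fun a : L ⊗[OL L] AdicCompletion (idealP p L) M =>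
    ∃ (k : ℕ) (z : AdicCompletion (idealP p L) M), ((p : L) ^ k) • a = ofInt p M z) a ?_ ?_ ?_
  · exact ⟨0, 0, by simp⟩
  · intro c z
    obtain ⟨k, hk⟩ := exists_pow_mul_mem_OL hp c
    refine ⟨k, (⟨_, hk⟩ : OL L) • z, ?_⟩
    rw [TensorProduct.smul_tmul', map_smul]
    change _ = _ • ((1 : L) ⊗ₜ[OL L] z)
    rw [TensorProduct.smul_tmul']
    congr 1
    change _ = (_ : L) * 1
    rw [mul_one]; rfl
  · rintro a b ⟨k, z, hz⟩ ⟨k', z', hz'⟩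
    refine ⟨k + k', (p : OL L) ^ k' • z + (p : OL L) ^ k • z', ?_⟩
    rw [map_add, map_smul, map_smul, ← hz, ← hz', ← algebraMap_smul L ((p : OL L) ^ k'),
      ← algebraMap_smul L ((p : OL L) ^ k)]
    simp only [map_pow, map_natCast, smul_smul, smul_add, pow_add, mul_comm]

/-- The lattice `p^k (lim_j M / p^j M)` of the completion. -/
def ball (p : ℕ) (M : Submodule (OL L) V) (k : ℕ) : Set (LatticeCompletion p M) :=
  {a | ∃ z, a = ((p : L) ^ k) • int p M z}

lemma mem_ball_iff {k : ℕ} {a : LatticeCompletion p M} :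
    a ∈ ball p M k ↔ ∃ z, a = int p M ((p : OL L) ^ k • z) := by
  simp only [int_pow_smul]; rfl

lemma isOpen_iff {U : Set (LatticeCompletion p M)} :
    IsOpen U ↔ ∀ a ∈ U, ∃ k : ℕ, ∀ b ∈ ball p M k, a + b ∈ U := by
  refine forall₂_congr fun a _ => exists_congr fun k => ?_
  exact ⟨by rintro h _ ⟨z, rfl⟩; exact h z, fun h z => h _ ⟨z, rfl⟩⟩

lemma ball_add {k : ℕ} {a b : LatticeCompletion p M} (ha : a ∈ ball p M k)
    (hb : b ∈ ball p M k) : a + b ∈ ball p M k := by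
  obtain ⟨z, rfl⟩ := ha
  obtain ⟨z', rfl⟩ := hb
  exact ⟨z + z', by rw [int_add, smul_add]⟩

lemma ball_smul {k : ℕ} {c : L} (hc : ‖c‖ ≤ 1) {a : LatticeCompletion p M}
    (ha : a ∈ ball p M k) : c • a ∈ ball p M k := by
  obtain ⟨z, rfl⟩ := ha
  exact ⟨(⟨c, mem_OL.2 hc⟩ : OL L) • z, by rw [int_smul, smul_comm]⟩

lemma ball_neg {k : ℕ} {a : LatticeCompletion p M} (ha : a ∈ ball p M k) : -a ∈ ball p M k := by
  have := ball_smul (c := -1) (by simp) ha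
  simpa using this

lemma zero_mem_ball (k : ℕ) : (0 : LatticeCompletion p M) ∈ ball p M k :=
  ⟨0, by rw [int_zero, smul_zero]⟩

lemma ball_anti {k l : ℕ} (h : k ≤ l) : ball p M l ⊆ ball p M k := by
  rintro _ ⟨z, rfl⟩
  refine ⟨(p : OL L) ^ (l - k) • z, ?_⟩
  rw [int_pow_smul, smul_smul, ← pow_add, Nat.add_sub_cancel' h]

lemma add_ball_mem_nhds (a : LatticeCompletion p M) (k : ℕ) :
    {b | b - a ∈ ball p M k} ∈ 𝓝 a := by
  refine IsOpen.mem_nhds (isOpen_iff.2 fun b hb => ⟨k, fun c hc => ?_⟩) ?_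
  · change b + c - a ∈ ball p M k
    rw [add_sub_right_comm]
    exact ball_add hb hc
  · change a - a ∈ ball p M k
    rw [sub_self]; exact zero_mem_ball k

lemma eq_zero_of_forall_mem_ball (hp0 : (p : L) ≠ 0) (hp : ‖(p : L)‖ < 1)
    {a : LatticeCompletion p M} (ha : ∀ k, a ∈ ball p M k) : a = 0 := by
  obtain ⟨z, rfl⟩ := mem_ball_iff.1 (ha 0)
  rw [pow_zero, one_smul] at ha ⊢
  suffices h : z = 0 by rw [h, int_zero]
  apply AdicCompletion.ext
  intro k
  obtain ⟨z', hz'⟩ := mem_ball_iff.1 (ha k)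
  exact eval_eq_zero_iff.2 ⟨z', (int_injective hp0 hp hz').symm⟩

/-- The gauge of the unit ball `lim_k M / p^k M`. -/
def gauge (p : ℕ) (M : Submodule (OL L) V) (a : LatticeCompletion p M) : ℝ :=
  sInf {r : ℝ | ∃ (c : L) (z : AdicCompletion (idealP p L) M), a = c • int p M z ∧ ‖c‖ = r}

lemma gauge_le {a : LatticeCompletion p M} {c : L} {z : AdicCompletion (idealP p L) M}
    (h : a = c • int p M z) : gauge p M a ≤ ‖c‖ :=
  csInf_le ⟨0, by rintro _ ⟨c, z, -, rfl⟩; exact norm_nonneg c⟩ ⟨c, z, h, rfl⟩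

lemma gauge_nonempty (hp0 : (p : L) ≠ 0) (hp : ‖(p : L)‖ < 1) (a : LatticeCompletion p M) :
    {r : ℝ | ∃ (c : L) (z : AdicCompletion (idealP p L) M),
      a = c • int p M z ∧ ‖c‖ = r}.Nonempty := by
  obtain ⟨k, z, hz⟩ := exists_pow_smul_eq_int hp a
  refine ⟨_, ((p : L) ^ k)⁻¹, z, ?_, rfl⟩
  rw [← hz, smul_smul, inv_mul_cancel₀ (pow_ne_zero k hp0), one_smul]

lemma exists_of_gauge_lt (hp0 : (p : L) ≠ 0) (hp : ‖(p : L)‖ < 1) {a : LatticeCompletion p M}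
    {r : ℝ} (h : gauge p M a < r) :
    ∃ (c : L) (z : AdicCompletion (idealP p L) M), a = c • int p M z ∧ ‖c‖ < r := by
  obtain ⟨_, ⟨c, z, hcz, rfl⟩, hr⟩ := exists_lt_of_csInf_lt (gauge_nonempty hp0 hp a) h
  exact ⟨c, z, hcz, hr⟩

lemma gauge_nonneg (a : LatticeCompletion p M) : 0 ≤ gauge p M a :=
  Real.sInf_nonneg (by rintro _ ⟨c, z, -, rfl⟩; exact norm_nonneg c)

/-- `𝒪_L` is a valuation ring, so the `L`-multiples of the unit lattice are totally ordered by
inclusion. The ultrametric inequality for the gauge rests on this. -/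
lemma smul_int_of_norm_le {c d : L} (h : ‖c‖ ≤ ‖d‖) (z : AdicCompletion (idealP p L) M) :
    ∃ z' : AdicCompletion (idealP p L) M, c • int p M z = d • int p M z' := by
  by_cases hd : d = 0
  · have hc : c = 0 := by simpa [hd] using h
    exact ⟨z, by rw [hc, hd]⟩
  · refine ⟨(⟨d⁻¹ * c, mem_OL.2 ?_⟩ : OL L) • z, ?_⟩
    · rw [norm_mul, norm_inv]
      exact inv_mul_le_one_of_le₀ h (norm_nonneg _)
    · rw [int_smul, smul_smul, mul_inv_cancel_left₀ hd]

lemma gauge_add_le (hp0 : (p : L) ≠ 0) (hp : ‖(p : L)‖ < 1) (a b : LatticeCompletion p M) :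
    gauge p M (a + b) ≤ max (gauge p M a) (gauge p M b) := by
  refine le_of_forall_gt_imp_ge_of_dense fun r hr => ?_
  obtain ⟨c, z, rfl, hc⟩ := exists_of_gauge_lt hp0 hp ((le_max_left _ _).trans_lt hr)
  obtain ⟨d, z', rfl, hd⟩ := exists_of_gauge_lt hp0 hp ((le_max_right _ _).trans_lt hr)
  rcases le_total ‖c‖ ‖d‖ with h | h
  · obtain ⟨y, hy⟩ := smul_int_of_norm_le h z
    rw [hy, ← smul_add, ← int_add]
    exact (gauge_le rfl).trans hd.le
  · obtain ⟨y, hy⟩ := smul_int_of_norm_le h z'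
    rw [hy, ← smul_add, ← int_add]
    exact (gauge_le rfl).trans hc.le

lemma gauge_smul_le (hp0 : (p : L) ≠ 0) (hp : ‖(p : L)‖ < 1) (c : L) (a : LatticeCompletion p M) :
    gauge p M (c • a) ≤ ‖c‖ * gauge p M a := by
  by_cases hc : c = 0
  · subst hc
    have := gauge_le (p := p) (M := M) (a := 0) (c := 0) (z := 0) (by simp)
    simpa using this
  · have hc' : 0 < ‖c‖ := norm_pos_iff.2 hc
    rw [← div_le_iff₀' hc']
    refine le_csInf (gauge_nonempty hp0 hp a) ?_
    rintro _ ⟨d, z, rfl, rfl⟩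
    rw [div_le_iff₀' hc', ← norm_mul, smul_smul]
    exact gauge_le rfl

/-- The gauge as a seminorm. -/
def gaugeSeminorm (hp0 : (p : L) ≠ 0) (hp : ‖(p : L)‖ < 1) (M : Submodule (OL L) V) :
    Seminorm L (LatticeCompletion p M) :=
  Seminorm.ofSMulLE (gauge p M)
    (le_antisymm ((gauge_le (c := 0) (z := 0) (by simp)).trans_eq norm_zero) (gauge_nonneg _))
    (fun a b => (gauge_add_le hp0 hp a b).trans
      (max_le_add_of_nonneg (gauge_nonneg a) (gauge_nonneg b)))
    (gauge_smul_le hp0 hp)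

lemma mem_ball_of_gauge_lt (hp0 : (p : L) ≠ 0) (hp : ‖(p : L)‖ < 1) {k : ℕ}
    {a : LatticeCompletion p M} (h : gauge p M a < ‖(p : L)‖ ^ k) : a ∈ ball p M k := by
  obtain ⟨c, z, rfl, hc⟩ := exists_of_gauge_lt hp0 hp h
  rw [← norm_pow] at hc
  exact smul_int_of_norm_le hc.le z

lemma gauge_le_of_mem_ball {k : ℕ} {a : LatticeCompletion p M} (h : a ∈ ball p M k) :
    gauge p M a ≤ ‖(p : L)‖ ^ k := by
  obtain ⟨z, rfl⟩ := h
  exact (gauge_le rfl).trans_eq (norm_pow _ _)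

lemma isOpen_iff_gauge (hp0 : (p : L) ≠ 0) (hp : ‖(p : L)‖ < 1)
    {U : Set (LatticeCompletion p M)} :
    IsOpen U ↔ ∀ a ∈ U, ∃ ε : ℝ, 0 < ε ∧ ∀ b, gauge p M (b - a) < ε → b ∈ U := by
  rw [isOpen_iff]
  refine forall₂_congr fun a _ => ⟨?_, ?_⟩
  · rintro ⟨k, hk⟩
    refine ⟨‖(p : L)‖ ^ k, pow_pos (norm_pos_iff.2 hp0) k, fun b hb => ?_⟩
    simpa using hk _ (mem_ball_of_gauge_lt hp0 hp hb)
  · rintro ⟨ε, hε, h⟩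
    obtain ⟨k, hk⟩ := exists_pow_lt_of_lt_one hε hp
    refine ⟨k, fun b hb => h _ ?_⟩
    rw [add_sub_cancel_left]
    exact (gauge_le_of_mem_ball hb).trans_lt hk

lemma exists_limit (hp0 : (p : L) ≠ 0) (hp : ‖(p : L)‖ < 1) (s : ℕ → LatticeCompletion p M)
    (hs : ∀ k, ∃ K, ∀ i ≥ K, ∀ j ≥ K, s i - s j ∈ ball p M k) :
    ∃ a, ∀ k, ∃ K, ∀ i ≥ K, s i - a ∈ ball p M k := by
  choose K hK using hs
  -- Partial sums give a monotone majorant of `K`, so that `s (T l) - s (T k)` lies in the ball of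
  -- index `k` for all `l ≥ k`.
  let T : ℕ → ℕ := fun k => ∑ i ∈ Finset.range (k + 1), K i
  have hT : Monotone T := fun a b h => Finset.sum_le_sum_of_subset (by
    intro i; simp only [Finset.mem_range]; omega)
  have hKT : ∀ k, K k ≤ T k := fun k =>
    Finset.single_le_sum (f := K) (fun _ _ => Nat.zero_le _) (by simp)
  -- The terms `s (T k)` need not lie in the unit lattice, but their differences with `s (T 0)` do.
  have h0 : ∀ k, ∃ z, s (T k) - s (T 0) = int p M z := by
    intro k
    obtain ⟨z, hz⟩ := hK 0 (T k) ((hKT 0).trans (hT (Nat.zero_le k))) (T 0) (hKT 0)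
    exact ⟨z, by simpa using hz⟩
  choose z hz using h0
  have hzc : ∀ k l, k ≤ l → (z l).val k = (z k).val k := by
    intro k l hkl
    obtain ⟨y, hy⟩ := mem_ball_iff.1 (hK k (T l) ((hKT k).trans (hT hkl)) (T k) (hKT k))
    have h1 : int p M (z l - z k) = int p M ((p : OL L) ^ k • y) := by
      rw [int_sub, ← hz, ← hz, ← hy]; abel
    have h2 := eval_eq_zero_iff.2 ⟨y, (int_injective hp0 hp h1).symm⟩
    rwa [AdicCompletion.val_sub_apply, sub_eq_zero] at h2
  -- The limit is read off diagonally: its component modulo `p^k` is that of `z k`, and `hzc` is the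
  -- compatibility.
  let t : AdicCompletion (idealP p L) M := ⟨fun k => (z k).val k, by
    intro k l hkl
    change AdicCompletion.transitionMap _ _ hkl ((z l).val l) = _
    rw [(z l).prop hkl, hzc k l hkl]⟩
  refine ⟨s (T 0) + int p M t, fun k => ⟨T k, fun i hi => ?_⟩⟩
  have h1 : s i - s (T k) ∈ ball p M k := hK k i ((hKT k).trans hi) (T k) (hKT k)
  have h2 : int p M (z k - t) ∈ ball p M k := by
    have : (z k - t).val k = 0 := by
      rw [AdicCompletion.val_sub_apply, sub_eq_zero]
    obtain ⟨y, hy⟩ := eval_eq_zero_iff.1 this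
    exact mem_ball_iff.2 ⟨y, by rw [hy]⟩
  have h3 := ball_add h1 h2
  rw [int_sub, ← hz] at h3
  convert h3 using 1
  abel

lemma gauge_complete (hp0 : (p : L) ≠ 0) (hp : ‖(p : L)‖ < 1) (s : ℕ → LatticeCompletion p M)
    (hs : ∀ ε : ℝ, 0 < ε → ∃ k : ℕ, ∀ i ≥ k, ∀ j ≥ k, gauge p M (s i - s j) < ε) :
    ∃ a, Tendsto (fun i => gauge p M (s i - a)) atTop (𝓝 0) := by
  obtain ⟨a, ha⟩ := exists_limit hp0 hp s fun k => by
    obtain ⟨K, hK⟩ := hs (‖(p : L)‖ ^ k) (pow_pos (norm_pos_iff.2 hp0) k)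
    exact ⟨K, fun i hi j hj => mem_ball_of_gauge_lt hp0 hp (hK i hi j hj)⟩
  refine ⟨a, Metric.tendsto_atTop.2 fun ε hε => ?_⟩
  obtain ⟨k, hk⟩ := exists_pow_lt_of_lt_one hε hp
  obtain ⟨K, hK⟩ := ha k
  refine ⟨K, fun i hi => ?_⟩
  rw [Real.dist_eq, sub_zero, abs_of_nonneg (gauge_nonneg _)]
  exact (gauge_le_of_mem_ball (hK i hi)).trans_lt hk

end LatticeCompletion

end LatticeStructure

/-! ### The universal property of the completion with respect to a lattice -/

section Universal

variable {p : ℕ} {L : Type u} [NormedField L] [IsUltrametricDist L]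
variable {V : Type v} [AddCommGroup V] [Module L V] {M : Submodule (OL L) V}

namespace LatticeCompletion

/-- The element `1 ⊗ a` of the completion, for `a ∈ M`. -/
def ofLattice (p : ℕ) (a : M) : LatticeCompletion p M :=
  int p M (AdicCompletion.of (idealP p L) M a)

lemma ofLattice_add (a b : M) : ofLattice p (a + b) = ofLattice p a + ofLattice p b := by
  rw [ofLattice, map_add, int_add]; rfl

lemma ofLattice_smul (c : OL L) (a : M) : ofLattice p (c • a) = (c : L) • ofLattice p a := by
  rw [ofLattice, map_smul, int_smul]; rfl

lemma ofLattice_pow_smul (k : ℕ) (a : M) :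
    ofLattice p ((p : OL L) ^ k • a) = (p : L) ^ k • ofLattice p a := by
  rw [ofLattice_smul]; simp

/-- Independence of the exponent used to bring `v` into `M`; it lets `ofSpace`, defined through a
choice, be computed with any convenient exponent. -/
lemma inv_pow_smul_ofLattice_eq (hp0 : (p : L) ≠ 0) {v : V} {k l : ℕ} (hk : (p : L) ^ k • v ∈ M)
    (hl : (p : L) ^ l • v ∈ M) :
    ((p : L) ^ k)⁻¹ • ofLattice p (⟨_, hk⟩ : M) = ((p : L) ^ l)⁻¹ • ofLattice p (⟨_, hl⟩ : M) := by
  have h : (p : OL L) ^ l • (⟨_, hk⟩ : M) = (p : OL L) ^ k • (⟨_, hl⟩ : M) := by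
    apply Subtype.ext
    rw [pow_smul_coe, pow_smul_coe, smul_smul, smul_smul, mul_comm]
  have h' := congrArg (ofLattice p) h
  rw [ofLattice_pow_smul, ofLattice_pow_smul] at h'
  have hk0 := pow_ne_zero k hp0
  have hl0 := pow_ne_zero l hp0
  rw [inv_smul_eq_iff₀ hk0, smul_comm, eq_inv_smul_iff₀ hl0, h']

/-- The natural map from `V` to its completion with respect to a spanning lattice. -/
def ofSpace (hp0 : (p : L) ≠ 0) (hp : ‖(p : L)‖ < 1) (hM : ∀ v : V, ∃ k : ℕ, (p : L) ^ k • v ∈ M) :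
    V →ₗ[L] LatticeCompletion p M where
  toFun v := ((p : L) ^ (hM v).choose)⁻¹ • ofLattice p (⟨_, (hM v).choose_spec⟩ : M)
  map_add' v w := by
    obtain ⟨k, hk⟩ := hM v
    obtain ⟨l, hl⟩ := hM w
    have hk' : (p : L) ^ (k + l) • v ∈ M := by
      rw [add_comm, pow_add, mul_smul]
      simpa only [pow_smul_coe] using ((p : OL L) ^ l • (⟨_, hk⟩ : M)).2
    have hl' : (p : L) ^ (k + l) • w ∈ M := by
      rw [pow_add, mul_smul]
      simpa only [pow_smul_coe] using ((p : OL L) ^ k • (⟨_, hl⟩ : M)).2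
    have hs : (p : L) ^ (k + l) • (v + w) ∈ M := by
      rw [smul_add]; exact add_mem hk' hl'
    rw [inv_pow_smul_ofLattice_eq hp0 _ hk', inv_pow_smul_ofLattice_eq hp0 _ hl',
      inv_pow_smul_ofLattice_eq hp0 _ hs, ← smul_add, ← ofLattice_add]
    congr 2
    exact Subtype.ext (smul_add _ _ _)
  map_smul' c v := by
    obtain ⟨k, hk⟩ := hM v
    obtain ⟨l, hl⟩ := exists_pow_mul_mem_OL (p := p) hp c
    have heq : (((⟨_, hl⟩ : OL L) • (⟨_, hk⟩ : M) : M) : V) = (p : L) ^ (l + k) • c • v := by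
      change ((p : L) ^ l * c) • ((p : L) ^ k • v) = _
      rw [smul_smul, smul_smul, pow_add]; congr 1; ring
    have hs : (p : L) ^ (l + k) • c • v ∈ M := heq ▸ Subtype.prop _
    rw [inv_pow_smul_ofLattice_eq hp0 _ hs, inv_pow_smul_ofLattice_eq hp0 _ hk]
    have : (⟨_, hs⟩ : M) = (⟨_, hl⟩ : OL L) • (⟨_, hk⟩ : M) := Subtype.ext heq.symm
    rw [this, ofLattice_smul, smul_smul, RingHom.id_apply, smul_smul]
    congr 1
    have h1 := pow_ne_zero k hp0
    have h2 := pow_ne_zero l hp0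
    rw [pow_add]
    field_simp

variable (hp0 : (p : L) ≠ 0) (hp : ‖(p : L)‖ < 1) (hM : ∀ v : V, ∃ k : ℕ, (p : L) ^ k • v ∈ M)

lemma ofSpace_coe (a : M) : ofSpace hp0 hp hM (a : V) = ofLattice p a := by
  have h : (p : L) ^ 0 • (a : V) ∈ M := by simp
  refine (inv_pow_smul_ofLattice_eq hp0 _ h).trans ?_
  simp

lemma ofSpace_mem_ball {k : ℕ} (a : M) : ofSpace hp0 hp hM ((p : L) ^ k • (a : V)) ∈ ball p M k := by
  rw [map_smul, ofSpace_coe]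
  exact ⟨_, rfl⟩

/-- Density of `V` in the completion. -/
lemma exists_sub_ofSpace_mem_ball (k : ℕ) (a : LatticeCompletion p M) :
    ∃ v : V, a - ofSpace hp0 hp hM v ∈ ball p M k := by
  obtain ⟨l, z, hz⟩ := exists_pow_smul_eq_int hp a
  -- The approximation is made modulo `p^(l+k)` because the later division by `p^l` loses `l`
  -- digits.
  obtain ⟨m, hm⟩ := Submodule.Quotient.mk_surjective _ (z.val (l + k))
  have : (z - AdicCompletion.of (idealP p L) M m).val (l + k) = 0 := by
    rw [AdicCompletion.val_sub_apply, ← hm, sub_eq_zero]; rfl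
  obtain ⟨z', hz'⟩ := eval_eq_zero_iff.1 this
  have hl := pow_ne_zero l hp0
  refine ⟨((p : L) ^ l)⁻¹ • (m : V), z', ?_⟩
  have h1 : a = ((p : L) ^ l)⁻¹ • int p M z := by rw [← hz, inv_smul_smul₀ hl]
  rw [map_smul, ofSpace_coe, h1, ← smul_sub, ofLattice, ← int_sub, ← hz', int_pow_smul, pow_add,
    smul_smul, inv_mul_cancel_left₀ hl]

lemma exists_eq_inv_pow_smul_coe (hp0 : (p : L) ≠ 0)
    (hM : ∀ v : V, ∃ k : ℕ, (p : L) ^ k • v ∈ M) (v : V) :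
    ∃ (k : ℕ) (m : M), v = ((p : L) ^ k)⁻¹ • (m : V) := by
  obtain ⟨k, hk⟩ := hM v
  exact ⟨k, ⟨_, hk⟩, by rw [inv_smul_smul₀ (pow_ne_zero k hp0)]⟩

/-- The hypothesis `htop` says that the topology of `V` is at least as fine as the one in which the
`p^k M` form a basis of neighbourhoods of `0`. For Π^an this is the openness of `M`. -/
lemma continuous_ofSpace [TopologicalSpace V]
    (htop : ∀ U : Set V, (∀ a ∈ U, ∃ k : ℕ, ∀ m ∈ M, a + (p : L) ^ k • m ∈ U) → IsOpen U) :
    Continuous (ofSpace hp0 hp hM) := by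
  refine continuous_def.2 fun U hU => htop _ fun a ha => ?_
  obtain ⟨k, hk⟩ := isOpen_iff.1 hU _ ha
  refine ⟨k, fun m hm => ?_⟩
  change ofSpace hp0 hp hM _ ∈ U
  rw [map_add]
  exact hk _ (ofSpace_mem_ball hp0 hp hM ⟨m, hm⟩)

/-! ### The group action on the completion. -/

section Action

variable {G : Type x} [Group G] (τ : Representation L G V) (hτ : ∀ g : G, ∀ a ∈ M, τ g a ∈ M)

lemma rep_int (g : G) (z : AdicCompletion (idealP p L) M) :
    latticeCompletionRep p M τ hτ g (int p M z)
      = int p M (AdicCompletion.map (idealP p L) (latticeAction M τ hτ g) z) := rfl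

lemma rep_mem_ball (g : G) {k : ℕ} {a : LatticeCompletion p M} (ha : a ∈ ball p M k) :
    latticeCompletionRep p M τ hτ g a ∈ ball p M k := by
  obtain ⟨z, rfl⟩ := ha
  exact ⟨_, by rw [map_smul, rep_int]⟩

lemma rep_ofSpace (g : G) (v : V) :
    latticeCompletionRep p M τ hτ g (ofSpace hp0 hp hM v) = ofSpace hp0 hp hM (τ g v) := by
  obtain ⟨k, m, rfl⟩ := exists_eq_inv_pow_smul_coe hp0 hM v
  simp only [map_smul]
  congr 1
  rw [ofSpace_coe]
  have h2 := ofSpace_coe hp0 hp hM (latticeAction M τ hτ g m)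
  have h3 : ((latticeAction M τ hτ g m : M) : V) = τ g (m : V) := rfl
  rw [h3] at h2
  rw [h2, ofLattice, rep_int, AdicCompletion.map_of]
  rfl

lemma gauge_rep_le (hp0 : (p : L) ≠ 0) (hp : ‖(p : L)‖ < 1) (τ : Representation L G V)
    (hτ : ∀ g : G, ∀ a ∈ M, τ g a ∈ M) (g : G) (a : LatticeCompletion p M) :
    gauge p M (latticeCompletionRep p M τ hτ g a) ≤ gauge p M a := by
  refine le_csInf (gauge_nonempty hp0 hp a) ?_
  rintro _ ⟨c, z, rfl, rfl⟩
  rw [map_smul, rep_int]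
  exact gauge_le rfl

lemma gauge_rep (hp0 : (p : L) ≠ 0) (hp : ‖(p : L)‖ < 1) (τ : Representation L G V)
    (hτ : ∀ g : G, ∀ a ∈ M, τ g a ∈ M) (g : G) (a : LatticeCompletion p M) :
    gauge p M (latticeCompletionRep p M τ hτ g a) = gauge p M a := by
  refine le_antisymm (gauge_rep_le hp0 hp τ hτ g a) ?_
  have h := gauge_rep_le hp0 hp τ hτ g⁻¹ (latticeCompletionRep p M τ hτ g a)
  have h2 : latticeCompletionRep p M τ hτ g⁻¹ (latticeCompletionRep p M τ hτ g a) = a :=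
    Representation.inv_self_apply _ g a
  rwa [h2] at h

variable [TopologicalSpace G] [IsTopologicalGroup G]

/-- The action preserves every ball, hence is equicontinuous. Joint continuity then reduces to
continuity at `1` of the orbit maps of a dense set of vectors, and `horb` provides it on the image
of `V`. -/
lemma continuous_rep (hp0 : (p : L) ≠ 0) (hp : ‖(p : L)‖ < 1)
    (hM : ∀ v : V, ∃ k : ℕ, (p : L) ^ k • v ∈ M) (τ : Representation L G V)
    (hτ : ∀ g : G, ∀ a ∈ M, τ g a ∈ M)
    (horb : ∀ v : V, ∀ᶠ g in 𝓝 (1 : G), τ g v - v ∈ M) :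
    Continuous fun z : G × LatticeCompletion p M => latticeCompletionRep p M τ hτ z.1 z.2 := by
  refine continuous_iff_continuousAt.2 fun ⟨g, a⟩ => ?_
  intro U hU
  obtain ⟨U', hU'U, hU', haU'⟩ := mem_nhds_iff.1 hU
  obtain ⟨k, hk⟩ := isOpen_iff.1 hU' _ haU'
  obtain ⟨v, hv⟩ := exists_sub_ofSpace_mem_ball hp0 hp hM k a
  have hpk := pow_ne_zero k hp0
  have h1 : ∀ᶠ u in 𝓝 (1 : G), latticeCompletionRep p M τ hτ u a - a ∈ ball p M k := by
    -- Applying `horb` to `p^(-k) v` gives `u v - v ∈ p^k M`. Then `u a - a = u (a - v) + (u v - v)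
    -- - (a - v)`, with all three terms in the ball.
    filter_upwards [horb (((p : L) ^ k)⁻¹ • v)] with u hu
    have h2 := ofSpace_mem_ball hp0 hp hM (k := k) ⟨_, hu⟩
    rw [smul_sub, map_smul, smul_inv_smul₀ hpk, smul_inv_smul₀ hpk, map_sub,
      ← rep_ofSpace hp0 hp hM τ hτ] at h2
    have h3 := ball_add (ball_add (rep_mem_ball τ hτ u hv) h2) (ball_neg hv)
    rw [map_sub] at h3
    convert h3 using 1
    abel
  have h2 : ∀ᶠ g' in 𝓝 g, latticeCompletionRep p M τ hτ (g⁻¹ * g') a - a ∈ ball p M k := by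
    have : Tendsto (fun g' : G => g⁻¹ * g') (𝓝 g) (𝓝 1) := by
      have := (continuous_const_mul g⁻¹).tendsto g
      rwa [inv_mul_cancel] at this
    exact this.eventually h1
  have h3 := prod_mem_nhds h2 (add_ball_mem_nhds a k)
  refine mem_map.2 ?_
  filter_upwards [h3] with z hz
  refine hU'U ?_
  -- For `z = (g', b)`: `g' b - g a = g' (b - a) + g (g⁻¹ g' a - a)`.
  have h4 := ball_add (rep_mem_ball τ hτ z.1 hz.2) (rep_mem_ball τ hτ g hz.1)
  have h5 := hk _ h4
  convert h5 using 1
  have h6 : latticeCompletionRep p M τ hτ g (latticeCompletionRep p M τ hτ (g⁻¹ * z.1) a)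
      = latticeCompletionRep p M τ hτ z.1 a := by
    rw [← Module.End.mul_apply, ← map_mul, mul_inv_cancel_left]
  rw [map_sub, map_sub, h6]
  change _ = _ + _
  abel

lemma isUnitaryBanachRep (hp0 : (p : L) ≠ 0) (hp : ‖(p : L)‖ < 1)
    (hM : ∀ v : V, ∃ k : ℕ, (p : L) ^ k • v ∈ M) (τ : Representation L G V)
    (hτ : ∀ g : G, ∀ a ∈ M, τ g a ∈ M)
    (horb : ∀ v : V, ∀ᶠ g in 𝓝 (1 : G), τ g v - v ∈ M) :
    IsUnitaryBanachRep (latticeCompletionRep p M τ hτ) where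
  continuous_action := continuous_rep hp0 hp hM τ hτ horb
  exists_norm := by
    refine ⟨gaugeSeminorm hp0 hp M, gauge_add_le hp0 hp, fun a ha => ?_, fun U =>
      isOpen_iff_gauge hp0 hp, gauge_complete hp0 hp, gauge_rep hp0 hp τ hτ⟩
    refine eq_zero_of_forall_mem_ball hp0 hp fun k => mem_ball_of_gauge_lt hp0 hp ?_
    exact (show gauge p M a = 0 from ha).trans_lt (pow_pos (norm_pos_iff.2 hp0) k)

end Action

/-- A linear map that is bounded on `M`, with values in a complete ultrametric space, extends to
`lim_k M / p^k M`. -/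
lemma exists_extension {B : Type w} [AddCommGroup B] [Module L B] (N : Seminorm L B)
    (hadd : ∀ a b, N (a + b) ≤ max (N a) (N b)) (hzero : ∀ a, N a = 0 → a = 0)
    (hcomp : ∀ s : ℕ → B, (∀ ε : ℝ, 0 < ε → ∃ k : ℕ, ∀ i ≥ k, ∀ j ≥ k, N (s i - s j) < ε) →
      ∃ a : B, Tendsto (fun i => N (s i - a)) atTop (𝓝 0))
    (f : V →ₗ[L] B) {C : ℝ} (hC : ∀ m ∈ M, N (f m) ≤ C) (hp : ‖(p : L)‖ < 1) :
    ∃ F : AdicCompletion (idealP p L) M →ₗ[OL L] B,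
      (∀ m : M, F (AdicCompletion.of _ _ m) = f m) ∧ ∀ z, N (F z) ≤ C := by
  have hC0 : 0 ≤ C := (apply_nonneg N _).trans (hC 0 M.zero_mem)
  have hsub : ∀ a b, N (a - b) ≤ max (N a) (N b) := fun a b => by
    rw [sub_eq_add_neg, ← map_neg_eq_map N b]; exact hadd _ _
  have hlim : Tendsto (fun k : ℕ => C * ‖(p : L)‖ ^ k) atTop (𝓝 0) := by
    simpa using (tendsto_pow_atTop_nhds_zero_of_lt_one (norm_nonneg _) hp).const_mul C
  -- The graph of the extension: `b` is the limit of the values of `f` on lifts of the components of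
  -- `z`. Quantifying over all lifts makes the choice of lifts harmless, and linearity follows from
  -- uniqueness.
  let P : AdicCompletion (idealP p L) M → B → Prop := fun z b =>
    ∀ (k : ℕ) (m : M), Submodule.Quotient.mk m = z.val k → N (b - f m) ≤ C * ‖(p : L)‖ ^ k
  have hmod : ∀ (k : ℕ) (m m' : M), (Submodule.Quotient.mk m :
      M ⧸ (idealP p L ^ k • ⊤ : Submodule (OL L) M)) = Submodule.Quotient.mk m' →
      N (f m - f m') ≤ C * ‖(p : L)‖ ^ k := by
    intro k m m' h
    obtain ⟨b, hb⟩ := mem_idealP_pow_smul.1 ((Submodule.Quotient.eq _).1 h)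
    have : (m : V) - m' = (p : L) ^ k • (b : V) := by
      rw [← pow_smul_coe, hb]; rfl
    rw [← map_sub, this, map_smul, map_smul_eq_mul, norm_pow, mul_comm]
    exact mul_le_mul_of_nonneg_right (hC _ b.2) (by positivity)
  have huniq : ∀ z b b', P z b → P z b' → b = b' := by
    intro z b b' h h'
    rw [← sub_eq_zero]
    refine hzero _ (le_antisymm (ge_of_tendsto' hlim fun k => ?_) (apply_nonneg N _))
    obtain ⟨m, hm⟩ := Submodule.Quotient.mk_surjective _ (z.val k)
    rw [← sub_sub_sub_cancel_right b b' (f m)]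
    exact (hsub _ _).trans (max_le (h k m hm) (h' k m hm))
  have hex : ∀ z, ∃ b, P z b := by
    intro z
    choose s hs using fun k => Submodule.Quotient.mk_surjective _ (z.val k)
    have hsk : ∀ k l, k ≤ l → (Submodule.Quotient.mk (s l) :
        M ⧸ (idealP p L ^ k • ⊤ : Submodule (OL L) M)) = z.val k := by
      intro k l hkl
      rw [← z.prop hkl]
      change _ = AdicCompletion.transitionMap _ _ hkl (z.val l)
      rw [← hs l]; rfl
    have hcau : ∀ k l m, k ≤ l → Submodule.Quotient.mk m = z.val k →
        N (f (s l) - f m) ≤ C * ‖(p : L)‖ ^ k := fun k l m hkl hm =>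
      hmod k _ _ ((hsk k l hkl).trans hm.symm)
    obtain ⟨b, hb⟩ := hcomp (fun k => f (s k)) fun ε hε => by
      obtain ⟨k, hk⟩ := (hlim.eventually (gt_mem_nhds hε)).exists
      exact ⟨k, fun i hi j hj => ((hmod k _ _ ((hsk k i hi).trans (hsk k j hj).symm))).trans_lt hk⟩
    refine ⟨b, fun k m hm => ?_⟩
    refine le_of_forall_pos_lt_add fun ε hε => ?_
    obtain ⟨l, hl, hkl⟩ := ((hb.eventually (gt_mem_nhds hε)).and (eventually_ge_atTop k)).exists
    rw [← sub_add_sub_cancel b (f (s l)) (f m)]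
    refine (hadd _ _).trans_lt (max_lt ?_ ?_)
    · rw [← neg_sub, map_neg_eq_map]
      exact hl.trans_le (le_add_of_nonneg_left (by positivity))
    · exact (hcau k l m hkl hm).trans_lt (lt_add_of_pos_right _ hε)
  choose F hF using hex
  refine ⟨{ toFun := F, map_add' := fun z z' => ?_, map_smul' := fun c z => ?_ }, fun m => ?_,
    fun z => ?_⟩
  · refine huniq _ _ _ (hF _) fun k m hm => ?_
    obtain ⟨a, ha⟩ := Submodule.Quotient.mk_surjective _ (z.val k)
    obtain ⟨a', ha'⟩ := Submodule.Quotient.mk_surjective _ (z'.val k)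
    rw [AdicCompletion.val_add_apply, ← ha, ← ha', ← Submodule.Quotient.mk_add] at hm
    have h1 := hmod k _ _ hm.symm
    have : F z + F z' - f m = (F z - f a) + (F z' - f a') + (f ((a + a' : M) : V) - f m) := by
      rw [Submodule.coe_add, map_add]; abel
    rw [this]
    exact (hadd _ _).trans (max_le ((hadd _ _).trans (max_le (hF z k a ha) (hF z' k a' ha'))) h1)
  · refine huniq _ _ _ (hF _) fun k m hm => ?_
    obtain ⟨a, ha⟩ := Submodule.Quotient.mk_surjective _ (z.val k)
    rw [AdicCompletion.val_smul_apply, ← ha, ← Submodule.Quotient.mk_smul] at hm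
    have h1 := hmod k _ _ hm.symm
    have h2 : f ((c • a : M) : V) = (c : L) • f a := f.map_smul (c : L) (a : V)
    have : (c : L) • F z - f m = (c : L) • (F z - f a) + (f ((c • a : M) : V) - f m) := by
      rw [h2, smul_sub]; abel
    change N ((c : L) • F z - f m) ≤ _
    rw [this]
    refine (hadd _ _).trans (max_le ?_ h1)
    rw [map_smul_eq_mul]
    exact (mul_le_of_le_one_left (apply_nonneg N _) (mem_OL.1 c.2)).trans (hF z k a ha)
  · exact huniq _ _ _ (hF _) fun k m' hm' => hmod k _ _ hm'.symm
  · obtain ⟨m, hm⟩ := Submodule.Quotient.mk_surjective _ (z.val 0)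
    have h1 := hF z 0 m hm
    rw [pow_zero, mul_one] at h1
    change N (F z) ≤ C
    rw [← sub_add_cancel (F z) (f m)]
    exact (hadd _ _).trans (max_le h1 (hC m m.2))

/-- An additive map to a separated ultrametric space that vanishes on `V` and is small on small
balls vanishes. -/
lemma eq_zero_of_ofSpace_eq_zero {B : Type w} [AddCommGroup B] [Module L B] (N : Seminorm L B)
    (hzero : ∀ a, N a = 0 → a = 0) (D : LatticeCompletion p M →+ B)
    (hD : ∀ v, D (ofSpace hp0 hp hM v) = 0)
    (hball : ∀ ε : ℝ, 0 < ε → ∃ k, ∀ a ∈ ball p M k, N (D a) < ε) (a : LatticeCompletion p M) :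
    D a = 0 := by
  refine hzero _ (le_antisymm (le_of_forall_pos_lt_add fun ε hε => ?_) (apply_nonneg N _))
  obtain ⟨k, hk⟩ := hball ε hε
  obtain ⟨v, hv⟩ := exists_sub_ofSpace_mem_ball hp0 hp hM k a
  have := hk _ hv
  rwa [map_sub, hD, sub_zero, ← zero_add ε] at this

lemma exists_ball_of_continuous {B : Type w} [AddCommGroup B] [Module L B] [TopologicalSpace B]
    {N : Seminorm L B} (hadd : ∀ a b, N (a + b) ≤ max (N a) (N b))
    (hopen : ∀ U : Set B, IsOpen U ↔ ∀ a ∈ U, ∃ ε : ℝ, 0 < ε ∧ ∀ b : B, N (b - a) < ε → b ∈ U)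
    {F : LatticeCompletion p M → B} (hF : Continuous F) (hF0 : F 0 = 0) {ε : ℝ} (hε : 0 < ε) :
    ∃ k, ∀ a ∈ ball p M k, N (F a) < ε := by
  have hU : IsOpen {b | N b < ε} := (hopen _).2 fun a ha => ⟨ε, hε, fun b hb => by
    have := hadd (b - a) a
    rw [sub_add_cancel] at this
    exact this.trans_lt (max_lt hb ha)⟩
  obtain ⟨k, hk⟩ := isOpen_iff.1 (hU.preimage hF) 0 (by simpa [hF0] using hε)
  exact ⟨k, fun a ha => by simpa using hk a ha⟩

/-- The two inputs specific to a lattice are `horb`, which gives continuity of the action on the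
completion, and `hbdd`, which gives the extension of maps. Equivariance and uniqueness of the
extension both hold because a map that is small on small balls is determined by its values on the
dense image of `V`. -/
theorem isUniversalUnitaryCompletion [TopologicalSpace V]
    {G : Type x} [Group G] [TopologicalSpace G] [IsTopologicalGroup G]
    (τ : Representation L G V) (hτ : ∀ g : G, ∀ a ∈ M, τ g a ∈ M)
    (horb : ∀ v : V, ∀ᶠ g in 𝓝 (1 : G), τ g v - v ∈ M)
    (hbdd : ∀ (B : Type w) [AddCommGroup B] [Module L B] [TopologicalSpace B]
      (β : Representation L G B) (N : Seminorm L B), (∀ a b, N (a + b) ≤ max (N a) (N b)) →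
      (∀ U : Set B, IsOpen U ↔ ∀ a ∈ U, ∃ ε : ℝ, 0 < ε ∧ ∀ b : B, N (b - a) < ε → b ∈ U) →
      (∀ (g : G) (a : B), N (β g a) = N a) → ∀ f : V →L[L] B,
      (∀ (g : G) (a : V), f (τ g a) = β g (f a)) → ∃ C : ℝ, ∀ m ∈ M, N (f m) ≤ C)
    (ι : V →L[L] LatticeCompletion p M) (hι : ∀ v, ι v = ofSpace hp0 hp hM v) :
    IsUniversalUnitaryCompletion.{u, v, w} τ (latticeCompletionRep p M τ hτ) ι where
  unitary := isUnitaryBanachRep hp0 hp hM τ hτ horb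
  equivariant g a := by rw [hι, hι, rep_ofSpace]
  universal := by
    intro B _ _ _ β hβ f hf
    obtain ⟨N, hadd, hzero, hopen, hcomp, hinv⟩ := hβ.exists_norm
    obtain ⟨C, hC⟩ := hbdd B β N hadd hopen hinv f hf
    obtain ⟨F₀, hF₀, hF₀C⟩ := exists_extension N hadd hzero hcomp f.toLinearMap hC hp
    let F : LatticeCompletion p M →ₗ[L] B := LinearMap.liftBaseChange L F₀
    have hFint : ∀ z, F (int p M z) = F₀ z := fun z => by
      change LinearMap.liftBaseChange L F₀ ((1 : L) ⊗ₜ z) = _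
      rw [LinearMap.liftBaseChange_tmul, one_smul]
    have hsmall : ∀ ε : ℝ, 0 < ε → ∃ k, ∀ a ∈ ball p M k, N (F a) < ε := by
      intro ε hε
      have hlim : Tendsto (fun k : ℕ => ‖(p : L)‖ ^ k * C) atTop (𝓝 0) := by
        simpa using (tendsto_pow_atTop_nhds_zero_of_lt_one (norm_nonneg _) hp).mul_const C
      obtain ⟨k, hk⟩ := (hlim.eventually (gt_mem_nhds hε)).exists
      refine ⟨k, ?_⟩
      rintro _ ⟨z, rfl⟩
      rw [map_smul, hFint, map_smul_eq_mul, norm_pow]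
      exact (mul_le_mul_of_nonneg_left (hF₀C z) (by positivity)).trans_lt hk
    have hFc : Continuous F := by
      refine continuous_def.2 fun U hU => isOpen_iff.2 fun a ha => ?_
      obtain ⟨ε, hε, h⟩ := (hopen U).1 hU _ ha
      obtain ⟨k, hk⟩ := hsmall ε hε
      refine ⟨k, fun b hb => h _ ?_⟩
      rw [map_add, add_sub_cancel_left]
      exact hk b hb
    have hFι : ∀ v, F (ofSpace hp0 hp hM v) = f v := by
      intro v
      obtain ⟨k, m, rfl⟩ := exists_eq_inv_pow_smul_coe hp0 hM v
      rw [map_smul, map_smul, map_smul, ofSpace_coe, ofLattice, hFint, hF₀]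
      rfl
    refine ⟨⟨F, hFc⟩, ⟨fun g b => ?_, fun a => ?_⟩, ?_⟩
    · let D : LatticeCompletion p M →+ B :=
        (F ∘ₗ latticeCompletionRep p M τ hτ g - β g ∘ₗ F).toAddMonoidHom
      have hD : ∀ a, D a = F (latticeCompletionRep p M τ hτ g a) - β g (F a) := fun _ => rfl
      refine sub_eq_zero.1 (eq_zero_of_ofSpace_eq_zero hp0 hp hM N hzero D (fun v => ?_) ?_ b)
      · rw [hD, rep_ofSpace, hFι, hFι, hf, sub_self]
      · intro ε hε
        obtain ⟨k, hk⟩ := hsmall ε hε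
        refine ⟨k, fun a ha => ?_⟩
        rw [hD, sub_eq_add_neg]
        refine (hadd _ _).trans_lt (max_lt (hk _ (rep_mem_ball τ hτ g ha)) ?_)
        rw [map_neg_eq_map, hinv]
        exact hk a ha
    · rw [hι]; exact hFι a
    · rintro F' ⟨-, hF'⟩
      ext b
      let D : LatticeCompletion p M →+ B := (F'.toLinearMap - F).toAddMonoidHom
      have hD : ∀ a, D a = F' a - F a := fun _ => rfl
      refine sub_eq_zero.1 (eq_zero_of_ofSpace_eq_zero hp0 hp hM N hzero D (fun v => ?_) ?_ b)
      · rw [hD, hFι, ← hι, hF', sub_self]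
      · intro ε hε
        obtain ⟨k, hk⟩ := hsmall ε hε
        obtain ⟨l, hl⟩ := exists_ball_of_continuous hadd hopen F'.continuous (map_zero F') hε
        refine ⟨max k l, fun a ha => ?_⟩
        rw [hD, sub_eq_add_neg]
        refine (hadd _ _).trans_lt (max_lt (hl _ (ball_anti (le_max_right k l) ha)) ?_)
        rw [map_neg_eq_map]
        exact hk a (ball_anti (le_max_left k l) ha)

end LatticeCompletion

end Universal

/-! ### Topology of `GL_n(ℚ_p)` and the subgroup `H` -/

section GLTopology

lemma kappa_pos (p : ℕ) : 0 < kappa p := by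
  unfold kappa; split_ifs <;> norm_num

variable {p : ℕ} [Fact p.Prime] {n : ℕ}

/-- The topology of a unit group also involves the inverse; here `g⁻¹ = det(g)⁻¹ adj(g)` is already
continuous in the entries of `g`. -/
lemma isEmbedding_GL_val :
    IsEmbedding (Units.val : GL (Fin n) ℚ_[p] → Matrix (Fin n) (Fin n) ℚ_[p]) := by
  have hdet : Continuous fun A : Matrix (Fin n) (Fin n) ℚ_[p] => A.det :=
    Continuous.matrix_det continuous_id
  have hadj : Continuous fun A : Matrix (Fin n) (Fin n) ℚ_[p] => A.adjugate :=
    Continuous.matrix_adjugate continuous_id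
  refine Units.isEmbedding_val_mk' (f := fun A => (A.det)⁻¹ • A.adjugate) ?_ fun u => ?_
  · exact ContinuousOn.smul (hdet.continuousOn.inv₀ fun A hA =>
      ((Matrix.isUnit_iff_isUnit_det A).1 hA).ne_zero) hadj.continuousOn
  · rw [Matrix.coe_units_inv, Matrix.inv_def, Ring.inverse_eq_inv']

lemma continuous_GL_entry {R : Type*} [CommRing R] [TopologicalSpace R] (i j : Fin n) :
    Continuous fun g : GL (Fin n) R => (g : Matrix (Fin n) (Fin n) R) i j :=
  Units.continuous_val.matrix_elem i j

/-- Such a matrix is integral and congruent to `1` modulo `p^κ`, so its determinant is congruent to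
`1` and is a unit of `ℤ_p`: invertibility over `ℤ_p` is automatic. -/
lemma mem_H_of_norm_le {g : GL (Fin n) ℚ_[p]}
    (h : ∀ i j, ‖(g : Matrix (Fin n) (Fin n) ℚ_[p]) i j - (1 : Matrix (Fin n) (Fin n) ℚ_[p]) i j‖
      ≤ (p : ℝ) ^ (-(kappa p : ℤ))) : g ∈ H p n := by
  have hp1 : (p : ℝ) ^ (-(kappa p : ℤ)) < 1 := by
    rw [zpow_neg, zpow_natCast]
    exact inv_lt_one_of_one_lt₀ (one_lt_pow₀ (by exact_mod_cast (Fact.out : p.Prime).one_lt)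
      (kappa_pos p).ne')
  have hone : ∀ i j : Fin n, ‖(1 : Matrix (Fin n) (Fin n) ℚ_[p]) i j‖ ≤ 1 := fun i j => by
    rw [Matrix.one_apply]; split_ifs <;> simp
  have hg : ∀ i j, ‖(g : Matrix (Fin n) (Fin n) ℚ_[p]) i j‖ ≤ 1 := fun i j => by
    rw [← sub_add_cancel ((g : Matrix (Fin n) (Fin n) ℚ_[p]) i j)
      ((1 : Matrix (Fin n) (Fin n) ℚ_[p]) i j)]
    exact (IsUltrametricDist.norm_add_le_max _ _).trans (max_le ((h i j).trans hp1.le) (hone i j))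
  let X : Matrix (Fin n) (Fin n) ℤ_[p] := fun i j => ⟨_, hg i j⟩
  have hX : (PadicInt.toZModPow (p := p) (kappa p)).mapMatrix X = 1 := by
    rw [← map_one (PadicInt.toZModPow (p := p) (kappa p)).mapMatrix, ← sub_eq_zero, ← map_sub]
    ext i j
    change PadicInt.toZModPow (p := p) (kappa p) (X i j - (1 : Matrix (Fin n) (Fin n) ℤ_[p]) i j) = 0
    rw [← RingHom.mem_ker, PadicInt.ker_toZModPow, ← PadicInt.norm_le_pow_iff_mem_span_pow,
      PadicInt.norm_def, PadicInt.coe_sub]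
    convert h i j using 3
    by_cases hij : i = j <;> simp [hij, Matrix.one_apply]
  have hdet : IsUnit X.det := by
    have h1 : PadicInt.toZModPow (p := p) (kappa p) X.det = 1 := by
      rw [RingHom.map_det, hX, Matrix.det_one]
    rw [PadicInt.isUnit_iff]
    have h2 : ‖X.det - 1‖ ≤ (p : ℝ) ^ (-(kappa p : ℤ)) := by
      rw [PadicInt.norm_le_pow_iff_mem_span_pow, ← PadicInt.ker_toZModPow, RingHom.mem_ker,
        map_sub, h1, map_one, sub_self]
    have h3 := IsUltrametricDist.norm_eq_of_add_norm_lt_max (x := X.det) (y := -1)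
      (by
        rw [← sub_eq_add_neg, norm_neg, norm_one]
        exact (h2.trans_lt hp1).trans_le (le_max_right _ _))
    simpa using h3
  refine ⟨Matrix.GeneralLinearGroup.mk'' X hdet, ?_, ?_⟩
  · refine MonoidHom.mem_ker.2 (Units.ext ?_)
    exact hX
  · refine Units.ext ?_
    rfl

lemma isOpen_H : IsOpen (H p n : Set (GL (Fin n) ℚ_[p])) := by
  refine Subgroup.isOpen_of_mem_nhds (H p n) (g := 1) ?_
  have h : ∀ i j : Fin n, ∀ᶠ g : GL (Fin n) ℚ_[p] in 𝓝 1,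
      ‖(g : Matrix (Fin n) (Fin n) ℚ_[p]) i j - (1 : Matrix (Fin n) (Fin n) ℚ_[p]) i j‖
        < (p : ℝ) ^ (-(kappa p : ℤ)) := by
    intro i j
    have hc : Continuous fun g : GL (Fin n) ℚ_[p] =>
        ‖(g : Matrix (Fin n) (Fin n) ℚ_[p]) i j - (1 : Matrix (Fin n) (Fin n) ℚ_[p]) i j‖ :=
      ((continuous_GL_entry i j).sub continuous_const).norm
    refine hc.tendsto 1 |>.eventually (gt_mem_nhds ?_)
    simp only [Units.val_one, sub_self, norm_zero]
    exact zpow_pos (by exact_mod_cast (Fact.out : p.Prime).pos) _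
  filter_upwards [eventually_all.2 fun i => eventually_all.2 (h i)] with g hg
  exact mem_H_of_norm_le fun i j => (hg i j).le

lemma isCompact_H : IsCompact (H p n : Set (GL (Fin n) ℚ_[p])) := by
  have hc : Continuous (Matrix.GeneralLinearGroup.map (n := Fin n) (algebraMap ℤ_[p] ℚ_[p])) :=
    Continuous.generalLinearGroup_map continuous_subtype_val
  have : CompactSpace (Matrix (Fin n) (Fin n) ℤ_[p]) :=
    inferInstanceAs (CompactSpace (Fin n → Fin n → ℤ_[p]))
  have : CompactSpace (GL (Fin n) ℤ_[p]) :=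
    inferInstanceAs (CompactSpace (Matrix (Fin n) (Fin n) ℤ_[p])ˣ)
  refine IsCompact.image (IsClosed.isCompact ?_) hc
  have : ((Matrix.GeneralLinearGroup.map (n := Fin n)
      (PadicInt.toZModPow (p := p) (kappa p))).ker : Set (GL (Fin n) ℤ_[p]))
      = ⋂ i, ⋂ j, {g : GL (Fin n) ℤ_[p] | ‖(g : Matrix (Fin n) (Fin n) ℤ_[p]) i j
        - (1 : Matrix (Fin n) (Fin n) ℤ_[p]) i j‖ ≤ (p : ℝ) ^ (-(kappa p : ℤ))} := by
    ext g
    simp only [SetLike.mem_coe, MonoidHom.mem_ker, Set.mem_iInter, Set.mem_ofPred_eq,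
      PadicInt.norm_le_pow_iff_mem_span_pow, ← PadicInt.ker_toZModPow, RingHom.mem_ker, map_sub,
      sub_eq_zero]
    rw [Matrix.GeneralLinearGroup.ext_iff]
    refine forall₂_congr fun i j => ?_
    change PadicInt.toZModPow (p := p) (kappa p) ((g : Matrix (Fin n) (Fin n) ℤ_[p]) i j) = _ ↔ _
    by_cases hij : i = j <;> simp [hij, Matrix.one_apply]
  rw [this]
  refine isClosed_iInter fun i => isClosed_iInter fun j => ?_
  refine isClosed_le ?_ continuous_const
  exact ((continuous_GL_entry i j).sub continuous_const).norm

lemma generator_mem_H (ij : Fin n × Fin n) : generator p ij ∈ H p n := by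
  refine mem_H_of_norm_le fun i j => ?_
  change ‖(1 + Matrix.single ij.1 ij.2 ((p : ℚ_[p]) ^ kappa p) : Matrix (Fin n) (Fin n) ℚ_[p]) i j
    - (1 : Matrix (Fin n) (Fin n) ℚ_[p]) i j‖ ≤ _
  rw [Matrix.add_apply, add_sub_cancel_left, Matrix.single_apply]
  split_ifs
  · rw [norm_pow, Padic.norm_p, zpow_neg, zpow_natCast, inv_pow]
  · rw [norm_zero]; positivity

lemma dist1_eq_zero {g : GL (Fin n) ℚ_[p]} (hg : g ∈ H p n) : dist1 g = 0 := by
  refine Nat.sInf_eq_zero.2 (Or.inl fun a ha => ?_)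
  rw [pow_zero, pow_one]
  exact mul_mem (mul_mem (inv_mem hg) ha) hg

/-- The quotient is discrete because `H` is open, and Lindelöf because the group is second
countable. Countability is what allows Baire's theorem to be used on a sum over the group. -/
lemma countable_quotient_H : Countable (GL (Fin n) ℚ_[p] ⧸ H p n) := by
  have : SecondCountableTopology (Matrix (Fin n) (Fin n) ℚ_[p]) :=
    inferInstanceAs (SecondCountableTopology (Fin n → Fin n → ℚ_[p]))
  have : SecondCountableTopology (GL (Fin n) ℚ_[p]) :=
    isEmbedding_GL_val.secondCountableTopology
  have : DiscreteTopology (GL (Fin n) ℚ_[p] ⧸ H p n) := QuotientGroup.discreteTopology isOpen_H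
  exact countable_of_Lindelof_of_discrete

end GLTopology

/-! ### An open mapping theorem for countable families -/

section OpenMapping

variable {L : Type*} [NontriviallyNormedField L]
variable {X Y : Type*} [NormedAddCommGroup X] [NormedSpace L X] [NormedAddCommGroup Y]
  [NormedSpace L Y]

/-- The second half of the proof of the open mapping theorem. The conclusion of Baire's theorem
replaces surjectivity, which is not known beforehand for a finite part of a countable family. -/
lemma exists_preimage_norm_le_of_interior_closure_nonempty [CompleteSpace X] (T : X →L[L] Y)
    {R : ℝ} (h : (interior (closure (T '' Metric.closedBall 0 R))).Nonempty) :
    ∃ δ > 0, ∃ C, ∀ y, ‖y‖ < δ → ∃ x, T x = y ∧ ‖x‖ ≤ C := by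
  obtain ⟨c, hc0, hc1⟩ := NormedField.exists_norm_lt_one L
  obtain ⟨y₀, hy₀⟩ := h
  obtain ⟨δ, hδ, hball⟩ := Metric.isOpen_iff.1 isOpen_interior y₀ hy₀
  have hball' : ∀ y, ‖y‖ < δ → y₀ + y ∈ closure (T '' Metric.closedBall 0 R) := fun y hy =>
    interior_subset (hball (by simpa [dist_eq_norm] using hy))
  -- Subtracting an approximation of `y₀` from one of `y₀ + y` recentres the ball at `0`, at the
  -- price of replacing `R` by `R + R`.
  have happ : ∀ y, ‖y‖ < δ → ∀ η > 0, ∃ x, ‖x‖ ≤ R + R ∧ ‖y - T x‖ < η := by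
    intro y hy η hη
    obtain ⟨_, ⟨x₁, hx₁, rfl⟩, h₁⟩ := Metric.mem_closure_iff.1 (hball' y hy) (η / 2) (half_pos hη)
    obtain ⟨_, ⟨x₂, hx₂, rfl⟩, h₂⟩ := Metric.mem_closure_iff.1 (hball' 0 (by simpa)) (η / 2)
      (half_pos hη)
    refine ⟨x₁ - x₂, (norm_sub_le _ _).trans (add_le_add (by simpa using hx₁)
      (by simpa using hx₂)), ?_⟩
    rw [dist_eq_norm] at h₁ h₂
    have : y - T (x₁ - x₂) = (y₀ + y - T x₁) - (y₀ + 0 - T x₂) := by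
      rw [map_sub]; abel
    rw [this]
    exact (norm_sub_le _ _).trans_lt (by linarith)
  -- Scaling by `c^k` gives preimages of size `‖c‖^k` whose error is smaller by one more factor
  -- `‖c‖`; the corrections sum to an exact preimage.
  have hstep : ∀ (k : ℕ) (y : {y : Y // ‖y‖ < δ * ‖c‖ ^ k}),
      ∃ x, ‖x‖ ≤ (R + R) * ‖c‖ ^ k ∧ ‖(y : Y) - T x‖ < δ * ‖c‖ ^ (k + 1) := by
    rintro k ⟨y, hy⟩
    have hck : 0 < ‖c‖ ^ k := pow_pos hc0 k
    have hck' : c ^ k ≠ 0 := pow_ne_zero k (norm_pos_iff.1 hc0)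
    obtain ⟨x, hx, hx'⟩ := happ ((c ^ k)⁻¹ • y) (by
      rw [norm_smul, norm_inv, norm_pow, inv_mul_lt_iff₀ hck, mul_comm]
      exact hy) (δ * ‖c‖) (mul_pos hδ hc0)
    refine ⟨c ^ k • x, ?_, ?_⟩
    · rw [norm_smul, norm_pow, mul_comm]
      exact mul_le_mul_of_nonneg_right hx hck.le
    · have : y - T (c ^ k • x) = c ^ k • ((c ^ k)⁻¹ • y - T x) := by
        rw [smul_sub, smul_inv_smul₀ hck', map_smul]
      rw [this, norm_smul, norm_pow, pow_succ', ← mul_assoc, mul_comm]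
      exact mul_lt_mul_of_pos_right hx' hck
  choose s hs hs' using hstep
  refine ⟨δ, hδ, ∑' k, (R + R) * ‖c‖ ^ k, fun y hy => ?_⟩
  let z : (k : ℕ) → {y : Y // ‖y‖ < δ * ‖c‖ ^ k} := fun k =>
    Nat.rec ⟨y, by simpa using hy⟩ (fun k a => ⟨(a : Y) - T (s k a), hs' k a⟩) k
  have hz : ∀ k, (z (k + 1)).1 = (z k).1 - T (s k (z k)) := fun k => rfl
  have hsumm : Summable fun k => (R + R) * ‖c‖ ^ k :=
    (summable_geometric_of_lt_one (norm_nonneg _) hc1).mul_left _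
  have hsum : Summable fun k => s k (z k) := Summable.of_norm_bounded hsumm fun k => hs k (z k)
  have hpart : ∀ k, ∑ i ∈ Finset.range k, T (s i (z i)) = y - (z k).1 := by
    intro k
    induction k with
    | zero => simp [z]
    | succ k ih => rw [Finset.sum_range_succ, ih, hz]; abel
  have hz0 : Tendsto (fun k => (z k).1) atTop (𝓝 0) := by
    refine squeeze_zero_norm (fun k => (z k).2.le) ?_
    simpa using (tendsto_pow_atTop_nhds_zero_of_lt_one (norm_nonneg c) hc1).const_mul δ
  refine ⟨∑' k, s k (z k), ?_, ?_⟩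
  · have h1 := ((T.hasSum hsum.hasSum).tendsto_sum_nat)
    simp only [hpart] at h1
    have h2 : Tendsto (fun k => y - (z k).1) atTop (𝓝 (y - 0)) := tendsto_const_nhds.sub hz0
    rw [sub_zero] at h2
    exact tendsto_nhds_unique h1 h2
  · exact tsum_of_norm_bounded hsumm.hasSum fun k => hs k (z k)

/-- Each vector is a finite sum of images, so `Y` is covered by the closures of the images of balls
under the finite partial sums `S F`, with integral radii. Only countably many such sets occur, so
one has interior points, and the corresponding `S F` has preimages of controlled norm. -/
lemma exists_ball_subset_of_iSup_range_eq_top [CompleteSpace X] [CompleteSpace Y] {ι : Type*}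
    [Countable ι] (T : ι → X →L[L] Y) (hT : ⨆ i, LinearMap.range (T i : X →ₗ[L] Y) = ⊤)
    (A : AddSubgroup Y) (hA : ∀ i x, ‖x‖ ≤ 1 → T i x ∈ A) :
    ∃ ε > 0, ∀ y, ‖y‖ ≤ ε → y ∈ A := by
  classical
  obtain ⟨c, hc0, hc1⟩ := NormedField.exists_norm_lt_one L
  let S : (F : Finset ι) → (F → X) →L[L] Y := fun F =>
    ∑ i : F, (T i).comp (ContinuousLinearMap.proj (R := L) (φ := fun _ : F => X) i)
  have hS : ∀ F x, S F x = ∑ i : F, T i (x i) := fun F x => by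
    simp [S]
  let Q : Finset ι × ℕ → Set Y := fun q => closure (S q.1 '' Metric.closedBall 0 q.2)
  have hcov : ⋃ q, Q q = Set.univ := by
    refine Set.eq_univ_of_forall fun y => ?_
    have hy : y ∈ ⨆ i, LinearMap.range (T i : X →ₗ[L] Y) := hT ▸ Submodule.mem_top
    obtain ⟨f, hf, hfy⟩ := (Submodule.mem_iSup_iff_exists_finsupp _ _).1 hy
    choose g hg using hf
    let x : f.support → X := fun i => g i
    obtain ⟨N, hN⟩ := exists_nat_ge ‖x‖
    refine Set.mem_iUnion.2 ⟨(f.support, N), subset_closure ⟨x, by simpa using hN, ?_⟩⟩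
    have h : ∑ i : f.support, T i (x i) = ∑ i : f.support, f i :=
      Finset.sum_congr rfl fun i _ => hg i
    exact (hS _ _).trans (h.trans ((Finset.sum_coe_sort f.support f).trans hfy))
  obtain ⟨⟨F, N⟩, hq⟩ := nonempty_interior_of_iUnion_of_closed (fun q => isClosed_closure) hcov
  obtain ⟨δ, hδ, C, hC⟩ := exists_preimage_norm_le_of_interior_closure_nonempty (S F) hq
  have hlim : Tendsto (fun k : ℕ => ‖c‖ ^ k * C) atTop (𝓝 0) := by
    simpa using (tendsto_pow_atTop_nhds_zero_of_lt_one (norm_nonneg c) hc1).mul_const C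
  obtain ⟨k, hk⟩ := (hlim.eventually (gt_mem_nhds zero_lt_one)).exists
  have hck : c ^ k ≠ 0 := pow_ne_zero k (norm_pos_iff.1 hc0)
  -- Scaling by `c^k` brings preimages of norm at most `C` into the unit ball, where `hA` applies;
  -- `δ / 2` turns `≤` into the strict inequality required by `hC`.
  refine ⟨‖c ^ k‖ * (δ / 2), mul_pos (norm_pos_iff.2 hck) (half_pos hδ), fun y hy => ?_⟩
  obtain ⟨x, hx, hxC⟩ := hC ((c ^ k)⁻¹ • y) (by
    rw [norm_smul, norm_inv, inv_mul_lt_iff₀ (norm_pos_iff.2 hck)]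
    exact hy.trans_lt (mul_lt_mul_of_pos_left (half_lt_self hδ) (norm_pos_iff.2 hck)))
  have hyx : y = S F (c ^ k • x) := by rw [map_smul, hx, smul_inv_smul₀ hck]
  rw [hyx, hS]
  refine sum_mem fun i _ => hA _ _ ?_
  refine (norm_le_pi_norm (c ^ k • x) i).trans ?_
  rw [norm_smul, norm_pow]
  exact (mul_le_mul_of_nonneg_left hxC (by positivity)).trans hk.le

end OpenMapping

/-! ### The Banach spaces `Π^(h)` -/

section PiHBanach

variable {p : ℕ} [Fact p.Prime] {n : ℕ}
variable {L : Type u} [NormedField L]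
variable {E : Type v} [NormedAddCommGroup E] [NormedSpace L E]
variable {ρ : Representation L (GL (Fin n) ℚ_[p]) E}

lemma IsContinuousRep.continuous_apply (hρ : IsContinuousRep ρ) (g : GL (Fin n) ℚ_[p]) :
    Continuous (ρ g) :=
  hρ.comp (Continuous.prodMk_right g)

lemma IsContinuousRep.continuous_bOp (hρ : IsContinuousRep ρ) (α : Fin n × Fin n → ℕ) :
    Continuous (bOp ρ α) := by
  unfold bOp
  induction List.finRange n ×ˢ List.finRange n with
  | nil => exact continuous_id
  | cons ij l ih =>
    rw [List.map_cons, List.prod_cons]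
    refine Continuous.comp (g := ((ρ (generator p ij) - 1) ^ α ij : Module.End L E)) ?_ ih
    rw [Module.End.coe_pow]
    exact Continuous.iterate ((hρ.continuous_apply _).sub continuous_id) _

lemma bOp_zero : bOp ρ 0 = 1 := by
  unfold bOp
  exact List.prod_eq_one (by simp)

lemma degree_zero : degree (0 : Fin n × Fin n → ℕ) = 0 := by simp [degree]

lemma bddAbove_normH {h : ℕ} {e : E} (he : e ∈ PiH ρ h) : BddAbove (Set.range
    fun α : Fin n × Fin n → ℕ => (p : ℝ) ^ (radius p h * degree α) * ‖bOp ρ α e‖) :=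
  Filter.Tendsto.bddAbove_range_of_cofinite he

lemma le_normH {h : ℕ} {e : E} (he : e ∈ PiH ρ h) (α : Fin n × Fin n → ℕ) :
    (p : ℝ) ^ (radius p h * degree α) * ‖bOp ρ α e‖ ≤ normH ρ h e :=
  le_ciSup (bddAbove_normH he) α

lemma norm_le_normH {h : ℕ} {e : E} (he : e ∈ PiH ρ h) : ‖e‖ ≤ normH ρ h e := by
  have := le_normH he 0
  rwa [degree_zero, bOp_zero, Nat.cast_zero, mul_zero, Real.rpow_zero, one_mul] at this

lemma normH_nonneg (h : ℕ) (e : E) : 0 ≤ normH ρ h e :=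
  Real.iSup_nonneg fun α => by positivity

variable (ρ) in
/-- The space `Π^(h)` with the norm `‖·‖_h`. -/
def PiHBanach (h : ℕ) : Type v := PiH ρ h

instance (h : ℕ) : AddCommGroup (PiHBanach ρ h) := inferInstanceAs (AddCommGroup (PiH ρ h))

instance (h : ℕ) : Module L (PiHBanach ρ h) := inferInstanceAs (Module L (PiH ρ h))

instance (h : ℕ) : Norm (PiHBanach ρ h) := ⟨fun e => normH ρ h ((PiH ρ h).subtype e)⟩

variable (ρ) in
/-- The inclusion of `Π^(h)` in `Π`. -/
def PiHBanach.incl (h : ℕ) : PiHBanach ρ h →ₗ[L] E := (PiH ρ h).subtype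

lemma PiHBanach.incl_mem {h : ℕ} (e : PiHBanach ρ h) : incl ρ h e ∈ PiH ρ h := Subtype.prop _

lemma PiHBanach.incl_injective (h : ℕ) : Function.Injective (incl ρ h) := Subtype.val_injective

lemma PiHBanach.norm_def {h : ℕ} (e : PiHBanach ρ h) : ‖e‖ = normH ρ h (incl ρ h e) := rfl

lemma PiHBanach.core (h : ℕ) : NormedSpace.Core L (PiHBanach ρ h) where
  norm_nonneg e := normH_nonneg _ _
  norm_smul c e := by
    rw [norm_def, norm_def, normH, normH, map_smul, Real.mul_iSup_of_nonneg (norm_nonneg c)]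
    congr 1; ext α
    rw [map_smul, norm_smul]; ring
  norm_triangle e f := by
    rw [norm_def, norm_def, norm_def, map_add]
    refine ciSup_le fun α => ?_
    rw [map_add]
    refine (mul_le_mul_of_nonneg_left (norm_add_le _ _) (by positivity)).trans ?_
    rw [mul_add]
    exact add_le_add (le_normH (incl_mem e) α) (le_normH (incl_mem f) α)
  norm_eq_zero_iff e := by
    refine ⟨fun h0 => ?_, ?_⟩
    · have h1 := norm_le_normH (incl_mem e)
      rw [← norm_def, h0, norm_le_zero_iff] at h1
      exact incl_injective h (h1.trans (map_zero _).symm)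
    · rintro rfl
      rw [norm_def, normH, map_zero]
      simp

instance (h : ℕ) : NormedAddCommGroup (PiHBanach ρ h) :=
  NormedAddCommGroup.ofCore (PiHBanach.core (ρ := ρ) h)

instance (h : ℕ) : NormedSpace L (PiHBanach ρ h) := NormedSpace.ofCore (PiHBanach.core (ρ := ρ) h)

lemma PiHBanach.norm_incl_le {h : ℕ} (e : PiHBanach ρ h) : ‖incl ρ h e‖ ≤ ‖e‖ :=
  norm_le_normH (incl_mem e)

lemma PiHBanach.continuous_incl (h : ℕ) : Continuous (incl ρ h) :=
  AddMonoidHomClass.continuous_of_bound (incl ρ h) 1 fun e => by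
    rw [one_mul]; exact norm_incl_le e

/-- A Cauchy sequence converges in `E`, and each `b^α` is continuous on `E`. The Cauchy estimates,
uniform in `α`, therefore pass to the limit. -/
lemma completeSpace_PiHBanach [CompleteSpace E] (hρ : IsContinuousRep ρ) (h : ℕ) :
    CompleteSpace (PiHBanach ρ h) := by
  refine Metric.complete_of_cauchySeq_tendsto fun s hs => ?_
  obtain ⟨e, he⟩ := cauchySeq_tendsto_of_complete
    ((uniformContinuous_addMonoidHom_of_continuous
      (PiHBanach.continuous_incl (ρ := ρ) h)).comp_cauchySeq hs)
  have key : ∀ ε > 0, ∃ N, ∀ i ≥ N, ∀ α : Fin n × Fin n → ℕ,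
      (p : ℝ) ^ (radius p h * degree α) * ‖bOp ρ α (e - PiHBanach.incl ρ h (s i))‖ ≤ ε := by
    intro ε hε
    obtain ⟨N, hN⟩ := Metric.cauchySeq_iff.1 hs ε hε
    refine ⟨N, fun i hi α => ?_⟩
    have hlim : Tendsto (fun j => (p : ℝ) ^ (radius p h * degree α) *
        ‖bOp ρ α (PiHBanach.incl ρ h (s j) - PiHBanach.incl ρ h (s i))‖) atTop
        (𝓝 ((p : ℝ) ^ (radius p h * degree α) * ‖bOp ρ α (e - PiHBanach.incl ρ h (s i))‖)) :=
      (((hρ.continuous_bOp α).tendsto _).comp (he.sub_const _)).norm.const_mul _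
    refine le_of_tendsto hlim (eventually_atTop.2 ⟨N, fun j hj => ?_⟩)
    rw [← map_sub]
    refine (le_normH (PiHBanach.incl_mem _) α).trans ?_
    have := hN j hj i hi
    rw [dist_eq_norm] at this
    exact this.le
  have hmem : e ∈ PiH ρ h := by
    refine Metric.tendsto_nhds.2 fun ε hε => ?_
    obtain ⟨N, hN⟩ := key (ε / 2) (half_pos hε)
    have h1 : ∀ᶠ α : Fin n × Fin n → ℕ in cofinite, (p : ℝ) ^ (radius p h * degree α) *
      ‖bOp ρ α (PiHBanach.incl ρ h (s N))‖ < ε / 2 :=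
      Tendsto.eventually (PiHBanach.incl_mem (s N)) (gt_mem_nhds (half_pos hε))
    filter_upwards [h1] with α hα
    rw [Real.dist_eq, sub_zero, abs_of_nonneg (by positivity)]
    have h2 := hN N le_rfl α
    have h3 : ‖bOp ρ α e‖ ≤ ‖bOp ρ α (e - PiHBanach.incl ρ h (s N))‖
        + ‖bOp ρ α (PiHBanach.incl ρ h (s N))‖ := by
      rw [map_sub]; exact norm_le_norm_sub_add _ _
    have h4 := mul_le_mul_of_nonneg_left h3
      (show (0 : ℝ) ≤ (p : ℝ) ^ (radius p h * degree α) by positivity)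
    rw [mul_add] at h4
    linarith
  let e' : PiHBanach ρ h := (⟨e, hmem⟩ : PiH ρ h)
  refine ⟨e', Metric.tendsto_atTop.2 fun ε hε => ?_⟩
  obtain ⟨N, hN⟩ := key (ε / 2) (half_pos hε)
  refine ⟨N, fun i hi => ?_⟩
  rw [dist_comm, dist_eq_norm]
  refine lt_of_le_of_lt ?_ (half_lt_self hε)
  exact ciSup_le (hN i hi)

lemma radius_pos (h : ℕ) : 0 < radius p h := by
  have hp : (1 : ℝ) < p := by exact_mod_cast (Fact.out : p.Prime).one_lt
  exact one_div_pos.2 (mul_pos (by positivity) (sub_pos.2 hp))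

lemma radius_anti {h h' : ℕ} (hh : h ≤ h') : radius p h' ≤ radius p h := by
  have hp : (1 : ℝ) < p := by exact_mod_cast (Fact.out : p.Prime).one_lt
  refine one_div_le_one_div_of_le (mul_pos (by positivity) (sub_pos.2 hp)) ?_
  exact mul_le_mul_of_nonneg_right (pow_le_pow_right₀ hp.le (by omega)) (sub_pos.2 hp).le

lemma weight_le {h h' : ℕ} (hh : h ≤ h') (α : Fin n × Fin n → ℕ) :
    (p : ℝ) ^ (radius p h' * degree α) ≤ (p : ℝ) ^ (radius p h * degree α) :=
  Real.rpow_le_rpow_of_exponent_le (by exact_mod_cast (Fact.out : p.Prime).one_lt.le)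
    (mul_le_mul_of_nonneg_right (radius_anti hh) (Nat.cast_nonneg _))

lemma PiH_mono {h h' : ℕ} (hh : h ≤ h') : PiH ρ h ≤ PiH ρ h' := fun e he =>
  squeeze_zero (fun α => by positivity)
    (fun α => mul_le_mul_of_nonneg_right (weight_le hh α) (norm_nonneg _)) he

lemma normH_anti {h h' : ℕ} (hh : h ≤ h') {e : E} (he : e ∈ PiH ρ h) :
    normH ρ h' e ≤ normH ρ h e :=
  ciSup_le fun α => (mul_le_mul_of_nonneg_right (weight_le hh α) (norm_nonneg _)).trans
    (le_normH he α)

/-- Coherence with `k = 0`: the sum defining Π^(h) runs over all `g` with `d(g,1) = 0`, in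
particular over `H`. -/
lemma IsCoherentFrom.map_le {m : ℕ} (hm : IsCoherentFrom ρ m) {h : ℕ} (hh : m ≤ h)
    {g : GL (Fin n) ℚ_[p]} (hg : g ∈ H p n) : (PiH ρ h).map (ρ g) ≤ PiH ρ h := by
  have := hm.2 h hh 0
  rw [add_zero] at this
  conv_rhs => rw [this]
  exact le_iSup₂_of_le g (dist1_eq_zero hg).le le_rfl

lemma map_mul_eq (g g' : GL (Fin n) ℚ_[p]) (W : Submodule L E) :
    W.map (ρ (g * g')) = (W.map (ρ g')).map (ρ g) := by
  rw [← Submodule.map_comp, map_mul]; rfl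

end PiHBanach

/-! ### Openness of the lattice `∑_g g Π_0^(h)` -/

section Openness

variable {p : ℕ} [Fact p.Prime] {n : ℕ}
variable {L : Type u} [NontriviallyNormedField L]
variable {E : Type v} [NormedAddCommGroup E] [NormedSpace L E] [CompleteSpace E]
variable {ρ : Representation L (GL (Fin n) ℚ_[p]) E}

/-- A group element that maps `Π^(h)` to `Π^(h')`, as a continuous linear map. -/
lemma exists_clm_of_mapsTo (hρ : IsContinuousRep ρ) {h h' : ℕ} {g : GL (Fin n) ℚ_[p]}
    (hg : (PiH ρ h).map (ρ g) ≤ PiH ρ h') : ∃ T : PiHBanach ρ h →L[L] PiHBanach ρ h',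
      ∀ e, PiHBanach.incl ρ h' (T e) = ρ g (PiHBanach.incl ρ h e) := by
  have := completeSpace_PiHBanach hρ h
  have := completeSpace_PiHBanach hρ h'
  let T : PiHBanach ρ h →ₗ[L] PiHBanach ρ h' := LinearMap.codRestrict (PiH ρ h')
    (ρ g ∘ₗ PiHBanach.incl ρ h) fun e => hg ⟨_, PiHBanach.incl_mem e, rfl⟩
  have hT : ∀ e, PiHBanach.incl ρ h' (T e) = ρ g (PiHBanach.incl ρ h e) := fun e => rfl
  refine ⟨⟨T, T.continuous_of_seq_closed_graph fun s x y hx hy => ?_⟩, hT⟩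
  apply PiHBanach.incl_injective
  rw [hT]
  have h1 := ((PiHBanach.continuous_incl h').tendsto y).comp hy
  have h2 := ((hρ.continuous_apply g).tendsto _).comp
    (((PiHBanach.continuous_incl h).tendsto x).comp hx)
  exact tendsto_nhds_unique h1 h2

/-- In a coherent representation, an additive subgroup of `Π^(h+k)` that contains the `g Π_0^(h)`
is open. -/
lemma IsCoherentFrom.exists_ball_subset (hρ : IsContinuousRep ρ) {m : ℕ}
    (hm : IsCoherentFrom ρ m) {h : ℕ} (hh : m ≤ h) (k : ℕ)
    (A : AddSubgroup E) (hA : ∀ (g : GL (Fin n) ℚ_[p]), ∀ e ∈ PiH ρ h, normH ρ h e ≤ 1 →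
      ρ g e ∈ A) :
    ∃ ε > 0, ∀ e ∈ PiH ρ (h + k), normH ρ (h + k) e ≤ ε → e ∈ A := by
  have := completeSpace_PiHBanach hρ h
  have := completeSpace_PiHBanach hρ (h + k)
  have := countable_quotient_H (p := p) (n := n)
  -- Representatives of cosets give a countable index set. By `h1` and `h2` below, stability under
  -- `H` makes the image of Π^(h) independent of the representative.
  let ι := {q : GL (Fin n) ℚ_[p] ⧸ H p n // (PiH ρ h).map (ρ q.out) ≤ PiH ρ (h + k)}
  choose T hT using fun i : ι => exists_clm_of_mapsTo hρ i.2
  have hsup : PiH ρ (h + k) ≤ ⨆ i : ι, (PiH ρ h).map (ρ i.1.out) := by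
    refine (hm.2 h hh k).le.trans (iSup₂_le fun g hg => ?_)
    obtain ⟨a, ha⟩ := QuotientGroup.mk_out_eq_mul (H p n) g
    have h1 : (PiH ρ h).map (ρ (g : GL (Fin n) ℚ_[p] ⧸ H p n).out) ≤ (PiH ρ h).map (ρ g) := by
      rw [ha, map_mul_eq]
      exact Submodule.map_mono (hm.map_le hh a.2)
    have h2 : (PiH ρ h).map (ρ g) ≤ (PiH ρ h).map (ρ (g : GL (Fin n) ℚ_[p] ⧸ H p n).out) := by
      have : g = (g : GL (Fin n) ℚ_[p] ⧸ H p n).out * (a⁻¹ : H p n) := by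
        rw [ha]; simp
      conv_lhs => rw [this, map_mul_eq]
      exact Submodule.map_mono (hm.map_le hh (a⁻¹ : H p n).2)
    have h3 : (PiH ρ h).map (ρ g) ≤ PiH ρ (h + k) := by
      rw [hm.2 h hh k]
      exact le_iSup₂_of_le g hg le_rfl
    exact h2.trans (le_iSup (fun i : ι => (PiH ρ h).map (ρ i.1.out)) ⟨g, h1.trans h3⟩)
  have htop : ⨆ i, LinearMap.range (T i : PiHBanach ρ h →ₗ[L] PiHBanach ρ (h + k)) = ⊤ := by
    refine Submodule.map_injective_of_injective (PiHBanach.incl_injective (ρ := ρ) (h + k)) ?_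
    rw [Submodule.map_iSup]
    refine le_antisymm (iSup_le fun i => Submodule.map_mono le_top) ?_
    rintro _ ⟨e, -, rfl⟩
    refine (hsup.trans (iSup_mono fun i => ?_)) (PiHBanach.incl_mem e)
    rintro _ ⟨f, hf, rfl⟩
    exact ⟨_, ⟨(⟨f, hf⟩ : PiH ρ h), rfl⟩, hT i _⟩
  obtain ⟨ε, hε, h1⟩ := exists_ball_subset_of_iSup_range_eq_top T htop
    (A.comap (PiHBanach.incl ρ (h + k)).toAddMonoidHom) fun i x hx => by
      change PiHBanach.incl ρ (h + k) (T i x) ∈ A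
      rw [hT]
      exact hA _ _ (PiHBanach.incl_mem x) hx
  exact ⟨ε, hε, fun e he hee => h1 (⟨e, he⟩ : PiH ρ (h + k)) hee⟩

end Openness

/-! ### `p`-adic analyticity of `x ↦ (1 + T)^x` -/

section PowAnalytic

variable {p : ℕ} [Fact p.Prime]

lemma one_lt_prime_cast : (1 : ℝ) < p := by exact_mod_cast (Fact.out : p.Prime).one_lt

lemma norm_inv_factorial_le (k : ℕ) : ‖((k.factorial : ℚ_[p]))⁻¹‖ ≤ (p : ℝ) ^ k := by
  have h0 : (k.factorial : ℚ_[p]) ≠ 0 := by exact_mod_cast k.factorial_ne_zero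
  rw [norm_inv, Padic.norm_eq_zpow_neg_valuation h0, zpow_neg, inv_inv,
    Padic.valuation_natCast, zpow_natCast]
  refine pow_le_pow_right₀ one_lt_prime_cast.le ?_
  have h1 := sub_one_mul_padicValNat_factorial (p := p) k
  have h2 := (Fact.out : p.Prime).two_le
  have h3 : 1 * padicValNat p k.factorial ≤ (p - 1) * padicValNat p k.factorial :=
    Nat.mul_le_mul_right _ (by omega)
  omega

variable {A : Type*} [NormedRing A] [NormedAlgebra ℚ_[p] A]

/-- The coefficients of `(1 + T)^x = ∑_k x (x - 1) ⋯ (x - k + 1) T^k / k!` as a power series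
in `x`, before summation over `k`. -/
def powCoeff (p : ℕ) [Fact p.Prime] {A : Type*} [NormedRing A] [NormedAlgebra ℚ_[p] A] (T : A) (k m : ℕ) : A :=
  ((descPochhammer ℤ k).coeff m : ℚ_[p]) • ((k.factorial : ℚ_[p])⁻¹ • T ^ k)

/-- Of the factor `p^(-3k)`, one `p^k` pays for `1/k!`. The remaining `p^(-2k)` is at most `p^(-k)
p^(-m)`, as the coefficient vanishes for `m > k`; the bound is thus summable over both indices. -/
lemma norm_powCoeff_le {T : A} (hT : ∀ k, ‖T ^ k‖ ≤ ((p : ℝ)⁻¹ ^ 3) ^ k) (k m : ℕ) :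
    ‖powCoeff p T k m‖ ≤ (p : ℝ)⁻¹ ^ k * (p : ℝ)⁻¹ ^ m := by
  have hp := one_lt_prime_cast (p := p)
  have hpi : (p : ℝ)⁻¹ ≤ 1 := (inv_lt_one_of_one_lt₀ hp).le
  by_cases hm : k < m
  · rw [powCoeff, Polynomial.coeff_eq_zero_of_natDegree_lt (by rwa [descPochhammer_natDegree]),
      Int.cast_zero, zero_smul, norm_zero]
    positivity
  · have h1 : ‖(k.factorial : ℚ_[p])⁻¹ • T ^ k‖ ≤ (p : ℝ) ^ k * ((p : ℝ)⁻¹ ^ 3) ^ k := by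
      rw [norm_smul]
      exact mul_le_mul (norm_inv_factorial_le k) (hT k) (norm_nonneg _) (by positivity)
    rw [powCoeff, norm_smul]
    refine (mul_le_of_le_one_left (norm_nonneg _) (Padic.norm_int_le_one _)).trans (h1.trans ?_)
    have h2 : (p : ℝ) ^ k * ((p : ℝ)⁻¹ ^ 3) ^ k = (p : ℝ)⁻¹ ^ k * (p : ℝ)⁻¹ ^ k := by
      rw [← mul_pow, ← mul_pow]; congr 1; field_simp
    rw [h2]
    exact mul_le_mul_of_nonneg_left (pow_le_pow_of_le_one (by positivity) hpi (not_lt.1 hm))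
      (by positivity)

lemma sum_powCoeff (T : A) (k : ℕ) (y : ℚ_[p]) :
    HasSum (fun m => y ^ m • powCoeff p T k m)
      ((descPochhammer ℚ_[p] k).eval y • ((k.factorial : ℚ_[p])⁻¹ • T ^ k)) := by
  have h1 : (descPochhammer ℚ_[p] k).eval y
      = ∑ m ∈ Finset.range (k + 1), ((descPochhammer ℤ k).coeff m : ℚ_[p]) * y ^ m := by
    rw [← descPochhammer_map (Int.castRingHom ℚ_[p]), Polynomial.eval_map,
      Polynomial.eval₂_eq_sum_range, descPochhammer_natDegree]
    rfl
  rw [h1, Finset.sum_smul]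
  have h2 := hasSum_sum_of_ne_finset_zero (L := SummationFilter.unconditional ℕ) (f := fun m => y ^ m • powCoeff p T k m)
    (s := Finset.range (k + 1)) fun m hm => by
      rw [powCoeff, Polynomial.coeff_eq_zero_of_natDegree_lt, Int.cast_zero, zero_smul, smul_zero]
      rw [descPochhammer_natDegree]
      simpa using hm
  convert h2 using 1
  refine Finset.sum_congr rfl fun m _ => ?_
  rw [powCoeff, smul_smul (y ^ m), mul_comm]

lemma summable_inv_pow_mul : Summable fun q : ℕ × ℕ => (p : ℝ)⁻¹ ^ q.1 * (p : ℝ)⁻¹ ^ q.2 := by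
  have h : Summable fun k : ℕ => (p : ℝ)⁻¹ ^ k :=
    summable_geometric_of_lt_one (by positivity) (inv_lt_one_of_one_lt₀ one_lt_prime_cast)
  exact h.mul_of_nonneg h (fun _ => by positivity) (fun _ => by positivity)

/-- Modulo `p`, the `p^s`-th power of `1 + T` is `1 + T^(p^s)`. Once `p^s ≥ K` the difference with
`1` is divisible by `p` in norm, and each further `p`-th power gains another factor `p`. -/
lemma exists_norm_one_add_pow_sub_one_le [IsUltrametricDist A] (hone : ‖(1 : A)‖ ≤ 1) {T : A}
    (hT : ‖T‖ ≤ 1) {K : ℕ} (hTK : ‖T ^ K‖ ≤ (p : ℝ)⁻¹) (j : ℕ) :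
    ∃ N, ‖(1 + T) ^ p ^ N - 1‖ ≤ (p : ℝ)⁻¹ ^ (j + 1) := by
  have hp := (Fact.out : p.Prime)
  -- The congruence is applied inside the unit ball so that the multiple of `p` has a cofactor of
  -- norm at most `1`.
  let O : Subring A :=
    { carrier := {a | ‖a‖ ≤ 1}
      mul_mem' := fun ha hb => (norm_mul_le _ _).trans (mul_le_one₀ ha (norm_nonneg _) hb)
      one_mem' := hone
      add_mem' := fun ha hb => (IsUltrametricDist.norm_add_le_max _ _).trans (max_le ha hb)
      zero_mem' := by simp
      neg_mem' := fun ha => by simpa using ha }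
  have hpA : ∀ a : A, ‖(p : A) * a‖ = (p : ℝ)⁻¹ * ‖a‖ := fun a => by
    rw [← nsmul_eq_mul, ← Nat.cast_smul_eq_nsmul ℚ_[p], norm_smul, Padic.norm_p]
  have hstep : ∀ (U : A) (s : ℕ), ‖U‖ ≤ 1 →
      ‖(1 + U) ^ p ^ s - 1‖ ≤ max ‖U ^ p ^ s‖ ((p : ℝ)⁻¹ * ‖U‖) := by
    intro U s hU
    obtain ⟨r, hr⟩ := (Commute.one_left (⟨U, hU⟩ : O)).exists_add_pow_prime_pow_eq hp s
    have hr' := congrArg Subtype.val hr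
    have h1 : (1 + U) ^ p ^ s - 1 = U ^ p ^ s + (p : A) * (U * r) := by
      have : (1 + U) ^ p ^ s = 1 ^ p ^ s + U ^ p ^ s + p * 1 * U * r := hr'
      rw [this, one_pow, mul_one, mul_assoc]; abel
    rw [h1]
    refine (IsUltrametricDist.norm_add_le_max _ _).trans (max_le_max le_rfl ?_)
    rw [hpA]
    exact mul_le_mul_of_nonneg_left ((norm_mul_le _ _).trans
      (mul_le_of_le_one_right (norm_nonneg _) r.2)) (by positivity)
  have hpi : (p : ℝ)⁻¹ ≤ 1 := (inv_lt_one_of_one_lt₀ one_lt_prime_cast).le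
  induction j with
  | zero =>
    obtain ⟨s, hs⟩ : ∃ s, K ≤ p ^ s := ⟨K, (Nat.lt_pow_self hp.one_lt).le⟩
    refine ⟨s, (hstep T s hT).trans (max_le ?_ ?_)⟩
    · rw [zero_add, pow_one, ← Nat.sub_add_cancel hs, pow_add]
      refine (norm_mul_le _ _).trans ((mul_le_of_le_one_left (norm_nonneg _) ?_).trans hTK)
      exact pow_mem (show T ∈ O from hT) _
    · rw [zero_add, pow_one]
      exact mul_le_of_le_one_right (by positivity) hT
  | succ j ih =>
    obtain ⟨N, hN⟩ := ih
    refine ⟨N + 1, ?_⟩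
    have h1 := hstep ((1 + T) ^ p ^ N - 1) 1 (hN.trans (pow_le_one₀ (by positivity) hpi))
    rw [add_sub_cancel, pow_one, ← pow_mul, ← pow_succ] at h1
    refine h1.trans (max_le ?_ ?_)
    · refine (norm_pow_le' _ hp.pos).trans ((pow_le_pow_left₀ (norm_nonneg _) hN p).trans ?_)
      rw [← pow_mul]
      refine pow_le_pow_of_le_one (by positivity) hpi ?_
      -- This is `(j + 1) p ≥ j + 2`, from `p ≥ 2`.
      nlinarith [hp.two_le]
    · rw [pow_succ' _ (j + 1)]
      exact mul_le_mul_of_nonneg_left hN (by positivity)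

variable [CompleteSpace A]

/-- The function `x ↦ (1 + T)^x`, for `T` small. -/
def padicPow (T : A) (y : ℚ_[p]) : A := ∑' m, y ^ m • ∑' k, powCoeff p T k m

/-- The double family over `k` and `m` is absolutely summable. Summed over `k` first it is a power
series in `y`; summed over `m` first it is the binomial series. -/
lemma hasSum_padicPow {T : A} (hT : ∀ k, ‖T ^ k‖ ≤ ((p : ℝ)⁻¹ ^ 3) ^ k) {y : ℚ_[p]}
    (hy : ‖y‖ ≤ 1) :
    HasSum (fun m => y ^ m • ∑' k, powCoeff p T k m) (padicPow T y) ∧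
    HasSum (fun k => (descPochhammer ℚ_[p] k).eval y • ((k.factorial : ℚ_[p])⁻¹ • T ^ k))
      (padicPow T y) := by
  have hbound : ∀ q : ℕ × ℕ, ‖y ^ q.2 • powCoeff p T q.1 q.2‖
      ≤ (p : ℝ)⁻¹ ^ q.1 * (p : ℝ)⁻¹ ^ q.2 := fun q => by
    rw [norm_smul, norm_pow]
    exact (mul_le_of_le_one_left (norm_nonneg _) (pow_le_one₀ (norm_nonneg _) hy)).trans
      (norm_powCoeff_le hT _ _)
  have hs : Summable fun q : ℕ × ℕ => y ^ q.2 • powCoeff p T q.1 q.2 :=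
    Summable.of_norm_bounded summable_inv_pow_mul hbound
  have hm : ∀ m, Summable fun k => powCoeff p T k m := fun m =>
    Summable.of_norm_bounded (summable_inv_pow_mul.comp_injective
      (i := fun k : ℕ => (k, m)) fun a b h => (Prod.ext_iff.1 h).1) fun k => norm_powCoeff_le hT k m
  have h1 := hs.hasSum.prod_fiberwise fun k => sum_powCoeff T k y
  have h2 := ((Equiv.prodComm ℕ ℕ).hasSum_iff.2 hs.hasSum).prod_fiberwise
    (g := fun m => y ^ m • ∑' k, powCoeff p T k m) fun m => (hm m).hasSum.const_smul (y ^ m)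
  have h3 : padicPow T y = ∑' q : ℕ × ℕ, y ^ q.2 • powCoeff p T q.1 q.2 := h2.tsum_eq
  rw [h3]
  exact ⟨h2, h1⟩

lemma padicPow_natCast {T : A} (hT : ∀ k, ‖T ^ k‖ ≤ ((p : ℝ)⁻¹ ^ 3) ^ k) (s : ℕ) :
    padicPow T (s : ℚ_[p]) = (1 + T) ^ s := by
  refine (hasSum_padicPow hT (by simpa using Padic.norm_int_le_one (p := p) s)).2.unique ?_
  have h1 : ∀ k, (descPochhammer ℚ_[p] k).eval (s : ℚ_[p]) • ((k.factorial : ℚ_[p])⁻¹ • T ^ k)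
      = s.choose k • T ^ k := fun k => by
    rw [descPochhammer_eval_eq_descFactorial, smul_smul, Nat.descFactorial_eq_factorial_mul_choose,
      Nat.cast_mul, mul_comm, inv_mul_cancel_left₀ (by exact_mod_cast k.factorial_ne_zero),
      Nat.cast_smul_eq_nsmul]
  simp only [h1]
  rw [add_comm, (Commute.one_right T).add_pow]
  simp only [one_pow, mul_one, ← nsmul_eq_mul']
  exact hasSum_sum_of_ne_finset_zero fun k hk => by
    rw [Nat.choose_eq_zero_of_lt (by simpa using hk), zero_smul]

variable (p) in
/-- The power series expansion of `x ↦ (1 + T)^x`, for `T` small. -/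
def powSeries (T : A) : FormalMultilinearSeries ℚ_[p] ℚ_[p] A := fun m =>
  ContinuousMultilinearMap.mkPiRing ℚ_[p] (Fin m) (∑' k, powCoeff p T k m)

lemma hasFPowerSeriesAt_padicPow {T : A} (hT : ∀ k, ‖T ^ k‖ ≤ ((p : ℝ)⁻¹ ^ 3) ^ k) :
    HasFPowerSeriesAt (padicPow T) (powSeries p T) 0 := by
  rw [hasFPowerSeriesAt_iff]
  filter_upwards [Metric.closedBall_mem_nhds (0 : ℚ_[p]) one_pos] with y hy
  rw [zero_add]
  have hcoeff : ∀ m, (powSeries p T).coeff m = ∑' k, powCoeff p T k m := fun m => by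
    simp [FormalMultilinearSeries.coeff, powSeries]
  simp only [hcoeff]
  exact (hasSum_padicPow hT (by simpa using hy)).1

/-- The derivative at `0` is the series of `log (1 + T)`. Its first term `T` strictly dominates the
rest, whose norm is at most `‖T‖ p⁻¹ / (1 - p⁻²)`. -/
lemma deriv_padicPow_ne_zero {T : ℚ_[p]} (hT : ‖T‖ ≤ (p : ℝ)⁻¹ ^ 3) (hT0 : T ≠ 0) :
    ∃ a ≠ 0, HasStrictDerivAt (padicPow T) a (0 : ℚ_[p]) := by
  have hT' : ∀ k, ‖T ^ k‖ ≤ ((p : ℝ)⁻¹ ^ 3) ^ k := fun k => by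
    rw [norm_pow]; exact pow_le_pow_left₀ (norm_nonneg _) hT k
  have h := (hasFPowerSeriesAt_padicPow hT').hasStrictDerivAt
  refine ⟨_, ?_, h⟩
  have hp := one_lt_prime_cast (p := p)
  have hp2 : (2 : ℝ) ≤ p := by exact_mod_cast (Fact.out : p.Prime).two_le
  have hTpos : 0 < ‖T‖ := norm_pos_iff.2 hT0
  have hs : Summable fun k => powCoeff p T k 1 :=
    Summable.of_norm_bounded (summable_inv_pow_mul.comp_injective
      (i := fun k : ℕ => (k, 1)) fun a b h => (Prod.ext_iff.1 h).1) fun k => norm_powCoeff_le hT' k 1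
  have h2 : ∀ k, ‖powCoeff p T (k + 2) 1‖ ≤ ‖T‖ * (p : ℝ)⁻¹ * ((p : ℝ)⁻¹ ^ 2) ^ k := by
    intro k
    rw [powCoeff, norm_smul, norm_smul, pow_succ', norm_mul]
    refine (mul_le_of_le_one_left (by positivity) (Padic.norm_int_le_one _)).trans ?_
    refine (mul_le_mul (norm_inv_factorial_le (k + 2)) (mul_le_mul_of_nonneg_left
      (hT' (k + 1)) hTpos.le) (by positivity) (by positivity)).trans_eq ?_
    have hpq : (p : ℝ) ^ (k + 2) * (p : ℝ)⁻¹ ^ (k + 2) = 1 := by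
      rw [← mul_pow, mul_inv_cancel₀ (by positivity), one_pow]
    calc (p : ℝ) ^ (k + 2) * (‖T‖ * ((p : ℝ)⁻¹ ^ 3) ^ (k + 1))
        = ‖T‖ * (p : ℝ)⁻¹ * ((p : ℝ)⁻¹ ^ 2) ^ k * ((p : ℝ) ^ (k + 2) * (p : ℝ)⁻¹ ^ (k + 2)) := by
          ring
      _ = _ := by rw [hpq, mul_one]
  have hgeo : Summable fun k => ‖T‖ * (p : ℝ)⁻¹ * ((p : ℝ)⁻¹ ^ 2) ^ k :=
    (summable_geometric_of_lt_one (by positivity) (pow_lt_one₀ (by positivity)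
      (inv_lt_one_of_one_lt₀ hp) two_ne_zero)).mul_left _
  have h3 : ‖∑' k, powCoeff p T (k + 2) 1‖ < ‖T‖ := by
    refine (tsum_of_norm_bounded hgeo.hasSum h2).trans_lt ?_
    rw [tsum_mul_left, tsum_geometric_of_lt_one (by positivity) (pow_lt_one₀ (by positivity)
      (inv_lt_one_of_one_lt₀ hp) two_ne_zero), mul_assoc]
    refine mul_lt_of_lt_one_right hTpos ?_
    have : (1 - (p : ℝ)⁻¹ ^ 2) > 0 := by
      have := pow_lt_one₀ (n := 2) (by positivity) (inv_lt_one_of_one_lt₀ hp) two_ne_zero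
      linarith
    rw [← div_eq_mul_inv, div_lt_one this]
    have h5 : (p : ℝ)⁻¹ ≤ 1 / 2 := by
      rw [one_div]; exact inv_anti₀ two_pos hp2
    have h6 : 0 < (p : ℝ)⁻¹ := by positivity
    nlinarith
  have h4 : ∑' k, powCoeff p T k 1 = T + ∑' k, powCoeff p T (k + 2) 1 := by
    rw [← hs.sum_add_tsum_nat_add 2]
    simp [Finset.sum_range_succ, powCoeff, descPochhammer, Polynomial.coeff_one]
  intro h0
  simp only [powSeries, ContinuousMultilinearMap.mkPiRing_apply, Finset.prod_const_one, one_smul] at h0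
  rw [h4] at h0
  rw [eq_neg_of_add_eq_zero_right h0, norm_neg] at h3
  exact lt_irrefl _ h3

/-- If `T` is topologically nilpotent, then `x ↦ (1 + T)^x` is given by a convergent power series
near `0`. -/
lemma exists_analyticAt_one_add_pow [IsUltrametricDist A] (hone : ‖(1 : A)‖ ≤ 1) {T : A}
    (hT : ‖T‖ ≤ 1) {K : ℕ} (hTK : ‖T ^ K‖ ≤ (p : ℝ)⁻¹) :
    ∃ (N : ℕ) (e : ℚ_[p] → A), AnalyticAt ℚ_[p] e 0 ∧
      ∀ s : ℕ, p ^ N ∣ s → e s = (1 + T) ^ s := by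
  -- The index `2` yields the bound `p⁻³` required by `padicPow`. Passing to the `p^N`-th power is
  -- compensated by dividing the variable by `p^N`.
  obtain ⟨N, hN⟩ := exists_norm_one_add_pow_sub_one_le (p := p) hone hT hTK 2
  have hT' : ∀ k, ‖((1 + T) ^ p ^ N - 1) ^ k‖ ≤ ((p : ℝ)⁻¹ ^ 3) ^ k := fun k => by
    rcases Nat.eq_zero_or_pos k with rfl | hk
    · simpa using hone
    · exact (norm_pow_le' _ hk).trans (pow_le_pow_left₀ (norm_nonneg _) hN k)
  have hpN : (p : ℚ_[p]) ^ N ≠ 0 := pow_ne_zero _ (by exact_mod_cast (Fact.out : p.Prime).ne_zero)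
  refine ⟨N, fun x => padicPow ((1 + T) ^ p ^ N - 1) (((p : ℚ_[p]) ^ N)⁻¹ * x), ?_, ?_⟩
  · have h1 : AnalyticAt ℚ_[p] (padicPow (p := p) ((1 + T) ^ p ^ N - 1)) (((p : ℚ_[p]) ^ N)⁻¹ * 0) := by
      rw [mul_zero]; exact (hasFPowerSeriesAt_padicPow hT').analyticAt
    exact h1.comp (analyticAt_const.mul analyticAt_id)
  · rintro _ ⟨s, rfl⟩
    push_cast
    rw [inv_mul_cancel_left₀ hpN, padicPow_natCast hT', add_sub_cancel, ← pow_mul]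

end PowAnalytic

/-! ### The one-parameter subgroups of the generators -/

section Generators

variable {p : ℕ} [Fact p.Prime] {n : ℕ}

/-- Over `ℚ_p`, the function `x ↦ (1 + T)^x` has nonzero derivative at `0`. -/
lemma exists_analyticAt_one_add_pow_deriv {T : ℚ_[p]} (hT : ‖T‖ ≤ (p : ℝ)⁻¹)
    (hne : ∀ N, (1 + T) ^ p ^ N ≠ 1) :
    ∃ (N : ℕ) (e : ℚ_[p] → ℚ_[p]), AnalyticAt ℚ_[p] e 0 ∧
      (∃ a ≠ 0, HasStrictDerivAt e a 0) ∧ ∀ s : ℕ, p ^ N ∣ s → e s = (1 + T) ^ s := by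
  have hpi : (p : ℝ)⁻¹ ≤ 1 := (inv_lt_one_of_one_lt₀ one_lt_prime_cast).le
  obtain ⟨N, hN⟩ := exists_norm_one_add_pow_sub_one_le (p := p) (A := ℚ_[p]) norm_one.le
    (hT.trans hpi) (K := 1) (by rwa [pow_one]) 2
  have hT' : ∀ k, ‖((1 + T) ^ p ^ N - 1) ^ k‖ ≤ ((p : ℝ)⁻¹ ^ 3) ^ k := fun k => by
    rw [norm_pow]; exact pow_le_pow_left₀ (norm_nonneg _) hN k
  obtain ⟨a, ha0, ha⟩ := deriv_padicPow_ne_zero hN (sub_ne_zero.2 (hne N))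
  have hpN : (p : ℚ_[p]) ^ N ≠ 0 := pow_ne_zero _ (by exact_mod_cast (Fact.out : p.Prime).ne_zero)
  refine ⟨N, fun x => padicPow ((1 + T) ^ p ^ N - 1) (((p : ℚ_[p]) ^ N)⁻¹ * x), ?_,
    ⟨a * ((p : ℚ_[p]) ^ N)⁻¹, mul_ne_zero ha0 (inv_ne_zero hpN), ?_⟩, ?_⟩
  · have h1 : AnalyticAt ℚ_[p] (padicPow (p := p) ((1 + T) ^ p ^ N - 1))
        (((p : ℚ_[p]) ^ N)⁻¹ * 0) := by
      rw [mul_zero]; exact (hasFPowerSeriesAt_padicPow hT').analyticAt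
    exact h1.comp (analyticAt_const.mul analyticAt_id)
  · have h1 : HasStrictDerivAt (fun x : ℚ_[p] => ((p : ℚ_[p]) ^ N)⁻¹ * x)
        ((p : ℚ_[p]) ^ N)⁻¹ 0 := by
      simpa using (hasStrictDerivAt_id (0 : ℚ_[p])).const_mul ((p : ℚ_[p]) ^ N)⁻¹
    refine HasStrictDerivAt.comp (0 : ℚ_[p]) (h₂ := padicPow ((1 + T) ^ p ^ N - 1)) ?_ h1
    rwa [mul_zero]
  · rintro _ ⟨s, rfl⟩
    push_cast
    rw [inv_mul_cancel_left₀ hpN, padicPow_natCast hT', add_sub_cancel, ← pow_mul]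

lemma one_add_single_pow_of_ne {i j : Fin n} (hij : i ≠ j) (c : ℚ_[p]) (s : ℕ) :
    (1 + Matrix.single i j c) ^ s = 1 + (s * c) • Matrix.single i j (1 : ℚ_[p]) := by
  induction s with
  | zero => simp
  | succ s ih =>
    rw [pow_succ, ih, mul_add, mul_one, add_mul, one_mul, smul_mul_assoc,
      Matrix.single_mul_single_of_ne _ _ _ _ hij.symm, smul_zero, add_zero, add_assoc]
    congr 1
    have : Matrix.single i j c = c • Matrix.single i j (1 : ℚ_[p]) := by simp
    rw [this, ← add_smul]
    congr 1
    push_cast; ring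

lemma one_add_single_pow_self (i : Fin n) (c : ℚ_[p]) (s : ℕ) :
    (1 + Matrix.single i i c) ^ s = 1 + ((1 + c) ^ s - 1) • Matrix.single i i (1 : ℚ_[p]) := by
  induction s with
  | zero => simp
  | succ s ih =>
    have : Matrix.single i i c = c • Matrix.single i i (1 : ℚ_[p]) := by simp
    rw [pow_succ, ih, this, mul_add, mul_one, add_mul, one_mul, smul_mul_smul_comm,
      Matrix.single_mul_single_same, mul_one, add_assoc, ← add_smul, ← add_smul]
    congr 2
    ring

lemma generator_pow_val (ij : Fin n × Fin n) (s : ℕ) :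
    ((generator p ij ^ s : GL (Fin n) ℚ_[p]) : Matrix (Fin n) (Fin n) ℚ_[p])
      = (1 + Matrix.single ij.1 ij.2 ((p : ℚ_[p]) ^ kappa p)) ^ s := rfl

/-- The one-parameter subgroup of a generator is analytic. -/
lemma exists_generator_pow (ij : Fin n × Fin n) : ∃ (N : ℕ) (c : ℚ_[p] → ℚ_[p]),
    AnalyticAt ℚ_[p] c 0 ∧ c 0 = 0 ∧ (∃ a ≠ 0, HasStrictDerivAt c a 0) ∧
      ∀ s : ℕ, p ^ N ∣ s →
        ((generator p ij ^ s : GL (Fin n) ℚ_[p]) : Matrix (Fin n) (Fin n) ℚ_[p])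
          = 1 + c s • Matrix.single ij.1 ij.2 (1 : ℚ_[p]) := by
  obtain ⟨i, j⟩ := ij
  have hp0 : (p : ℚ_[p]) ≠ 0 := by exact_mod_cast (Fact.out : p.Prime).ne_zero
  -- On the diagonal `E_ii` is idempotent and `c(s) = (1 + p^κ)^s - 1`. Off the diagonal `E_ij² = 0`
  -- and `c(s) = s p^κ`, with no divisibility condition.
  by_cases hij : i = j
  · subst hij
    obtain ⟨N, e, he, ⟨a, ha0, ha⟩, hes⟩ := exists_analyticAt_one_add_pow_deriv
      (p := p) (T := (p : ℚ_[p]) ^ kappa p) (by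
        rw [norm_pow, Padic.norm_p]
        exact pow_le_of_le_one (by positivity)
          (inv_lt_one_of_one_lt₀ one_lt_prime_cast).le (kappa_pos p).ne') (fun N h => by
        have h1 : (1 + p ^ kappa p) ^ p ^ N = 1 := by exact_mod_cast h
        have h2 : 0 < p ^ kappa p := pow_pos (Fact.out : p.Prime).pos _
        have h3 := Nat.one_lt_pow (pow_ne_zero N (Fact.out : p.Prime).ne_zero)
          (show 1 < 1 + p ^ kappa p by omega)
        omega)
    refine ⟨N, fun x => e x - 1, he.sub analyticAt_const, ?_, ⟨a, ha0, ha.sub_const 1⟩, ?_⟩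
    · have := hes 0 (dvd_zero _)
      rw [Nat.cast_zero, pow_zero] at this
      exact sub_eq_zero.2 this
    · intro s hs
      rw [generator_pow_val, one_add_single_pow_self, ← hes s hs]
  · refine ⟨0, fun x => x * (p : ℚ_[p]) ^ kappa p, analyticAt_id.mul analyticAt_const, zero_mul _,
      ⟨(p : ℚ_[p]) ^ kappa p, pow_ne_zero _ hp0, ?_⟩, fun s _ => ?_⟩
    · simpa using (hasStrictDerivAt_id (0 : ℚ_[p])).mul_const ((p : ℚ_[p]) ^ kappa p)
    · rw [generator_pow_val, one_add_single_pow_of_ne hij]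

end Generators

/-! ### Finite differences of analytic functions -/

section Differences

variable {p : ℕ} [Fact p.Prime]

/-- The coefficient of `f k` in the `j`-th finite difference of `f` at `0`. -/
def diffCoeff (j k : ℕ) : ℤ := (-1) ^ (j - k) * (j.choose k : ℤ)

lemma sum_diffCoeff_smul_pow {j m : ℕ} (h : m < j) :
    ∑ k ∈ Finset.range (j + 1), (diffCoeff j k : ℚ_[p]) * (k : ℚ_[p]) ^ m = 0 := by
  have h1 := fwdDiff_iter_eq_sum_shift (1 : ℚ_[p]) (fun r => r ^ m) j 0
  rw [fwdDiff_iter_pow_eq_zero_of_lt h] at h1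
  simpa [diffCoeff, eq_comm] using h1

lemma sub_one_pow_eq_sum {R : Type*} [Ring R] (S : R) (j : ℕ) :
    (S - 1) ^ j = ∑ k ∈ Finset.range (j + 1), diffCoeff j k • S ^ k := by
  rw [sub_eq_add_neg, (Commute.one_right S).neg_right.add_pow]
  refine Finset.sum_congr rfl fun k _ => ?_
  rw [diffCoeff, zsmul_eq_mul]
  push_cast
  rw [mul_assoc]
  exact ((((Commute.one_left S).neg_left.pow_left _).mul_left
    (Nat.cast_commute _ S)).pow_right k).eq.symm

variable {W E : Type*} [NormedAddCommGroup W] [NormedSpace ℚ_[p] W] [NormedAddCommGroup E]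
  [NormedSpace ℚ_[p] E]

/-- Along the arithmetic progression, `k ↦ q(y + k e, …)` is a polynomial in `k` of degree at most
`m`, and the `j`-th difference kills degrees below `j`. -/
lemma sum_diffCoeff_smul_multilinear {j m : ℕ} (h : m < j)
    (q : ContinuousMultilinearMap ℚ_[p] (fun _ : Fin m => W) E) (y e : W) :
    ∑ k ∈ Finset.range (j + 1), diffCoeff j k • q (fun _ => y + (k : ℚ_[p]) • e) = 0 := by
  classical
  have h1 : ∀ k : ℕ, q (fun _ => y + (k : ℚ_[p]) • e)
      = ∑ s : Finset (Fin m), (k : ℚ_[p]) ^ s.card • q (s.piecewise (fun _ => e) fun _ => y) := by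
    intro k
    have h2 : (fun _ : Fin m => y + (k : ℚ_[p]) • e)
        = (fun _ => (k : ℚ_[p]) • e) + fun _ => y := by
      ext i; simp [add_comm]
    rw [h2, ContinuousMultilinearMap.map_add_univ]
    refine Finset.sum_congr rfl fun s _ => ?_
    have h3 := q.toMultilinearMap.map_piecewise_smul (fun _ => (k : ℚ_[p]))
      (s.piecewise (fun _ => e) fun _ => y) s
    rw [Finset.prod_const] at h3
    refine Eq.trans ?_ h3
    change q _ = q _
    congr 1
    ext i
    by_cases hi : i ∈ s <;> simp [hi]
  simp only [h1, Finset.smul_sum]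
  rw [Finset.sum_comm]
  refine Finset.sum_eq_zero fun s _ => ?_
  have h2 : s.card < j := lt_of_le_of_lt (by simpa using s.card_le_univ) h
  have h3 := sum_diffCoeff_smul_pow (p := p) h2
  simp only [← Int.cast_smul_eq_zsmul ℚ_[p], smul_smul]
  rw [← Finset.sum_smul, h3, zero_smul]

lemma norm_sum_diffCoeff_le [IsUltrametricDist E] (j : ℕ) {f : ℕ → E} {C : ℝ} (hC : 0 ≤ C)
    (hf : ∀ k, ‖f k‖ ≤ C) : ‖∑ k ∈ Finset.range (j + 1), diffCoeff j k • f k‖ ≤ C :=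
  IsUltrametricDist.norm_sum_le_of_forall_le_of_nonneg hC fun k _ =>
    (IsUltrametricDist.norm_zsmul_le _ _).trans (hf k)

/-- The finite differences of an analytic function decay geometrically, uniformly near a point. -/
lemma exists_norm_diff_le [IsUltrametricDist E] {F : W → E} {w₀ : W} (hF : AnalyticAt ℚ_[p] F w₀) :
    ∃ δ > 0, ∃ θ ∈ Set.Ioo (0 : ℝ) 1, ∃ C > 0, ∀ y e : W,
      (∀ k : ℕ, ‖y + (k : ℚ_[p]) • e‖ < δ) → ∀ j : ℕ,
      ‖∑ k ∈ Finset.range (j + 1), diffCoeff j k • F (w₀ + (y + (k : ℚ_[p]) • e))‖ ≤ C * θ ^ j := by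
  obtain ⟨q, r, hr⟩ := hF
  obtain ⟨δ, hδ0, hδr⟩ := ENNReal.lt_iff_exists_nnreal_btwn.1 hr.r_pos
  obtain ⟨θ, hθ, C, hC, h⟩ := hr.uniform_geometric_approx hδr
  refine ⟨δ, by exact_mod_cast hδ0, θ, hθ, C, hC, fun y e hye j => ?_⟩
  -- The partial sum has degree less than `j`, so it may be subtracted from `F` freely. What remains
  -- is the Taylor remainder, of size `C θ^j`, and integral coefficients do not increase ultrametric
  -- norms.
  have h0 : ∑ k ∈ Finset.range (j + 1), diffCoeff j k • q.partialSum j (y + (k : ℚ_[p]) • e) = 0 := by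
    simp only [FormalMultilinearSeries.partialSum, Finset.smul_sum]
    rw [Finset.sum_comm]
    exact Finset.sum_eq_zero fun m hm =>
      sum_diffCoeff_smul_multilinear (Finset.mem_range.1 hm) (q m) y e
  rw [← sub_zero (∑ k ∈ Finset.range (j + 1), diffCoeff j k • F _), ← h0, ← Finset.sum_sub_distrib]
  simp only [← smul_sub]
  exact norm_sum_diffCoeff_le j (mul_nonneg hC.le (pow_nonneg hθ.1.le j)) fun k =>
    h _ (by simpa using hye k) j

end Differences

/-! ### Decay of `b^α v` for a locally analytic vector `v` -/

section Decay

variable {p : ℕ} [Fact p.Prime] {n : ℕ}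

section IntOps

variable {L : Type u} [NormedField L] {E : Type v} [AddCommGroup E] [Module L E]

/-- The ring of operators generated by `H`. -/
def intOps (ρ : Representation L (GL (Fin n) ℚ_[p]) E) : Subring (Module.End L E) :=
  Subring.closure (((H p n).toSubmonoid.map ρ : Submonoid (Module.End L E)) : Set (Module.End L E))

variable {ρ : Representation L (GL (Fin n) ℚ_[p]) E}

lemma rho_mem_intOps {g : GL (Fin n) ℚ_[p]} (hg : g ∈ H p n) : ρ g ∈ intOps ρ :=
  Subring.subset_closure ⟨g, hg, rfl⟩

/-- The image of `H` is closed under multiplication, so the ring it generates is already its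
additive span. -/
lemma intOps_induction {P : Module.End L E → Prop} (hρ : ∀ g ∈ H p n, P (ρ g)) (h0 : P 0)
    (hadd : ∀ A B, P A → P B → P (A + B)) (hneg : ∀ A, P A → P (-A)) {A : Module.End L E}
    (hA : A ∈ intOps ρ) : P A := by
  rw [intOps, Subring.mem_closure_iff, Submonoid.closure_eq] at hA
  refine AddSubgroup.closure_induction (p := fun A _ => P A) ?_ h0 (fun A B _ _ => hadd A B)
    (fun A _ => hneg A) hA
  rintro _ ⟨g, hg, rfl⟩
  exact hρ g hg

lemma generator_sub_one_mem_intOps (ij : Fin n × Fin n) :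
    ρ (generator p ij) - 1 ∈ intOps ρ :=
  sub_mem (rho_mem_intOps (generator_mem_H ij)) (one_mem _)

lemma bOp_mem_intOps (α : Fin n × Fin n → ℕ) : bOp ρ α ∈ intOps ρ :=
  list_prod_mem fun A hA => by
    obtain ⟨ij, -, rfl⟩ := List.mem_map.1 hA
    exact pow_mem (generator_sub_one_mem_intOps ij) _

lemma bOp_eq_mul (α : Fin n × Fin n → ℕ) (ij : Fin n × Fin n) :
    ∃ A ∈ intOps ρ, ∃ B ∈ intOps ρ, bOp ρ α = A * (ρ (generator p ij) - 1) ^ α ij * B := by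
  have hij : ij ∈ List.finRange n ×ˢ List.finRange n := by
    simp [List.product, SProd.sprod]
  obtain ⟨s, t, hst⟩ := List.append_of_mem hij
  have hl : ∀ l : List (Fin n × Fin n),
      (l.map fun ij => (ρ (generator p ij) - 1) ^ α ij).prod ∈ intOps ρ := fun l =>
    list_prod_mem fun A hA => by
      obtain ⟨ij, -, rfl⟩ := List.mem_map.1 hA
      exact pow_mem (generator_sub_one_mem_intOps ij) _
  refine ⟨_, hl s, _, hl t, ?_⟩
  rw [bOp, hst, List.map_append, List.prod_append, List.map_cons, List.prod_cons, mul_assoc]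

end IntOps

section Bounds

variable {L : Type u} [NontriviallyNormedField L]
variable {E : Type v} [NormedAddCommGroup E] [NormedSpace L E] [IsUltrametricDist E]
  [CompleteSpace E] {ρ : Representation L (GL (Fin n) ℚ_[p]) E}

/-- Orbits of the compact group `H` are bounded, so Banach–Steinhaus bounds `H` uniformly, and the
ultrametric inequality extends the bound to integral combinations. This plays the role of an
`H`-invariant norm. -/
lemma IsContinuousRep.exists_bound (hρ : IsContinuousRep ρ) :
    ∃ R ≥ 1, ∀ A ∈ intOps ρ, ∀ e, ‖A e‖ ≤ R * ‖e‖ := by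
  let T : H p n → E →L[L] E := fun g => ⟨ρ g, hρ.continuous_apply g⟩
  obtain ⟨R, hR⟩ := banach_steinhaus (g := T) fun e => by
    have hc : Continuous fun g : GL (Fin n) ℚ_[p] => ρ g e := hρ.comp (Continuous.prodMk_left e)
    obtain ⟨C, hC⟩ := isCompact_H.exists_bound_of_continuousOn hc.continuousOn
    exact ⟨C, fun g => hC g g.2⟩
  refine ⟨max R 1, le_max_right _ _, fun A hA => ?_⟩
  refine intOps_induction (P := fun A => ∀ e, ‖A e‖ ≤ max R 1 * ‖e‖) ?_ ?_ ?_ ?_ hA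
  · intro g hg e
    refine ((T ⟨g, hg⟩).le_opNorm e).trans ?_
    exact mul_le_mul_of_nonneg_right ((hR _).trans (le_max_left _ _)) (norm_nonneg _)
  · intro e
    simp only [LinearMap.zero_apply, norm_zero]
    positivity
  · intro A B hA hB e
    exact (IsUltrametricDist.norm_add_le_max _ _).trans (max_le (hA e) (hB e))
  · intro A hA e
    simpa using hA e

end Bounds

section LocallyAnalytic

variable {L : Type u} [NontriviallyNormedField L] [NormedAlgebra ℚ_[p] L]
variable {E : Type v} [NormedAddCommGroup E] [NormedSpace L E] [IsUltrametricDist E]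
  {ρ : Representation L (GL (Fin n) ℚ_[p]) E}

/-- The entries of an element of `GL_n(ℚ_p)`. -/
def entries (g : GL (Fin n) ℚ_[p]) : Fin n → Fin n → ℚ_[p] := fun i j => g i j

lemma isEmbedding_entries : IsEmbedding (entries : GL (Fin n) ℚ_[p] → Fin n → Fin n → ℚ_[p]) :=
  isEmbedding_GL_val

/-- Left multiplication by a matrix. -/
def leftMul (A : Matrix (Fin n) (Fin n) ℚ_[p]) :
    (Fin n → Fin n → ℚ_[p]) →L[ℚ_[p]] (Fin n → Fin n → ℚ_[p]) :=
  LinearMap.toContinuousLinearMap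
    { toFun := fun X => A * Matrix.of X
      map_add' := fun X Y => by
        change _ = (_ + _ : Matrix (Fin n) (Fin n) ℚ_[p])
        rw [← mul_add]; rfl
      map_smul' := fun c X => by
        change _ = c • (_ : Matrix (Fin n) (Fin n) ℚ_[p])
        rw [← mul_smul_comm]; rfl }

lemma leftMul_entries (g g' : GL (Fin n) ℚ_[p]) :
    leftMul (g : Matrix (Fin n) (Fin n) ℚ_[p]) (entries g') = entries (g * g') := rfl

/-- Left multiplication by the elementary matrix `E_ij`. -/
def rowOp (ij : Fin n × Fin n) : (Fin n → Fin n → ℚ_[p]) →L[ℚ_[p]] (Fin n → Fin n → ℚ_[p]) :=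
  leftMul (Matrix.single ij.1 ij.2 1)

lemma entries_generator_pow_mul {ij : Fin n × Fin n} {s : ℕ} {c : ℚ_[p]}
    (h : ((generator p ij ^ s : GL (Fin n) ℚ_[p]) : Matrix (Fin n) (Fin n) ℚ_[p])
      = 1 + c • Matrix.single ij.1 ij.2 (1 : ℚ_[p])) (g : GL (Fin n) ℚ_[p]) :
    entries (generator p ij ^ s * g) = entries g + c • rowOp ij (entries g) := by
  have h1 : ((generator p ij ^ s * g : GL (Fin n) ℚ_[p]) : Matrix (Fin n) (Fin n) ℚ_[p])
      = g + c • (Matrix.single ij.1 ij.2 (1 : ℚ_[p]) * (g : Matrix (Fin n) (Fin n) ℚ_[p])) := by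
    rw [Units.val_mul, h, add_mul, one_mul, smul_mul_assoc]
  exact h1

/-- With `S` the `p^N`-th power of the generator, `(S - 1)^j (g v)` is the `j`-th difference of `k ↦
S^k g v`, an analytic function of the pair formed by `p^N k` and the entries of `g`. Treating both
variables together makes the decay uniform for `g` near `g₀`. -/
lemma exists_local_decay {v : E} (hv : v ∈ analyticSubmodule ρ) (ij : Fin n × Fin n)
    (g₀ : GL (Fin n) ℚ_[p]) : ∃ N : ℕ, ∃ θ ∈ Set.Ioo (0 : ℝ) 1, ∃ C > 0, ∀ᶠ g in 𝓝 g₀, ∀ j,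
      ‖((ρ (generator p ij ^ p ^ N) - 1) ^ j) (ρ g v)‖ ≤ C * θ ^ j := by
  let _ : NormedSpace ℚ_[p] E := NormedSpace.restrictScalars ℚ_[p] L E
  obtain ⟨F, hF, hFv⟩ := hv g₀
  obtain ⟨N₀, c, hc, hc0, -, hcs⟩ := exists_generator_pow (p := p) ij
  let Φ : ℚ_[p] × (Fin n → Fin n → ℚ_[p]) → Fin n → Fin n → ℚ_[p] :=
    fun z => z.2 + c z.1 • rowOp ij z.2
  let z₀ : ℚ_[p] × (Fin n → Fin n → ℚ_[p]) := (0, entries g₀)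
  have hz₀ : Φ z₀ = entries g₀ := by
    change entries g₀ + c 0 • _ = _
    rw [hc0, zero_smul, add_zero]
  have hc' : AnalyticAt ℚ_[p] c z₀.1 := hc
  have hΦ : AnalyticAt ℚ_[p] Φ z₀ := by
    have h1 : AnalyticAt ℚ_[p] (fun z : ℚ_[p] × (Fin n → Fin n → ℚ_[p]) => c z.1) z₀ :=
      AnalyticAt.comp (g := c) hc' analyticAt_fst
    have h2 : AnalyticAt ℚ_[p] (fun z : ℚ_[p] × (Fin n → Fin n → ℚ_[p]) => rowOp ij z.2) z₀ :=
      ((rowOp ij).comp (ContinuousLinearMap.snd ℚ_[p] ℚ_[p] (Fin n → Fin n → ℚ_[p]))).analyticAt z₀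
    exact analyticAt_snd.add (h1.smul h2)
  have hF' : AnalyticAt ℚ_[p] F (Φ z₀) := by rw [hz₀]; exact hF
  obtain ⟨δ, hδ, θ, hθ, C, hC, hdiff⟩ := exists_norm_diff_le (hF'.comp hΦ)
  rw [isEmbedding_entries.nhds_eq_comap, eventually_comap, ← hz₀] at hFv
  have hev := hΦ.continuousAt.eventually hFv
  obtain ⟨δ', hδ', hball⟩ := Metric.eventually_nhds_iff.1 hev
  obtain ⟨N₁, hN₁⟩ : ∃ N₁ : ℕ, ((p : ℝ)⁻¹) ^ N₁ < min δ δ' :=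
    exists_pow_lt_of_lt_one (lt_min hδ hδ') (inv_lt_one_of_one_lt₀ one_lt_prime_cast)
  refine ⟨N₀ + N₁, θ, hθ, C, hC, ?_⟩
  have hnear : ∀ᶠ g in 𝓝 g₀, ‖entries g - entries g₀‖ < min δ δ' := by
    have := (isEmbedding_entries.continuous.tendsto g₀).eventually
      (Metric.ball_mem_nhds _ (lt_min hδ hδ'))
    filter_upwards [this] with g hg
    rwa [← dist_eq_norm]
  filter_upwards [hnear] with g hg j
  let y : ℚ_[p] × (Fin n → Fin n → ℚ_[p]) := (0, entries g - entries g₀)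
  -- In the step `p^(N₀+N₁)`, `N₀` makes the formula for powers of the generator valid and `N₁`
  -- keeps all points `y + k e` inside the disc of analyticity.
  let e : ℚ_[p] × (Fin n → Fin n → ℚ_[p]) := ((p : ℚ_[p]) ^ (N₀ + N₁), 0)
  have hye : ∀ k : ℕ, y + (k : ℚ_[p]) • e
      = (((p ^ (N₀ + N₁) * k : ℕ) : ℚ_[p]), entries g - entries g₀) := by
    intro k
    ext1
    · simp [y, e, mul_comm]
    · simp [y, e]
  have hnorm : ∀ k : ℕ, ‖y + (k : ℚ_[p]) • e‖ < min δ δ' := by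
    intro k
    rw [hye, Prod.norm_def, max_lt_iff]
    refine ⟨lt_of_le_of_lt ?_ hN₁, hg⟩
    push_cast
    rw [norm_mul, norm_pow, Padic.norm_p, pow_add, mul_assoc]
    have h1 : ‖(k : ℚ_[p])‖ ≤ 1 := by simpa using Padic.norm_int_le_one (p := p) k
    have h2 : (p : ℝ)⁻¹ ^ N₀ ≤ 1 :=
      pow_le_one₀ (by positivity) (inv_lt_one_of_one_lt₀ one_lt_prime_cast).le
    refine (mul_le_of_le_one_left (by positivity) h2).trans
      (mul_le_of_le_one_right (by positivity) h1)
  have hval : ∀ k : ℕ, (F ∘ Φ) (z₀ + (y + (k : ℚ_[p]) • e))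
      = ρ ((generator p ij ^ p ^ (N₀ + N₁)) ^ k) (ρ g v) := by
    intro k
    have h1 : z₀ + (y + (k : ℚ_[p]) • e) = (((p ^ (N₀ + N₁) * k : ℕ) : ℚ_[p]), entries g) := by
      rw [hye]
      ext1
      · simp [z₀]
      · simp [z₀]
    have h2 : entries ((generator p ij ^ p ^ (N₀ + N₁)) ^ k * g)
        = Φ (z₀ + (y + (k : ℚ_[p]) • e)) := by
      rw [h1, ← pow_mul]
      exact entries_generator_pow_mul (hcs _ ((pow_dvd_pow p (Nat.le_add_right _ _)).mul_right k)) g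
    have h3 := hball (y := z₀ + (y + (k : ℚ_[p]) • e)) (by
      rw [dist_eq_norm, add_sub_cancel_left]
      exact (hnorm k).trans_le (min_le_right _ _)) _ h2
    rw [Function.comp_apply, ← h2]
    change _ = (ρ ((generator p ij ^ p ^ (N₀ + N₁)) ^ k) * ρ g) v
    rw [← map_mul]
    exact h3.symm
  have h4 := hdiff y e (fun k => (hnorm k).trans_le (min_le_left _ _)) j
  simp only [hval] at h4
  convert h4 using 2
  rw [sub_one_pow_eq_sum, LinearMap.sum_apply]
  refine Finset.sum_congr rfl fun k _ => ?_
  simp only [map_pow]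
  rfl

end LocallyAnalytic

end Decay

/-! ### From one generator near one point to all `b^α` along `H`. -/

section Decay

variable {p : ℕ} [Fact p.Prime] {n : ℕ}

lemma exists_pow_eq_of_mem_Ioo {θ : ℝ} (hθ : θ ∈ Set.Ioo (0 : ℝ) 1) {q : ℕ} (hq : q ≠ 0) :
    ∃ θ' ∈ Set.Ioo (0 : ℝ) 1, θ' ^ q = θ := by
  have hq' : (0 : ℝ) < (q : ℝ)⁻¹ := by positivity
  exact ⟨θ ^ ((q : ℝ)⁻¹), ⟨Real.rpow_pos_of_pos hθ.1 _, Real.rpow_lt_one hθ.1.le hθ.2 hq'⟩,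
    Real.rpow_inv_natCast_pow hθ.1.le hq⟩

lemma norm_natCast_prime (L : Type*) [NormedField L] [NormedAlgebra ℚ_[p] L] :
    ‖(p : L)‖ = (p : ℝ)⁻¹ := by
  rw [← map_natCast (algebraMap ℚ_[p] L), norm_algebraMap', Padic.norm_p]

/-- `X ^ q` is the sum of `(1 + X) ^ q - 1` and a multiple of `p`, when `q` is a power of `p`. -/
lemma exists_X_pow_eq (N : ℕ) : ∃ r : Polynomial ℤ,
    (Polynomial.X : Polynomial ℤ) ^ p ^ N
      = (p : Polynomial ℤ) * r + ((Polynomial.X + 1) ^ p ^ N - 1) := by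
  obtain ⟨r, hr⟩ := exists_add_pow_prime_pow_eq (Fact.out : p.Prime)
    (Polynomial.X : Polynomial ℤ) 1 N
  refine ⟨-(Polynomial.X * 1 * r), ?_⟩
  rw [hr]; ring

section Norms

variable {L : Type u} [NontriviallyNormedField L] [NormedAlgebra ℚ_[p] L]
variable {E : Type v} [NormedAddCommGroup E] [NormedSpace L E] [IsUltrametricDist E]

/-- Decay of the powers of `S ^ q - 1` at a vector implies decay of those of `S - 1`. -/
lemma exists_pow_decay {R : ℝ} (hR : 1 ≤ R) {A : Subring (Module.End L E)}
    (hA : ∀ T ∈ A, ∀ e, ‖T e‖ ≤ R * ‖e‖) {S : Module.End L E} (hS : S ∈ A) (N : ℕ)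
    {θ : ℝ} (hθ : θ ∈ Set.Ioo (0 : ℝ) 1) {C : ℝ} (hC : 0 < C) :
    ∃ θ' ∈ Set.Ioo (0 : ℝ) 1, ∃ C' > 0, ∀ e : E,
      (∀ j, ‖((S ^ p ^ N - 1) ^ j) e‖ ≤ C * θ ^ j) → ∀ k, ‖((S - 1) ^ k) e‖ ≤ C' * θ' ^ k := by
  have hp1 : (1 : ℝ) < p := one_lt_prime_cast
  have hpinv : (p : ℝ)⁻¹ ∈ Set.Ioo (0 : ℝ) 1 := ⟨by positivity, inv_lt_one_of_one_lt₀ hp1⟩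
  set μ := max (p : ℝ)⁻¹ θ with hμ
  have hμ' : μ ∈ Set.Ioo (0 : ℝ) 1 := ⟨lt_max_of_lt_left hpinv.1, max_lt hpinv.2 hθ.2⟩
  have hq : p ^ N ≠ 0 := pow_ne_zero _ (Fact.out : p.Prime).ne_zero
  obtain ⟨θ', hθ', hθq⟩ := exists_pow_eq_of_mem_Ioo hμ' hq
  have hD : S - 1 ∈ A := sub_mem hS (one_mem _)
  have hR0 : 0 < R := one_pos.trans_le hR
  -- With `θ'^(p^N) = μ`, the division by `μ` absorbs the remainder of `k` modulo `p^N`.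
  refine ⟨θ', hθ', R * (R * C) / μ, div_pos (by positivity) hμ'.1, fun e he k => ?_⟩
  -- Put `q = p^N` and `X^q = p r + ((1 + X)^q - 1)`. In the `m`-th power, term `i` gains `p^(-i)`
  -- from `p^i` and `θ^(m-i)` from the hypothesis, while `r^i` costs only the uniform bound `R`.
  have hkey : ∀ m, ‖((S - 1) ^ (p ^ N * m)) e‖ ≤ R * C * μ ^ m := by
    intro m
    obtain ⟨r, hr⟩ := exists_X_pow_eq (p := p) N
    have h1 : ((Polynomial.X : Polynomial ℤ) ^ (p ^ N * m))
        = ∑ i ∈ Finset.range (m + 1), (((p ^ i * m.choose i : ℕ) : Polynomial ℤ))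
          * (r ^ i * ((Polynomial.X + 1) ^ p ^ N - 1) ^ (m - i)) := by
      rw [pow_mul, hr, add_pow]
      refine Finset.sum_congr rfl fun i _ => ?_
      push_cast
      ring
    have h2 := congrArg (Polynomial.aeval (⟨S - 1, hD⟩ : A)) h1
    have h3 := congrArg (fun T : A => (T : Module.End L E) e) h2
    simp only [map_pow, map_sum, map_mul, Polynomial.aeval_X, map_sub, map_add, map_one,
      map_natCast] at h3
    have h4 : ((S - 1) ^ (p ^ N * m)) e = ∑ i ∈ Finset.range (m + 1), (p ^ i * m.choose i : ℕ) •
        ((Polynomial.aeval (⟨S - 1, hD⟩ : A) r : A) ^ i : Module.End L E)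
          (((S ^ p ^ N - 1) ^ (m - i)) e) := by
      refine Eq.trans ?_ (h3.trans ?_)
      · rfl
      · push_cast
        rw [Finset.sum_apply]
        refine Finset.sum_congr rfl fun i _ => ?_
        rw [sub_add_cancel, ← Nat.cast_pow, ← Nat.cast_mul, ← nsmul_eq_mul]
        rfl
    rw [h4]
    refine IsUltrametricDist.norm_sum_le_of_forall_le_of_nonneg (by have := hμ'.1; positivity)
      fun i hi => ?_
    have hi' : i ≤ m := Nat.lt_succ_iff.1 (Finset.mem_range.1 hi)
    have h5 := (hA _ (pow_mem (Polynomial.aeval (⟨S - 1, hD⟩ : A) r).2 i)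
      (((S ^ p ^ N - 1) ^ (m - i)) e)).trans (mul_le_mul_of_nonneg_left (he (m - i)) hR0.le)
    rw [mul_nsmul', ← Nat.cast_smul_eq_nsmul L, Nat.cast_pow, norm_smul, norm_pow,
      norm_natCast_prime]
    have h6 := (IsUltrametricDist.norm_nsmul_le (((Polynomial.aeval (⟨S - 1, hD⟩ : A) r : A) ^ i :
      Module.End L E) (((S ^ p ^ N - 1) ^ (m - i)) e)) (m.choose i)).trans h5
    calc (p : ℝ)⁻¹ ^ i * _ ≤ μ ^ i * (R * (C * μ ^ (m - i))) := by
          refine mul_le_mul (pow_le_pow_left₀ hpinv.1.le (le_max_left _ _) _) (h6.trans ?_)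
            (norm_nonneg _) (pow_nonneg hμ'.1.le _)
          gcongr
          · exact hθ.1.le
          · exact le_max_right _ _
      _ = R * C * μ ^ m := by
          conv_rhs => rw [← Nat.add_sub_cancel' hi', pow_add]
          ring
  rw [← Nat.mod_add_div k (p ^ N), pow_add (S - 1)]
  refine (hA _ (pow_mem hD _) _).trans
    ((mul_le_mul_of_nonneg_left (hkey (k / p ^ N)) hR0.le).trans ?_)
  rw [pow_add, pow_mul, hθq, div_mul_eq_mul_div, le_div_iff₀ hμ'.1]
  have h7 : μ ≤ θ' ^ (k % p ^ N) := by
    rw [← hθq]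
    exact pow_le_pow_of_le_one hθ'.1.le hθ'.2.le (Nat.mod_lt _ (Nat.pos_of_ne_zero hq)).le
  calc R * (R * C * μ ^ (k / p ^ N)) * μ = R * (R * C) * (μ * μ ^ (k / p ^ N)) := by ring
    _ ≤ _ := by
      have := hμ'.1
      gcongr

variable [CompleteSpace E] {ρ : Representation L (GL (Fin n) ℚ_[p]) E}

/-- Finitely many of the local estimates cover the compact group `H`. Operators in `intOps` are
integral combinations of elements of `H`, so the ultrametric inequality keeps the constants. -/
lemma exists_generator_decay (hρ : IsContinuousRep ρ) {v : E} (hv : v ∈ analyticSubmodule ρ)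
    (ij : Fin n × Fin n) : ∃ θ ∈ Set.Ioo (0 : ℝ) 1, ∃ C > 0, ∀ A ∈ intOps ρ, ∀ k,
      ‖((ρ (generator p ij) - 1) ^ k) (A v)‖ ≤ C * θ ^ k := by
  obtain ⟨R, hR, hb⟩ := hρ.exists_bound
  have hH : ∃ θ ∈ Set.Ioo (0 : ℝ) 1, ∃ C > 0, ∀ g ∈ (H p n : Set (GL (Fin n) ℚ_[p])), ∀ k,
      ‖((ρ (generator p ij) - 1) ^ k) (ρ g v)‖ ≤ C * θ ^ k := by
    refine isCompact_H.induction_on (p := fun s => ∃ θ ∈ Set.Ioo (0 : ℝ) 1, ∃ C > 0, ∀ g ∈ s, ∀ k,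
      ‖((ρ (generator p ij) - 1) ^ k) (ρ g v)‖ ≤ C * θ ^ k) ?_ ?_ ?_ ?_
    · exact ⟨2⁻¹, by norm_num, 1, one_pos, fun g hg => hg.elim⟩
    · rintro s t hst ⟨θ, hθ, C, hC, h⟩
      exact ⟨θ, hθ, C, hC, fun g hg => h g (hst hg)⟩
    · rintro s t ⟨θ, hθ, C, hC, h⟩ ⟨θ', hθ', C', hC', h'⟩
      refine ⟨max θ θ', ⟨lt_max_of_lt_left hθ.1, max_lt hθ.2 hθ'.2⟩, max C C',
        lt_max_of_lt_left hC, ?_⟩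
      rintro g (hg | hg) k
      · exact (h g hg k).trans (mul_le_mul (le_max_left _ _)
          (pow_le_pow_left₀ hθ.1.le (le_max_left _ _) _) (pow_nonneg hθ.1.le _)
          (hC.le.trans (le_max_left _ _)))
      · exact (h' g hg k).trans (mul_le_mul (le_max_right _ _)
          (pow_le_pow_left₀ hθ'.1.le (le_max_right _ _) _) (pow_nonneg hθ'.1.le _)
          (hC.le.trans (le_max_left _ _)))
    · intro g₀ _
      obtain ⟨N, θ, hθ, C, hC, h⟩ := exists_local_decay hv ij g₀
      obtain ⟨θ', hθ', C', hC', h'⟩ := exists_pow_decay (p := p) hR hb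
        (rho_mem_intOps (generator_mem_H ij)) N hθ hC
      refine ⟨_, mem_nhdsWithin_of_mem_nhds h, θ', hθ', C', hC', fun g hg => h' _ ?_⟩
      have hg' : ∀ j, ‖((ρ (generator p ij ^ p ^ N) - 1) ^ j) (ρ g v)‖ ≤ C * θ ^ j := hg
      rwa [map_pow] at hg'
  obtain ⟨θ, hθ, C, hC, h⟩ := hH
  refine ⟨θ, hθ, C, hC, fun A hA k => ?_⟩
  have hnn : 0 ≤ C * θ ^ k := mul_nonneg hC.le (pow_nonneg hθ.1.le _)
  refine intOps_induction (P := fun A => ‖((ρ (generator p ij) - 1) ^ k) (A v)‖ ≤ C * θ ^ k)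
    (fun g hg => h g hg k) ?_ ?_ ?_ hA
  · simpa using hnn
  · intro A B hA hB
    rw [LinearMap.add_apply, map_add]
    exact (IsUltrametricDist.norm_add_le_max _ _).trans (max_le hA hB)
  · intro A hA
    rw [LinearMap.neg_apply, map_neg, norm_neg]
    exact hA

/-- `b^α` contains the power of a single `h_ij - 1` with the largest exponent, surrounded by
operators of `intOps`. That exponent is at least a fixed fraction of `|α|`, so the decay for one
generator suffices. -/
lemma exists_bOp_decay (hρ : IsContinuousRep ρ) {v : E} (hv : v ∈ analyticSubmodule ρ) :
    ∃ θ ∈ Set.Ioo (0 : ℝ) 1, ∃ C > 0, ∀ g ∈ H p n, ∀ α,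
      ‖bOp ρ α (ρ g v)‖ ≤ C * θ ^ degree α := by
  obtain ⟨R, hR, hb⟩ := hρ.exists_bound
  have hR0 : 0 < R := one_pos.trans_le hR
  choose θ hθ C hC h using exists_generator_decay hρ hv
  obtain ⟨μ, hμ, hμ0⟩ : ∃ μ : ℝ, (∀ ij, θ ij < μ) ∧ μ ∈ Set.Ioo (0 : ℝ) 1 :=
    ((eventually_all.2 fun ij => eventually_nhdsWithin_of_eventually_nhds
      (lt_mem_nhds (hθ ij).2)).and (Ioo_mem_nhdsLT (zero_lt_one (α := ℝ)))).exists
  -- The root is taken because `|α|` is at most the number of indices times `max α_ij`; the `+ 1`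
  -- keeps the exponent nonzero when `n = 0`.
  obtain ⟨θ', hθ', hθq⟩ := exists_pow_eq_of_mem_Ioo hμ0
    (q := Fintype.card (Fin n × Fin n) + 1) (Nat.succ_ne_zero _)
  have hsum : ∀ ij, C ij ≤ ∑ ij, C ij := fun ij =>
    Finset.single_le_sum (f := C) (fun i _ => (hC i).le) (Finset.mem_univ ij)
  have hsum0 : 0 ≤ ∑ ij, C ij := Finset.sum_nonneg fun i _ => (hC i).le
  refine ⟨θ', hθ', R * (∑ ij, C ij) + R * (R * ‖v‖) + 1, by positivity, fun g hg α => ?_⟩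
  rcases isEmpty_or_nonempty (Fin n × Fin n) with hemp | hne
  · have hd : degree α = 0 := by simp [degree]
    rw [hd, pow_zero, mul_one]
    refine (hb _ (bOp_mem_intOps α) _).trans
      ((mul_le_mul_of_nonneg_left (hb _ (rho_mem_intOps hg) v) hR0.le).trans ?_)
    have : 0 ≤ R * (∑ ij, C ij) := by positivity
    linarith
  · obtain ⟨ij, -, hij⟩ := Finset.exists_max_image Finset.univ α Finset.univ_nonempty
    have hdeg : degree α ≤ (Fintype.card (Fin n × Fin n) + 1) * α ij := by
      refine (Finset.sum_le_card_nsmul _ _ (α ij) fun i hi => hij i hi).trans ?_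
      rw [Finset.card_univ, smul_eq_mul]
      exact Nat.mul_le_mul_right _ (Nat.le_succ _)
    obtain ⟨A, hA, B, hB, hAB⟩ := bOp_eq_mul (ρ := ρ) α ij
    have h1 : bOp ρ α (ρ g v) = A (((ρ (generator p ij) - 1) ^ α ij) ((B * ρ g) v)) := by
      rw [hAB]; rfl
    rw [h1]
    refine (hb A hA _).trans ((mul_le_mul_of_nonneg_left
      (h ij _ (mul_mem hB (rho_mem_intOps hg)) _) hR0.le).trans ?_)
    have h2 : θ ij ^ α ij ≤ θ' ^ degree α := by
      refine (pow_le_pow_left₀ (hθ ij).1.le (hμ ij).le _).trans ?_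
      rw [← hθq, ← pow_mul]
      exact pow_le_pow_of_le_one hθ'.1.le hθ'.2.le hdeg
    rw [← mul_assoc]
    refine mul_le_mul ?_ h2 (pow_nonneg (hθ ij).1.le _) (by positivity)
    have h3 := mul_le_mul_of_nonneg_left (hsum ij) hR0.le
    have : 0 ≤ R * (R * ‖v‖) := by positivity
    linarith

lemma tendsto_degree : Tendsto (degree (n := n)) cofinite atTop := by
  refine tendsto_atTop.2 fun k => ?_
  rw [eventually_cofinite]
  refine (Set.finite_Iic (fun _ : Fin n × Fin n => k)).subset fun α hα ij => ?_
  exact (Finset.single_le_sum (f := α) (fun _ _ => Nat.zero_le _) (Finset.mem_univ ij)).trans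
    (not_le.1 hα).le

lemma tendsto_radius : Tendsto (radius p) atTop (𝓝 0) := by
  have h1 : Tendsto (fun h : ℕ => (p : ℝ) ^ (h - 1)) atTop atTop :=
    (tendsto_pow_atTop_atTop_of_one_lt one_lt_prime_cast).comp (tendsto_sub_atTop_nat 1)
  have h2 := h1.atTop_mul_const (sub_pos.2 (one_lt_prime_cast (p := p)))
  exact (h2.inv_tendsto_atTop).congr fun h => (one_div _).symm

/-- For `h` large enough, the orbit under `H` of a locally analytic vector is contained in `Π^(h)`
and the orbit map is continuous at `1` for the norm of `Π^(h)`. -/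
lemma eventually_mem_PiH (hρ : IsContinuousRep ρ) {v : E} (hv : v ∈ analyticSubmodule ρ) :
    ∀ᶠ h in atTop, (∀ g ∈ H p n, ρ g v ∈ PiH ρ h) ∧
      ∀ ε > 0, ∀ᶠ g in 𝓝 (1 : GL (Fin n) ℚ_[p]), normH ρ h (ρ g v - v) ≤ ε := by
  obtain ⟨θ, hθ, C, hC, hdec⟩ := exists_bOp_decay hρ hv
  have hp0 : (0 : ℝ) < p := one_pos.trans one_lt_prime_cast
  -- Since `r_h → 0`, the weight `p^(r_h)` is eventually too small to destroy the decay rate `θ <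
  -- 1`.
  have h1 : Tendsto (fun h : ℕ => (p : ℝ) ^ radius p h * θ) atTop (𝓝 θ) := by
    have := (Real.continuous_const_rpow hp0.ne').tendsto 0 |>.comp (tendsto_radius (p := p))
    simpa using this.mul_const θ
  filter_upwards [h1.eventually (gt_mem_nhds hθ.2)] with h hh
  set μ := (p : ℝ) ^ radius p h * θ with hμ
  have hμ0 : 0 < μ := mul_pos (Real.rpow_pos_of_pos hp0 _) hθ.1
  have hterm : ∀ g ∈ H p n, ∀ α,
      (p : ℝ) ^ (radius p h * degree α) * ‖bOp ρ α (ρ g v)‖ ≤ C * μ ^ degree α := by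
    intro g hg α
    rw [hμ, mul_pow, Real.rpow_mul_natCast hp0.le]
    refine (mul_le_mul_of_nonneg_left (hdec g hg α) (by positivity)).trans (le_of_eq (by ring))
  have hlim : Tendsto (fun α : Fin n × Fin n → ℕ => C * μ ^ degree α) cofinite (𝓝 0) := by
    have := ((tendsto_pow_atTop_nhds_zero_of_lt_one hμ0.le hh).comp
      (tendsto_degree (n := n))).const_mul C
    simpa using this
  refine ⟨fun g hg => squeeze_zero (fun α => by positivity) (hterm g hg) hlim, fun ε hε => ?_⟩
  have hfin := hlim.eventually (gt_mem_nhds hε)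
  rw [eventually_cofinite] at hfin
  -- Outside a finite set of `α` the terms are below `ε` uniformly on `H`; on the finite set
  -- continuity of the action on `E` is enough.
  have hcont : ∀ α ∈ {α : Fin n × Fin n → ℕ | ¬ C * μ ^ degree α < ε},
      ∀ᶠ g in 𝓝 (1 : GL (Fin n) ℚ_[p]),
        (p : ℝ) ^ (radius p h * degree α) * ‖bOp ρ α (ρ g v - v)‖ < ε := by
    intro α _
    have hc : Continuous fun g : GL (Fin n) ℚ_[p] => ρ g v := hρ.comp (Continuous.prodMk_left v)
    have hc' := (((hρ.continuous_bOp α).comp (hc.sub (continuous_const (y := v)))).norm.const_mul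
      ((p : ℝ) ^ (radius p h * degree α))).tendsto (1 : GL (Fin n) ℚ_[p])
    refine hc'.eventually (gt_mem_nhds ?_)
    simpa [Function.comp_def] using hε
  filter_upwards [(hfin.eventually_all).2 hcont, isOpen_H.mem_nhds (one_mem (H p n))] with g hg hgH
  refine ciSup_le fun α => ?_
  by_cases hα : C * μ ^ degree α < ε
  · rw [map_sub, sub_eq_add_neg]
    have h2 := hterm 1 (one_mem _) α
    rw [map_one, Module.End.one_apply] at h2
    refine (mul_le_mul_of_nonneg_left (IsUltrametricDist.norm_add_le_max _ _)
      (by positivity)).trans ?_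
    rw [norm_neg, mul_max_of_nonneg _ _ (by positivity)]
    exact max_le ((hterm g hgH α).trans hα.le) (h2.trans hα.le)
  · exact (hg α hα).le

end Norms

end Decay

/-! ### Several-variable Mahler series with geometric decay -/

section Expansion

/-- The binomial formula with exponents recorded as a multiset chosen before the ring. The same
expansion can then be read among endomorphisms of `E` and among operators on bounded families. -/
lemma exists_one_add_pow_expansion (x : ℕ) : ∃ t : Multiset ℕ, ∀ (R : Type v) [Ring R] (u : R),
    (1 + u) ^ x = (t.map fun k => u ^ k).sum := by
  induction x with
  | zero => exact ⟨{0}, fun R _ u => by simp⟩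
  | succ x ih =>
    obtain ⟨t, ht⟩ := ih
    refine ⟨t + t.map Nat.succ, fun R _ u => ?_⟩
    rw [Multiset.map_add, Multiset.sum_add, Multiset.map_map, pow_succ, mul_add, mul_one, ← ht]
    congr 1
    simp only [Function.comp_def, pow_succ]
    rw [Multiset.sum_map_mul_right, ← ht]

/-- Expansion of an ordered product of powers `(1 + u_i) ^ x_i`, uniform in the ring. -/
lemma exists_prod_one_add_pow_expansion {ι : Type*} [DecidableEq ι] (x : ι → ℕ) {l : List ι}
    (hl : l.Nodup) : ∃ s : Multiset (ι → ℕ), ∀ (R : Type v) [Ring R] (u : ι → R),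
      (l.map fun i => (1 + u i) ^ x i).prod
        = (s.map fun α => (l.map fun i => u i ^ α i).prod).sum := by
  induction l with
  | nil => exact ⟨{0}, fun R _ u => by simp⟩
  | cons i l ih =>
    rw [List.nodup_cons] at hl
    obtain ⟨s, hs⟩ := ih hl.2
    obtain ⟨t, ht⟩ := exists_one_add_pow_expansion.{v} (x i)
    refine ⟨t.bind fun k => s.map fun α => Function.update α i k, fun R _ u => ?_⟩
    rw [List.map_cons, List.prod_cons, hs, ht, ← Multiset.sum_map_mul_right, Multiset.map_bind,
      Multiset.sum_bind]
    congr 1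
    refine Multiset.map_congr rfl fun k _ => ?_
    rw [Multiset.map_map, ← Multiset.sum_map_mul_left]
    congr 1
    refine Multiset.map_congr rfl fun α _ => ?_
    rw [Function.comp_apply, List.map_cons, List.prod_cons, Function.update_self]
    congr 2
    refine List.map_congr_left fun j hj => ?_
    rw [Function.update_of_ne]
    rintro rfl
    exact hl.1 hj

end Expansion

/-! ### Weighted shifts and the analyticity of Mahler series. -/

section Shift

open BoundedContinuousFunction

instance {α E : Type*} [TopologicalSpace α] [SeminormedAddCommGroup E] [IsUltrametricDist E] :
    IsUltrametricDist (α →ᵇ E) :=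
  IsUltrametricDist.isUltrametricDist_of_forall_norm_add_le_max_norm fun f g =>
    (BoundedContinuousFunction.norm_le (le_max_of_le_left (norm_nonneg f))).2 fun x =>
      (IsUltrametricDist.norm_add_le_max _ _).trans
        (max_le_max (f.norm_coe_le_norm x) (g.norm_coe_le_norm x))

instance {𝕜 W : Type*} [NontriviallyNormedField 𝕜] [SeminormedAddCommGroup W] [NormedSpace 𝕜 W]
    [IsUltrametricDist W] : IsUltrametricDist (W →L[𝕜] W) :=
  IsUltrametricDist.isUltrametricDist_of_forall_norm_add_le_max_norm fun A B =>
    ContinuousLinearMap.opNorm_le_bound _ (le_max_of_le_left (norm_nonneg A)) fun x => by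
      rw [max_mul_of_nonneg _ _ (norm_nonneg x)]
      exact (IsUltrametricDist.norm_add_le_max _ _).trans
        (max_le_max (A.le_opNorm x) (B.le_opNorm x))

variable {p : ℕ} [Fact p.Prime] {ι : Type} [Fintype ι]
variable {E : Type v} [NormedAddCommGroup E] [NormedSpace ℚ_[p] E]

variable (p) in
/-- The weight `p^⌊|β| / K⌋`. -/
def shiftWeight (K : ℕ) (β : ι → ℕ) : ℚ_[p] := (p : ℚ_[p]) ^ ((∑ i, β i) / K)

lemma shiftWeight_ne_zero (K : ℕ) (β : ι → ℕ) : shiftWeight p K β ≠ 0 :=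
  pow_ne_zero _ (by exact_mod_cast (Fact.out : p.Prime).ne_zero)

lemma norm_shiftWeight (K : ℕ) (β : ι → ℕ) :
    ‖shiftWeight p K β‖ = (p : ℝ)⁻¹ ^ ((∑ i, β i) / K) := by
  rw [shiftWeight, norm_pow, Padic.norm_p]

lemma norm_shiftWeight_add_le (K : ℕ) (β σ : ι → ℕ) :
    ‖shiftWeight p K (β + σ)‖ ≤ ‖shiftWeight p K β‖ := by
  rw [norm_shiftWeight, norm_shiftWeight]
  refine pow_le_pow_of_le_one (by positivity) (inv_lt_one_of_one_lt₀ one_lt_prime_cast).le ?_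
  exact Nat.div_le_div_right (Finset.sum_le_sum fun i _ => Nat.le_add_right _ _)

/-- `A` is the weighted translation by `σ`. -/
def IsWeightedShift (K : ℕ) (σ : ι → ℕ) (A : ((ι → ℕ) →ᵇ E) →L[ℚ_[p]] ((ι → ℕ) →ᵇ E)) : Prop :=
  ∀ c β, A c β = (shiftWeight p K β)⁻¹ • shiftWeight p K (β + σ) • c (β + σ)

lemma exists_isWeightedShift (K : ℕ) (σ : ι → ℕ) :
    ∃ A : ((ι → ℕ) →ᵇ E) →L[ℚ_[p]] ((ι → ℕ) →ᵇ E), IsWeightedShift K σ A ∧ ‖A‖ ≤ 1 := by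
  have hb : ∀ (c : (ι → ℕ) →ᵇ E) β,
      ‖(shiftWeight p K β)⁻¹ • shiftWeight p K (β + σ) • c (β + σ)‖ ≤ ‖c‖ := by
    intro c β
    rw [smul_smul, norm_smul, norm_mul, norm_inv]
    refine (mul_le_of_le_one_left (norm_nonneg _) ?_).trans (c.norm_coe_le_norm _)
    exact (inv_mul_le_iff₀ (norm_pos_iff.2 (shiftWeight_ne_zero K β))).2
      (by rw [mul_one]; exact norm_shiftWeight_add_le K β σ)
  let A₀ : ((ι → ℕ) →ᵇ E) →ₗ[ℚ_[p]] ((ι → ℕ) →ᵇ E) :=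
    { toFun := fun c => BoundedContinuousFunction.ofNormedAddCommGroup
        (fun β => (shiftWeight p K β)⁻¹ • shiftWeight p K (β + σ) • c (β + σ))
        continuous_of_discreteTopology ‖c‖ (hb c)
      map_add' := fun c d => by ext β; simp
      map_smul' := fun a c => by
        ext β
        simp only [BoundedContinuousFunction.coe_ofNormedAddCommGroup, RingHom.id_apply,
          BoundedContinuousFunction.coe_smul]
        rw [smul_comm _ a, smul_comm _ a] }
  have hA₀ : ∀ c, ‖A₀ c‖ ≤ 1 * ‖c‖ := fun c => by
    rw [one_mul]
    exact (BoundedContinuousFunction.norm_le (norm_nonneg c)).2 (hb c)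
  exact ⟨A₀.mkContinuous 1 hA₀, fun c β => rfl, A₀.mkContinuous_norm_le zero_le_one hA₀⟩

lemma IsWeightedShift.one (K : ℕ) :
    IsWeightedShift K (0 : ι → ℕ) (1 : ((ι → ℕ) →ᵇ E) →L[ℚ_[p]] ((ι → ℕ) →ᵇ E)) := by
  intro c β
  rw [add_zero, smul_smul, inv_mul_cancel₀ (shiftWeight_ne_zero K β), one_smul]
  rfl

lemma IsWeightedShift.mul {K : ℕ} {σ τ : ι → ℕ}
    {A B : ((ι → ℕ) →ᵇ E) →L[ℚ_[p]] ((ι → ℕ) →ᵇ E)}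
    (hA : IsWeightedShift K σ A) (hB : IsWeightedShift K τ B) :
    IsWeightedShift K (σ + τ) (A * B) := by
  intro c β
  change A (B c) β = _
  rw [hA, hB, smul_smul (shiftWeight p K (β + σ)), mul_inv_cancel₀ (shiftWeight_ne_zero K _),
    one_smul, add_assoc]

lemma IsWeightedShift.pow {K : ℕ} {σ : ι → ℕ} {A : ((ι → ℕ) →ᵇ E) →L[ℚ_[p]] ((ι → ℕ) →ᵇ E)}
    (hA : IsWeightedShift K σ A) (k : ℕ) : IsWeightedShift K (k • σ) (A ^ k) := by
  induction k with
  | zero => rw [pow_zero, zero_smul]; exact IsWeightedShift.one K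
  | succ k ih => rw [pow_succ, succ_nsmul]; exact ih.mul hA

lemma IsWeightedShift.list_prod {K : ℕ} {κ : Type*} {σ : κ → ι → ℕ}
    {A : κ → ((ι → ℕ) →ᵇ E) →L[ℚ_[p]] ((ι → ℕ) →ᵇ E)} (hA : ∀ i, IsWeightedShift K (σ i) (A i))
    (l : List κ) : IsWeightedShift K (l.map σ).sum (l.map A).prod := by
  induction l with
  | nil => exact IsWeightedShift.one K
  | cons i l ih =>
    rw [List.map_cons, List.map_cons, List.sum_cons, List.prod_cons]
    exact (hA i).mul ih

/-- Dividing `f` by the weights gives a bounded family `c`, on which weighted shifts act so that the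
value of `∏ T_i^(α_i) c` at `0` is `f α`. Hence the Mahler sum of `f` is the value at `0` of `∏ (1 +
T_i)^(x_i) c`. Each `T_i^K` has norm at most `1/p`, so every factor is analytic near `0` by the
one-variable case. -/
lemma exists_analyticAt_mahler [DecidableEq ι] [IsUltrametricDist E] [CompleteSpace E] {K : ℕ} (hK : 0 < K)
    {f : (ι → ℕ) → E} {C : ℝ} (hf : ∀ β, (p : ℝ) ^ ((∑ i, β i) / K) * ‖f β‖ ≤ C)
    {l : List ι} (hl : l.Nodup) (hmem : ∀ i, i ∈ l) :
    ∃ (N : ℕ) (S : (ι → ℚ_[p]) → E), AnalyticAt ℚ_[p] S 0 ∧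
      ∀ x : ι → ℕ, (∀ i, p ^ N ∣ x i) → ∀ s : Multiset (ι → ℕ),
        (∀ (R : Type v) [Ring R] (u : ι → R), (l.map fun i => (1 + u i) ^ x i).prod
          = (s.map fun α => (l.map fun i => u i ^ α i).prod).sum) →
        S (fun i => x i) = (s.map f).sum := by
  let W := (ι → ℕ) →ᵇ E
  choose T hT hT1 using fun i : ι => exists_isWeightedShift (p := p) (E := E) K (Pi.single i 1)
  have hTK : ∀ i, ‖T i ^ K‖ ≤ (p : ℝ)⁻¹ := by
    intro i
    refine ContinuousLinearMap.opNorm_le_bound _ (by positivity) fun c => ?_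
    refine (BoundedContinuousFunction.norm_le (by positivity)).2 fun β => ?_
    have h1 : (∑ j, (β + K • (Pi.single i 1 : ι → ℕ)) j) / K = (∑ j, β j) / K + 1 := by
      have h2 : ∑ j, (β + K • (Pi.single i 1 : ι → ℕ)) j = ∑ j, β j + K := by
        simp [Finset.sum_add_distrib, Pi.single_apply]
      rw [h2, Nat.add_div_right _ hK]
    rw [(hT i).pow K c β, norm_smul, norm_smul, norm_inv, norm_shiftWeight, norm_shiftWeight, h1,
      pow_succ, ← mul_assoc, ← mul_assoc, inv_mul_cancel₀ (pow_ne_zero _ (inv_ne_zero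
        (one_pos.trans (one_lt_prime_cast (p := p))).ne')), one_mul]
    exact mul_le_mul_of_nonneg_left (c.norm_coe_le_norm _) (by positivity)
  choose N e he hes using fun i => exists_analyticAt_one_add_pow (p := p)
    (ContinuousLinearMap.norm_id_le (𝕜 := ℚ_[p]) (E := W)) (hT1 i) (hTK i)
  have hc : ∀ β, ‖(shiftWeight p K β)⁻¹ • f β‖ ≤ C := by
    intro β
    rw [norm_smul, norm_inv, norm_shiftWeight, ← inv_pow, inv_inv]
    exact hf β
  let c : W := BoundedContinuousFunction.ofNormedAddCommGroup
    (fun β => (shiftWeight p K β)⁻¹ • f β) continuous_of_discreteTopology C hc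
  let ev : (W →L[ℚ_[p]] W) →L[ℚ_[p]] E :=
    (BoundedContinuousFunction.evalCLM ℚ_[p] (0 : ι → ℕ)).comp
      (ContinuousLinearMap.apply ℚ_[p] W c)
  have hev : ∀ A, ev A = A c 0 := fun A => rfl
  have han : ∀ l : List ι, AnalyticAt ℚ_[p]
      (fun x : ι → ℚ_[p] => (l.map fun i => e i (x i)).prod) 0 := by
    intro l
    induction l with
    | nil => exact analyticAt_const
    | cons i l ih =>
      simp only [List.map_cons, List.prod_cons]
      refine AnalyticAt.mul ?_ ih
      exact AnalyticAt.comp (g := e i) (he i)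
        ((ContinuousLinearMap.proj (R := ℚ_[p]) (φ := fun _ : ι => ℚ_[p]) i).analyticAt 0)
  refine ⟨∑ i, N i, fun x => ev (l.map fun i => e i (x i)).prod, ev.analyticAt _ |>.comp (han l),
    fun x hx s hs => ?_⟩
  have h1 : (l.map fun i => e i (x i)).prod = (l.map fun i => (1 + T i) ^ x i).prod := by
    congr 1
    refine List.map_congr_left fun i _ => hes i (x i) (dvd_trans (pow_dvd_pow p ?_) (hx i))
    exact Finset.single_le_sum (f := N) (fun _ _ => Nat.zero_le _) (Finset.mem_univ i)
  change ev (l.map fun i => e i (x i)).prod = _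
  rw [h1, hs, map_multiset_sum, Multiset.map_map]
  congr 1
  refine Multiset.map_congr rfl fun α _ => ?_
  have h2 : (l.map fun i => α i • (Pi.single i 1 : ι → ℕ)).sum = α := by
    rw [← List.sum_toFinset _ hl]
    have : l.toFinset = Finset.univ := Finset.eq_univ_iff_forall.2 fun i => by simp [hmem i]
    rw [this]
    ext j
    simp [Finset.sum_apply, Pi.single_apply]
  have h3 := IsWeightedShift.list_prod (fun i => (hT i).pow (α i)) l c 0
  rw [Function.comp_apply, hev, h3, h2, zero_add]
  change _ • _ • (shiftWeight p K α)⁻¹ • f α = _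
  rw [smul_smul (shiftWeight p K α), mul_inv_cancel₀ (shiftWeight_ne_zero K α), one_smul]
  -- The weight at `0` is `p^0 = 1`.
  simp [shiftWeight]

end Shift

/-! ### Coordinates of the second kind on `GL_n(ℚ_p)` -/

section Coordinates

variable {p : ℕ} [Fact p.Prime] {n : ℕ}

/-- The entries of the ordered product of the matrices `1 + c_ij(ξ_ij) E_ij`. -/
def coordMap (c : Fin n × Fin n → ℚ_[p] → ℚ_[p]) :
    List (Fin n × Fin n) → (Fin n × Fin n → ℚ_[p]) → Fin n → Fin n → ℚ_[p]
  | [] => fun _ => entries 1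
  | ij :: l => fun ξ => coordMap c l ξ + c ij (ξ ij) • rowOp ij (coordMap c l ξ)

variable {c : Fin n × Fin n → ℚ_[p] → ℚ_[p]}

lemma analyticAt_coordMap (hc : ∀ ij, AnalyticAt ℚ_[p] (c ij) 0) (l : List (Fin n × Fin n)) :
    AnalyticAt ℚ_[p] (coordMap c l) 0 := by
  induction l with
  | nil => exact analyticAt_const
  | cons ij l ih =>
    have h1 : AnalyticAt ℚ_[p] (fun ξ : Fin n × Fin n → ℚ_[p] => c ij (ξ ij)) 0 :=
      AnalyticAt.comp (g := c ij) (hc ij) ((ContinuousLinearMap.proj (R := ℚ_[p])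
        (φ := fun _ : Fin n × Fin n => ℚ_[p]) ij).analyticAt 0)
    exact ih.add (h1.smul (AnalyticAt.comp (g := rowOp ij) ((rowOp ij).analyticAt _) ih))

lemma coordMap_zero (hc : ∀ ij, c ij 0 = 0) (l : List (Fin n × Fin n)) :
    coordMap c l 0 = entries 1 := by
  induction l with
  | nil => rfl
  | cons ij l ih =>
    change coordMap c l 0 + c ij 0 • _ = _
    rw [hc, zero_smul, add_zero, ih]

lemma coordMap_natCast {x : Fin n × Fin n → ℕ} (l : List (Fin n × Fin n))
    (hc : ∀ ij, ((generator p ij ^ x ij : GL (Fin n) ℚ_[p]) : Matrix (Fin n) (Fin n) ℚ_[p])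
      = 1 + c ij (x ij) • Matrix.single ij.1 ij.2 (1 : ℚ_[p])) :
    coordMap c l (fun ij => x ij) = entries (l.map fun ij => generator p ij ^ x ij).prod := by
  induction l with
  | nil => rfl
  | cons ij l ih =>
    rw [List.map_cons, List.prod_cons, entries_generator_pow_mul (hc ij), ← ih]
    rfl

/-- As each `c ij` vanishes at `0`, the product rule retains only the derivative of `c ij` times
`E_ij`; the factors contribute additively. -/
lemma hasStrictFDerivAt_coordMap (hc : ∀ ij, c ij 0 = 0) {a : Fin n × Fin n → ℚ_[p]}
    (ha : ∀ ij, HasStrictDerivAt (c ij) (a ij) 0) (l : List (Fin n × Fin n)) :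
    HasStrictFDerivAt (coordMap c l)
      (l.map fun ij => (ContinuousLinearMap.proj (R := ℚ_[p])
        (φ := fun _ : Fin n × Fin n => ℚ_[p]) ij).smulRight
          (a ij • rowOp ij (entries (1 : GL (Fin n) ℚ_[p])))).sum 0 := by
  induction l with
  | nil => exact hasStrictFDerivAt_const _ _
  | cons ij l ih =>
    have h1 : HasStrictFDerivAt (fun ξ : Fin n × Fin n → ℚ_[p] => c ij (ξ ij))
        (a ij • ContinuousLinearMap.proj (R := ℚ_[p])
          (φ := fun _ : Fin n × Fin n => ℚ_[p]) ij) 0 :=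
      HasStrictDerivAt.comp_hasStrictFDerivAt (h₂ := c ij)
        (f := fun ξ : Fin n × Fin n → ℚ_[p] => ξ ij) 0 (ha ij)
        (ContinuousLinearMap.proj (R := ℚ_[p])
          (φ := fun _ : Fin n × Fin n => ℚ_[p]) ij).hasStrictFDerivAt
    have h2 := ih.add (h1.smul ((rowOp ij).hasStrictFDerivAt.comp 0 ih))
    refine h2.congr_fderiv ?_
    rw [List.map_cons, List.sum_cons, add_comm]
    congr 1
    ext1 ξ
    simp [hc, coordMap_zero hc, smul_smul, mul_comm]

lemma rowOp_entries_one (ij : Fin n × Fin n) :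
    rowOp ij (entries (1 : GL (Fin n) ℚ_[p])) = fun i j => if ij = (i, j) then 1 else 0 := by
  have h1 : rowOp ij (entries (1 : GL (Fin n) ℚ_[p]))
      = (Matrix.single ij.1 ij.2 1 * 1 : Matrix (Fin n) (Fin n) ℚ_[p]) := rfl
  rw [h1, mul_one]
  ext i j
  rw [Matrix.single_apply]
  obtain ⟨a, b⟩ := ij
  simp [Prod.ext_iff]

lemma exists_coordEquiv {a : Fin n × Fin n → ℚ_[p]} (ha : ∀ ij, a ij ≠ 0)
    {l : List (Fin n × Fin n)} (hl : l.Nodup) (hmem : ∀ ij, ij ∈ l) :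
    ∃ T : (Fin n × Fin n → ℚ_[p]) ≃L[ℚ_[p]] (Fin n → Fin n → ℚ_[p]),
      (T : (Fin n × Fin n → ℚ_[p]) →L[ℚ_[p]] (Fin n → Fin n → ℚ_[p]))
        = (l.map fun ij => (ContinuousLinearMap.proj (R := ℚ_[p])
          (φ := fun _ : Fin n × Fin n => ℚ_[p]) ij).smulRight
            (a ij • rowOp ij (entries (1 : GL (Fin n) ℚ_[p])))).sum := by
  let T₀ : (Fin n × Fin n → ℚ_[p]) ≃ₗ[ℚ_[p]] (Fin n → Fin n → ℚ_[p]) :=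
    { toFun := fun ξ i j => ξ (i, j) * a (i, j)
      invFun := fun X ij => X ij.1 ij.2 * (a ij)⁻¹
      map_add' := fun ξ η => by ext i j; exact add_mul _ _ _
      map_smul' := fun r ξ => by ext i j; exact mul_assoc _ _ _
      left_inv := fun ξ => by ext ij; exact mul_inv_cancel_right₀ (ha ij) _
      right_inv := fun X => by ext i j; exact inv_mul_cancel_right₀ (ha (i, j)) _ }
  refine ⟨T₀.toContinuousLinearEquiv, ?_⟩
  have : l.toFinset = Finset.univ := Finset.eq_univ_iff_forall.2 fun i => by simp [hmem i]
  rw [← List.sum_toFinset _ hl, this]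
  ext1 ξ
  funext i j
  change ξ (i, j) * a (i, j) = _
  simp [rowOp_entries_one, Finset.sum_apply]

end Coordinates

/-! ### The vectors of `Π^(h)` are locally analytic -/

section Converse

variable {p : ℕ} [Fact p.Prime] {n : ℕ}
variable {L : Type u} [NontriviallyNormedField L] [NormedAlgebra ℚ_[p] L]
variable {E : Type v} [NormedAddCommGroup E] [NormedSpace L E] [IsUltrametricDist E]
  [CompleteSpace E] {ρ : Representation L (GL (Fin n) ℚ_[p]) E}

/-- Tuples of natural numbers are dense in `ℤ_p^ι`, so a given `ξ` near `0` is a limit of tuples of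
multiples of `p^M`. The embedding `φ` forces the corresponding elements to converge to `g`, and
continuity of `f` and `S` concludes. -/
lemma eq_of_natCast {ι X Y : Type*} [Fintype ι] [TopologicalSpace X] [TopologicalSpace Y] [T2Space Y]
    {Γ : Type*} [TopologicalSpace Γ] {φ : Γ → X} (hφ : IsEmbedding φ) {f : Γ → Y}
    (hf : Continuous f) {Ψ : (ι → ℚ_[p]) → X} {S : (ι → ℚ_[p]) → Y}
    (hΨ : ∀ᶠ ξ in 𝓝 0, ContinuousAt Ψ ξ) (hS : ∀ᶠ ξ in 𝓝 0, ContinuousAt S ξ) {N : ℕ}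
    (hnat : ∀ x : ι → ℕ, (∀ i, p ^ N ∣ x i) → ∃ g, φ g = Ψ (fun i => x i) ∧ f g = S fun i => x i) :
    ∀ᶠ ξ in 𝓝 0, ∀ g, φ g = Ψ ξ → f g = S ξ := by
  obtain ⟨δ, hδ, hball⟩ := Metric.eventually_nhds_iff.1 (hΨ.and hS)
  obtain ⟨N₁, hN₁⟩ : ∃ N₁ : ℕ, ((p : ℝ)⁻¹) ^ N₁ < δ :=
    exists_pow_lt_of_lt_one hδ (inv_lt_one_of_one_lt₀ one_lt_prime_cast)
  have hp0 : (p : ℚ_[p]) ≠ 0 := by exact_mod_cast (Fact.out : p.Prime).ne_zero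
  have hp0' : (0 : ℝ) < p := one_pos.trans one_lt_prime_cast
  set M := N + N₁ with hM
  refine Metric.eventually_nhds_iff.2 ⟨((p : ℝ)⁻¹) ^ M, by positivity, fun ξ hξ g hg => ?_⟩
  rw [dist_zero_right] at hξ
  let z : ι → ℤ_[p] := fun i => ⟨((p : ℚ_[p]) ^ M)⁻¹ * ξ i, by
    rw [norm_mul, norm_inv, norm_pow, Padic.norm_p]
    exact (inv_mul_le_iff₀ (by positivity)).2 (by
      rw [mul_one]; exact (norm_le_pi_norm ξ i).trans hξ.le)⟩
  let κ : (ι → ℤ_[p]) → ι → ℚ_[p] := fun t i => (p : ℚ_[p]) ^ M * (t i : ℚ_[p])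
  have hκ : Continuous κ := by
    refine continuous_pi fun i => ?_
    have h1 : Continuous fun t : ι → ℤ_[p] => (t i : ℚ_[p]) :=
      continuous_subtype_val.comp (continuous_apply i)
    exact h1.const_mul _
  have hκz : κ z = ξ := by
    funext i
    exact mul_inv_cancel_left₀ (pow_ne_zero _ hp0) _
  have hd : DenseRange (Pi.map fun (_ : ι) (k : ℕ) => (k : ℤ_[p])) :=
    DenseRange.piMap fun _ => PadicInt.denseRange_natCast
  have hne := comap_neBot_iff_frequently.2 (mem_closure_iff_frequently.1 (hd z))
  have hκt : Tendsto (fun k : ι → ℕ => κ (Pi.map (fun (_ : ι) (k : ℕ) => (k : ℤ_[p])) k))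
      (comap (Pi.map fun (_ : ι) (k : ℕ) => (k : ℤ_[p])) (𝓝 z)) (𝓝 ξ) := by
    rw [← hκz]
    exact (hκ.tendsto z).comp tendsto_comap
  have hξδ := hball (y := ξ) (by
    rw [dist_zero_right]
    refine hξ.trans_le (le_trans ?_ hN₁.le)
    exact pow_le_pow_of_le_one (by positivity) (inv_lt_one_of_one_lt₀ one_lt_prime_cast).le
      (Nat.le_add_left _ _))
  have hcast : ∀ k : ι → ℕ, κ (Pi.map (fun (_ : ι) (k : ℕ) => (k : ℤ_[p])) k)
      = fun i => ((p ^ M * k i : ℕ) : ℚ_[p]) := fun k => by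
    funext i
    simp [κ]
  choose γ hγ hγ' using fun k : ι → ℕ => hnat (fun i => p ^ M * k i) fun i =>
    (pow_dvd_pow p (Nat.le_add_right N N₁)).mul_right _
  have h1 : Tendsto γ (comap (Pi.map fun (_ : ι) (k : ℕ) => (k : ℤ_[p])) (𝓝 z)) (𝓝 g) := by
    rw [hφ.tendsto_nhds_iff, hg]
    refine (hξδ.1.tendsto.comp hκt).congr fun k => ?_
    rw [Function.comp_apply, Function.comp_apply, hcast, hγ]
  refine tendsto_nhds_unique ((hf.tendsto g).comp h1) ((hξδ.2.tendsto.comp hκt).congr fun k => ?_)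
  rw [Function.comp_apply, Function.comp_apply, hcast, hγ']

lemma nodup_index : (List.finRange n ×ˢ List.finRange n).Nodup :=
  (List.nodup_finRange n).product (List.nodup_finRange n)

lemma mem_index (ij : Fin n × Fin n) : ij ∈ List.finRange n ×ˢ List.finRange n := by
  simp [List.product, SProd.sprod]

/-- Taking `K = ⌈1 / r_h⌉` gives `⌊d / K⌋ ≤ r_h d`. Rounding down keeps the weights integral powers
of `p`, hence scalars of `ℚ_p`. -/
lemma exists_natDiv_weight_le (h : ℕ) : ∃ K : ℕ, 0 < K ∧ ∀ d : ℕ,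
    (p : ℝ) ^ (d / K) ≤ (p : ℝ) ^ (radius p h * d) := by
  have hr : 0 < radius p h := radius_pos h
  refine ⟨⌈(radius p h)⁻¹⌉₊, Nat.ceil_pos.2 (inv_pos.2 hr), fun d => ?_⟩
  rw [← Real.rpow_natCast]
  refine Real.rpow_le_rpow_of_exponent_le one_lt_prime_cast.le ?_
  refine Nat.cast_div_le.trans ?_
  rw [div_eq_inv_mul]
  refine mul_le_mul_of_nonneg_right (inv_le_of_inv_le₀ hr (Nat.le_ceil _)) (Nat.cast_nonneg d)

/-- On products of powers of the generators, `g v` is the Mahler sum of the `b^α v`, a power series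
`S` in the exponents. The coordinates have invertible derivative at `0`, so `F` is `S` composed with
their analytic local inverse. -/
lemma exists_analyticAt_one (hρ : IsContinuousRep ρ) {h : ℕ} {v : E} (hv : v ∈ PiH ρ h) :
    let _ : NormedSpace ℚ_[p] E := NormedSpace.restrictScalars ℚ_[p] L E
    ∃ F : (Fin n → Fin n → ℚ_[p]) → E, AnalyticAt ℚ_[p] F (entries 1) ∧
      ∀ᶠ g in 𝓝 (1 : GL (Fin n) ℚ_[p]), ρ g v = F (entries g) := by
  intro _
  obtain ⟨K, hK, hKle⟩ := exists_natDiv_weight_le (p := p) h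
  obtain ⟨N, S, hS, hSx⟩ := exists_analyticAt_mahler (p := p) hK (f := fun α => bOp ρ α v)
    (C := normH ρ h v) (fun α => (mul_le_mul_of_nonneg_right (hKle _) (norm_nonneg _)).trans
      (le_normH hv α)) (nodup_index (n := n)) mem_index
  choose N' c hc hc0 hca hcx using exists_generator_pow (p := p) (n := n)
  choose a ha0 ha using hca
  set l := List.finRange n ×ˢ List.finRange n with hl
  have hΨ := analyticAt_coordMap hc l
  have hΨ0 := coordMap_zero hc0 l
  obtain ⟨T, hT⟩ := exists_coordEquiv ha0 (nodup_index (n := n)) mem_index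
  have hD := hasStrictFDerivAt_coordMap hc0 ha l
  rw [← hT] at hD
  have hcont : Continuous fun g : GL (Fin n) ℚ_[p] => ρ g v := hρ.comp (Continuous.prodMk_left v)
  have hev := eq_of_natCast (p := p) isEmbedding_entries hcont
    (hΨ.eventually_analyticAt.mono fun _ h => h.continuousAt)
    (hS.eventually_analyticAt.mono fun _ h => h.continuousAt) (N := N + ∑ ij, N' ij) (by
      intro x hx
      refine ⟨(l.map fun ij => generator p ij ^ x ij).prod, (coordMap_natCast l fun ij =>
        hcx ij _ (dvd_trans (pow_dvd_pow p ?_) (hx ij))).symm, ?_⟩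
      · exact (Finset.single_le_sum (f := N') (fun _ _ => Nat.zero_le _)
          (Finset.mem_univ ij)).trans (Nat.le_add_left _ _)
      · obtain ⟨s, hs⟩ := exists_prod_one_add_pow_expansion.{v} x (nodup_index (n := n))
        rw [hSx x (fun ij => dvd_trans (pow_dvd_pow p (Nat.le_add_right _ _)) (hx ij)) s hs]
        have h1 := hs (Module.End L E) fun ij => ρ (generator p ij) - 1
        simp only [add_sub_cancel] at h1
        rw [map_list_prod, List.map_map]
        simp only [Function.comp_def, map_pow]
        rw [hl, h1]
        change LinearMap.applyₗ v _ = _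
        rw [map_multiset_sum, Multiset.map_map]
        rfl)
  let R := hD.toOpenPartialHomeomorph
  have hR0 : (0 : Fin n × Fin n → ℚ_[p]) ∈ R.source := hD.mem_toOpenPartialHomeomorph_source
  have hRc : ∀ ξ, R ξ = coordMap c l ξ := fun ξ => rfl
  have hsymm0 : R.symm (entries 1) = 0 := by
    rw [← hΨ0, ← hRc, R.left_inv hR0]
  have hRan : AnalyticAt ℚ_[p] R.symm (entries 1) := by
    have := R.analyticAt_symm' (i := T) hR0 hΨ hD.hasFDerivAt.fderiv
    rwa [hRc, hΨ0] at this
  refine ⟨S ∘ R.symm, AnalyticAt.comp (by rwa [hsymm0]) hRan, ?_⟩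
  have ht1 : (entries 1 : Fin n → Fin n → ℚ_[p]) ∈ R.target := by
    rw [← hΨ0]; exact R.map_source hR0
  have h2 : ∀ᶠ X in 𝓝 (entries 1 : Fin n → Fin n → ℚ_[p]),
      ∀ g, entries g = X → ρ g v = S (R.symm X) := by
    have h3 := hRan.continuousAt.tendsto
    rw [hsymm0] at h3
    filter_upwards [h3.eventually hev, R.open_target.mem_nhds ht1] with X hX hXt g hg
    refine hX g ?_
    rw [hg, ← hRc, R.right_inv hXt]
  filter_upwards [(isEmbedding_entries.continuous.tendsto 1).eventually h2] with g hg
  exact hg g rfl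

/-- Analyticity at `1` is moved to `g₀` by `g v = g₀ ((g₀⁻¹ g) v)`, left translation and `ρ g₀` both
being continuous and linear. -/
lemma mem_analyticSubmodule (hρ : IsContinuousRep ρ) {h : ℕ} {v : E} (hv : v ∈ PiH ρ h) :
    v ∈ analyticSubmodule ρ := by
  let _ : NormedSpace ℚ_[p] E := NormedSpace.restrictScalars ℚ_[p] L E
  intro g₀
  obtain ⟨F, hF, hFg⟩ := exists_analyticAt_one hρ hv
  let T : E →L[ℚ_[p]] E :=
    { toFun := ρ g₀
      map_add' := map_add (ρ g₀)
      map_smul' := fun a e => map_smul (ρ g₀) (algebraMap ℚ_[p] L a) e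
      cont := hρ.continuous_apply g₀ }
  let Λ : (Fin n → Fin n → ℚ_[p]) →L[ℚ_[p]] (Fin n → Fin n → ℚ_[p]) :=
    leftMul ((g₀⁻¹ : GL (Fin n) ℚ_[p]) : Matrix (Fin n) (Fin n) ℚ_[p])
  have hΛ : ∀ g, Λ (entries g) = entries (g₀⁻¹ * g) := leftMul_entries _
  refine ⟨fun X => T (F (Λ X)), ?_, ?_⟩
  · have hF' : AnalyticAt ℚ_[p] F (Λ (entries g₀)) := by rw [hΛ, inv_mul_cancel]; exact hF
    exact AnalyticAt.comp (g := T) (T.analyticAt _) (AnalyticAt.comp hF' (Λ.analyticAt _))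
  · have ht : Tendsto (fun g => g₀⁻¹ * g) (𝓝 g₀) (𝓝 1) := by
      have := (continuous_const_mul g₀⁻¹).tendsto g₀
      rwa [inv_mul_cancel] at this
    filter_upwards [ht.eventually hFg] with g hg
    change ρ g v = ρ g₀ (F (Λ (entries g)))
    rw [hΛ, ← hg, ← Module.End.mul_apply, ← map_mul, mul_inv_cancel_left]

end Converse

/-! ### The universal unitary completion of the space of locally analytic vectors -/

section Completion

variable {p : ℕ} [Fact p.Prime] {n : ℕ}

lemma normH_smul {L : Type u} [NontriviallyNormedField L] {E : Type v} [NormedAddCommGroup E]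
    [NormedSpace L E] {ρ : Representation L (GL (Fin n) ℚ_[p]) E} (h : ℕ) (c : L) (e : E) : normH ρ h (c • e) = ‖c‖ * normH ρ h e := by
  rw [normH, normH, Real.mul_iSup_of_nonneg (norm_nonneg c)]
  congr 1; ext α
  rw [map_smul, norm_smul]; ring

variable {L : Type u} [NontriviallyNormedField L] [NormedAlgebra ℚ_[p] L]

variable (p L) in
lemma natCast_prime_ne_zero : (p : L) ≠ 0 := by
  rw [← norm_pos_iff, norm_natCast_prime]
  exact inv_pos.2 (one_pos.trans one_lt_prime_cast)

variable (p L) in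
lemma norm_natCast_prime_lt_one : ‖(p : L)‖ < 1 := by
  rw [norm_natCast_prime]
  exact inv_lt_one_of_one_lt₀ one_lt_prime_cast

variable {E : Type v} [NormedAddCommGroup E] [NormedSpace L E]
  {ρ : Representation L (GL (Fin n) ℚ_[p]) E}

lemma exists_normH_pow_smul_le (h : ℕ) (e : E) {ε : ℝ} (hε : 0 < ε) :
    ∃ k : ℕ, normH ρ h ((p : L) ^ k • e) ≤ ε := by
  have h1 : Tendsto (fun k : ℕ => ‖(p : L)‖ ^ k * normH ρ h e) atTop (𝓝 0) := by
    simpa using (tendsto_pow_atTop_nhds_zero_of_lt_one (norm_nonneg _)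
      (norm_natCast_prime_lt_one p L)).mul_const (normH ρ h e)
  obtain ⟨k, hk⟩ := (h1.eventually (gt_mem_nhds hε)).exists
  refine ⟨k, ?_⟩
  rw [normH_smul, norm_pow]
  exact hk.le

lemma AnalyticVectors.incl_injective : Function.Injective (AnalyticVectors.incl ρ) :=
  Subtype.val_injective

lemma AnalyticVectors.incl_analyticRep (g : GL (Fin n) ℚ_[p]) (a : AnalyticVectors ρ) :
    AnalyticVectors.incl ρ (analyticRep ρ g a) = ρ g (AnalyticVectors.incl ρ a) := rfl

lemma AnalyticVectors.exists_incl_eq {e : E} (he : e ∈ analyticSubmodule ρ) :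
    ∃ a : AnalyticVectors ρ, AnalyticVectors.incl ρ a = e := ⟨(⟨e, he⟩ : analyticSubmodule ρ), rfl⟩

lemma AnalyticVectors.incl_mem (a : AnalyticVectors ρ) :
    AnalyticVectors.incl ρ a ∈ analyticSubmodule ρ := Subtype.prop _

/-! ### Open lattices of Π^an and boundedness on `latticeM`. -/

section Lattice

variable [IsUltrametricDist L]

lemma analyticRep_mem_latticeM {h : ℕ} {b : AnalyticVectors ρ}
    (hb : AnalyticVectors.incl ρ b ∈ PiH ρ h) (hb1 : normH ρ h (AnalyticVectors.incl ρ b) ≤ 1)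
    (g : GL (Fin n) ℚ_[p]) : analyticRep ρ g b ∈ latticeM ρ h :=
  Submodule.subset_span ⟨g, b, hb, hb1, rfl⟩

lemma IsOpenInEachPiH.isOpen {W : Submodule (OL L) (AnalyticVectors ρ)}
    (hW : IsOpenInEachPiH ρ W) : IsOpen (W : Set (AnalyticVectors ρ)) :=
  fun _ ha => ⟨W, hW, fun _ hb => W.add_mem ha hb⟩

/-- A set that contains, around each of its points, a multiple of an open lattice, is open. -/
lemma IsOpenInEachPiH.isOpen_of_forall {W : Submodule (OL L) (AnalyticVectors ρ)}
    (hW : IsOpenInEachPiH ρ W) {U : Set (AnalyticVectors ρ)}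
    (hU : ∀ a ∈ U, ∃ k : ℕ, ∀ m ∈ W, a + (p : L) ^ k • m ∈ U) : IsOpen U := by
  intro a ha
  obtain ⟨k, hk⟩ := hU a ha
  have hpk := pow_ne_zero k (natCast_prime_ne_zero p L)
  refine ⟨W.map (((p : L) ^ k • (LinearMap.id : AnalyticVectors ρ →ₗ[L] _)).restrictScalars (OL L)),
    fun h hh => ?_, ?_⟩
  · obtain ⟨ε, hε, hball⟩ := hW h hh
    refine ⟨‖(p : L) ^ k‖ * ε, mul_pos (norm_pos_iff.2 hpk) hε, fun b hb hb1 => ?_⟩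
    refine ⟨((p : L) ^ k)⁻¹ • b, hball _ ?_ ?_, smul_inv_smul₀ hpk b⟩
    · rw [map_smul]; exact Submodule.smul_mem _ _ hb
    · rw [map_smul, normH_smul, norm_inv]
      exact (inv_mul_le_iff₀ (norm_pos_iff.2 hpk)).2 hb1
  · rintro _ ⟨b, hb, rfl⟩
    exact hk b hb

/-- Continuity of `f` gives `N (f b) < 1` on `p^k Π_0^(h)` for some `k`. Invariance of `N` spreads
the resulting bound over all translates, and the ultrametric inequality over their span. -/
lemma exists_bound_latticeM {h : ℕ} (hh : 1 ≤ h) {B : Type w} [AddCommGroup B] [Module L B]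
    [TopologicalSpace B] (β : Representation L (GL (Fin n) ℚ_[p]) B) (N : Seminorm L B)
    (hadd : ∀ a b, N (a + b) ≤ max (N a) (N b))
    (hopen : ∀ U : Set B, IsOpen U ↔ ∀ a ∈ U, ∃ ε : ℝ, 0 < ε ∧ ∀ b : B, N (b - a) < ε → b ∈ U)
    (hinv : ∀ (g : GL (Fin n) ℚ_[p]) (a : B), N (β g a) = N a) (f : AnalyticVectors ρ →L[L] B)
    (hf : ∀ (g : GL (Fin n) ℚ_[p]) (a : AnalyticVectors ρ), f (analyticRep ρ g a) = β g (f a)) :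
    ∃ C : ℝ, ∀ a ∈ latticeM ρ h, N (f a) ≤ C := by
  have hU : IsOpen {b : B | N b < 1} := (hopen _).2 fun a ha => ⟨1, one_pos, fun b hb => by
    have := hadd (b - a) a
    rw [sub_add_cancel] at this
    exact this.trans_lt (max_lt hb ha)⟩
  obtain ⟨W, hW, hWU⟩ := (hU.preimage f.continuous) 0 (by
    change N (f 0) < 1
    rw [map_zero, map_zero]
    exact one_pos)
  obtain ⟨ε, hε, hball⟩ := hW h hh
  obtain ⟨k, hk⟩ : ∃ k : ℕ, ‖(p : L)‖ ^ k < ε :=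
    exists_pow_lt_of_lt_one hε (norm_natCast_prime_lt_one p L)
  have hpk := norm_pos_iff.2 (pow_ne_zero k (natCast_prime_ne_zero p L))
  refine ⟨‖(p : L) ^ k‖⁻¹, fun a ha => ?_⟩
  refine Submodule.span_induction (p := fun a _ => N (f a) ≤ ‖(p : L) ^ k‖⁻¹) ?_ ?_ ?_ ?_ ha
  · rintro _ ⟨g, b, hb, hb1, rfl⟩
    rw [hf, hinv]
    have hbW : (p : L) ^ k • b ∈ W := by
      refine hball _ ?_ ?_
      · rw [map_smul]; exact Submodule.smul_mem _ _ hb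
      · rw [map_smul, normH_smul, norm_pow]
        exact (mul_le_of_le_one_right (by positivity) hb1).trans hk.le
    have h1 : N (f (0 + (p : L) ^ k • b)) < 1 := hWU _ hbW
    rw [zero_add, map_smul, map_smul_eq_mul] at h1
    rw [← mul_one ‖(p : L) ^ k‖⁻¹]
    exact (le_inv_mul_iff₀ hpk).2 h1.le
  · rw [map_zero, map_zero]; positivity
  · intro a b _ _ ha hb
    rw [map_add]
    exact (hadd _ _).trans (max_le ha hb)
  · intro c a _ ha
    have h1 : f (c • a) = (c : L) • f a := map_smul f (c : L) a
    rw [h1, map_smul_eq_mul]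
    exact (mul_le_of_le_one_left (apply_nonneg N _) (mem_OL.1 c.2)).trans ha

end Lattice

variable [IsUltrametricDist E] [CompleteSpace E]

lemma mem_analyticSubmodule_iff (hρ : IsContinuousRep ρ) (e : E) :
    e ∈ analyticSubmodule ρ ↔ ∃ h ≥ 1, e ∈ PiH ρ h := by
  refine ⟨fun he => ?_, fun ⟨h, _, he⟩ => mem_analyticSubmodule hρ he⟩
  obtain ⟨h, hh, hh1⟩ := ((eventually_mem_PiH hρ he).and (eventually_ge_atTop 1)).exists
  have := hh.1 1 (one_mem _)
  rw [map_one] at this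
  exact ⟨h, hh1, this⟩

variable [IsUltrametricDist L]

/-- For `h' ≤ h` the unit ball of Π^(h') lies in that of Π^(h). For `h' = h + k` coherence and the
open mapping argument apply. -/
lemma isOpenInEachPiH_latticeM (hρ : IsContinuousRep ρ) {m : ℕ} (hm : IsCoherentFrom ρ m) {h : ℕ}
    (hh : m ≤ h) : IsOpenInEachPiH ρ (latticeM ρ h) := by
  intro h' _
  rcases le_total h' h with hle | hle
  · refine ⟨1, one_pos, fun a ha ha1 => ?_⟩
    have := analyticRep_mem_latticeM (PiH_mono hle ha) ((normH_anti hle ha).trans ha1) 1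
    rwa [map_one] at this
  · obtain ⟨k, rfl⟩ := Nat.exists_eq_add_of_le hle
    obtain ⟨ε, hε, hball⟩ := hm.exists_ball_subset hρ hh k
      ((latticeM ρ h).toAddSubgroup.map (AnalyticVectors.incl ρ).toAddMonoidHom) (by
        intro g e he he1
        obtain ⟨b, rfl⟩ := AnalyticVectors.exists_incl_eq (mem_analyticSubmodule hρ he)
        exact ⟨analyticRep ρ g b, analyticRep_mem_latticeM he he1 g, rfl⟩)
    refine ⟨ε, hε, fun a ha ha1 => ?_⟩
    obtain ⟨b, hb, hba⟩ := hball _ ha ha1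
    rwa [← AnalyticVectors.incl_injective hba]

lemma IsOpenInEachPiH.exists_pow_smul_mem (hρ : IsContinuousRep ρ)
    {W : Submodule (OL L) (AnalyticVectors ρ)} (hW : IsOpenInEachPiH ρ W) (a : AnalyticVectors ρ) :
    ∃ k : ℕ, (p : L) ^ k • a ∈ W := by
  obtain ⟨h, hh, ha⟩ := (mem_analyticSubmodule_iff hρ _).1 a.incl_mem
  obtain ⟨ε, hε, hball⟩ := hW h hh
  obtain ⟨k, hk⟩ := exists_normH_pow_smul_le (ρ := ρ) h (AnalyticVectors.incl ρ a) hε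
  refine ⟨k, hball _ ?_ ?_⟩
  · rw [map_smul]; exact Submodule.smul_mem _ _ ha
  · rwa [map_smul]

lemma IsOpenInEachPiH.span_eq_top (hρ : IsContinuousRep ρ)
    {W : Submodule (OL L) (AnalyticVectors ρ)} (hW : IsOpenInEachPiH ρ W) :
    Submodule.span L (W : Set (AnalyticVectors ρ)) = ⊤ := by
  refine (Submodule.eq_top_iff').2 fun a => ?_
  obtain ⟨k, hk⟩ := hW.exists_pow_smul_mem hρ a
  rw [← inv_smul_smul₀ (pow_ne_zero k (natCast_prime_ne_zero p L)) a]
  exact Submodule.smul_mem _ _ (Submodule.subset_span hk)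

/-- The orbit map of `a` is continuous at `1` in a single Π^(h), where the trace of `W` contains a
ball. -/
lemma IsOpenInEachPiH.eventually_sub_mem (hρ : IsContinuousRep ρ)
    {W : Submodule (OL L) (AnalyticVectors ρ)} (hW : IsOpenInEachPiH ρ W) (a : AnalyticVectors ρ) :
    ∀ᶠ g in 𝓝 (1 : GL (Fin n) ℚ_[p]), analyticRep ρ g a - a ∈ W := by
  obtain ⟨h, ⟨hmem, hnorm⟩, hh⟩ :=
    ((eventually_mem_PiH hρ a.incl_mem).and (eventually_ge_atTop 1)).exists
  obtain ⟨ε, hε, hball⟩ := hW h hh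
  filter_upwards [hnorm ε hε, isOpen_H.mem_nhds (one_mem (H p n))] with g hg hgH
  have ha := hmem 1 (one_mem _)
  rw [map_one, Module.End.one_apply] at ha
  refine hball _ ?_ ?_
  · rw [map_sub, AnalyticVectors.incl_analyticRep]
    exact Submodule.sub_mem _ (hmem g hgH) ha
  · rwa [map_sub, AnalyticVectors.incl_analyticRep]

theorem exists_isUniversalUnitaryCompletion_latticeM (hρ : IsContinuousRep ρ) {m : ℕ}
    (hm : IsCoherentFrom ρ m) {h : ℕ} (hh : m ≤ h) :
    ∃ ι : AnalyticVectors ρ →L[L] LatticeCompletion p (latticeM ρ h),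
      (∀ a : latticeM ρ h, ι a = LatticeCompletion.int p (latticeM ρ h)
        (AdicCompletion.of (idealP p L) (latticeM ρ h) a)) ∧
      IsUniversalUnitaryCompletion.{u, v, w} (analyticRep ρ)
        (latticeCompletionRep p (latticeM ρ h) (analyticRep ρ) (latticeM_stable ρ h)) ι := by
  have hW := isOpenInEachPiH_latticeM hρ hm hh
  have hp0 := natCast_prime_ne_zero p L
  have hp1 := norm_natCast_prime_lt_one p L
  have hM := hW.exists_pow_smul_mem hρ
  refine ⟨⟨LatticeCompletion.ofSpace hp0 hp1 hM,
    LatticeCompletion.continuous_ofSpace hp0 hp1 hM fun U hU => hW.isOpen_of_forall hU⟩,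
    fun a => LatticeCompletion.ofSpace_coe hp0 hp1 hM a, ?_⟩
  exact LatticeCompletion.isUniversalUnitaryCompletion hp0 hp1 hM (analyticRep ρ)
    (latticeM_stable ρ h) (hW.eventually_sub_mem hρ)
    (fun B _ _ _ β N hadd hopen hinv f hf =>
      exists_bound_latticeM (hm.1.trans hh) β N hadd hopen hinv f hf) _ fun _ => rfl

end Completion

end

end UnitaryCompletion

open UnitaryCompletion in
theorem mainTheorem12
    {p : ℕ} [Fact p.Prime] {n : ℕ}
    {L : Type u} [NontriviallyNormedField L] [IsUltrametricDist L] [NormedAlgebra ℚ_[p] L]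
    [FiniteDimensional ℚ_[p] L]
    {E : Type v} [NormedAddCommGroup E] [NormedSpace L E] [IsUltrametricDist E] [CompleteSpace E]
    (ρ : Representation L (GL (Fin n) ℚ_[p]) E) (hρ : IsContinuousRep ρ)
    (hadm : IsAdmissible hρ) (hcentral : HasCentralCharacter ρ) (hcoh : IsCoherent ρ) :
    (∀ e : E, e ∈ analyticSubmodule ρ ↔ ∃ h ≥ 1, e ∈ PiH ρ h) ∧
    HasUniversalUnitaryCompletion.{u, v, w} (analyticRep ρ) ∧
    ∀ m : ℕ, IsCoherentFrom ρ m → ∀ h ≥ m,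
      IsOpen (latticeM ρ h : Set (AnalyticVectors ρ)) ∧
      Submodule.span L (latticeM ρ h : Set (AnalyticVectors ρ)) = ⊤ ∧
      ∃ ι : AnalyticVectors ρ →L[L] LatticeCompletion p (latticeM ρ h),
        (∀ a : latticeM ρ h, ι a = LatticeCompletion.int p (latticeM ρ h)
          (AdicCompletion.of (idealP p L) (latticeM ρ h) a)) ∧
        IsUniversalUnitaryCompletion.{u, v, w} (analyticRep ρ)
          (latticeCompletionRep p (latticeM ρ h) (analyticRep ρ) (latticeM_stable ρ h)) ι := by
  refine ⟨mem_analyticSubmodule_iff hρ, ?_, fun m hm h hh => ?_⟩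
  · obtain ⟨m, hm⟩ := hcoh
    obtain ⟨ι, -, hι⟩ := exists_isUniversalUnitaryCompletion_latticeM.{u, v, w} hρ hm le_rfl
    exact ⟨_, _, _, _, _, ι, hι⟩
  · have hW := isOpenInEachPiH_latticeM hρ hm hh
    exact ⟨hW.isOpen, hW.span_eq_top hρ, exists_isUniversalUnitaryCompletion_latticeM hρ hm hh⟩
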